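/- Let $s>\frac32$ and let $f_0\in H^s(\mathbf R)$ (continuous representative, hence $C^1$) satisfy $f_0\ge 0$ and $\int_{\mathbf R} f_0\,dv=1$. Define $T_0\in(0,+\infty]$ by $$\Big(\frac{2\pi}{T_0}\Big)^2=\max\Big\{0,\ \max_{c\in S}\int_{\mathbf R}\frac{f_0'(v)}{v-c}\,dv\Big\},\qquad S=\{c\in\mathbf R: f_0'(c)=0\},$$ with $T_0=+\infty$ if the right-hand side is $0$. For $0<T<T_0$ consider the Vlasov-Poisson system with period $T$ in $x$, $$\partial_t f+v\,\partial_x f-E\,\partial_v f=0,\qquad \partial_x E=1-\int_{\mathbf R} f\,dv,$$ where $f(x,v,t)\ge0$ and $E(x,t)$ are $T$-periodic in $x$, $\int_0^T\!\int_{\mathbf R} f(x,v,0)\,dv\,dx=T$ and $\int_0^T E(x,t)\,dx=0$. A solution on a time interval $I$ is understood in the weak sense: $f(t)\in L^1((0,T)\times\mathbf R)$ for every $t\in I$, the Poisson equation holds in integrated form, and for every smooth test function $\varphi(x,v)$, $T$-periodic in $x$ and with bounded support in $v$, and all $t_1\le t_2$ in $I$, $$\int_0^T\!\!\int_{\mathbf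 R} f(t_2)\varphi\,dv\,dx-\int_0^T\!\!\int_{\mathbf R} f(t_1)\varphi\,dv\,dx=\int_{t_1}^{t_2}\!\int_0^T\!\!\int_{\mathbf R} f\,(v\,\partial_x\varphi-E\,\partial_v\varphi)\,dv\,dx\,dt .$$ Then for every $0<T<T_0$ there exists $\varepsilon_0>0$ (depending only on $s$, $f_0$, $T$) such that the following holds. If $(f,E)$ is a solution on $[0,\infty)$ (respectively on $(-\infty,0]$) with $$\|f(t)-f_0\|_{L^2_xH^s_v((0,T)\times\mathbf R)}<\varepsilon_0\quad\text{for all } t\ge0\ \ (\text{respectively for all } t\le 0),$$ $$\|f(0)\|_{L^\infty_{x,v}}<\infty,\qquad \int_0^T\!\!\int_{\mathbf R} v^2 f(x,v,0)\,dv\,dx<\infty,$$ then $\|E(t)\|_{L^2(0,T)}\to0$ as $t\to+\infty$ (respectively as $t\to-\infty$). -/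

import Mathlib

open MeasureTheory Set Filter Topology FourierTransform
open scoped ENNReal ContDiff

noncomputable section

namespace VlasovPoisson

/-- The norm of the Sobolev space `H^s(ℝ)`, `s ≥ 0`, of a real function:
`(∫ (1 + (2πξ)²)^s |ĝ(ξ)|² dξ)^{1/2}`, where `ĝ(ξ) = ∫ g(v) e^{-2πivξ} dv` is the (unitary)
Fourier-Plancherel transform on `L²(ℝ)`. It is `∞` if `g` is not in `L²` or not in `H^s`. -/
def hsNorm (s : ℝ) (g : ℝ → ℝ) : ℝ≥0∞ :=
  open Classical in
  if h : MemLp (fun v => (g v : ℂ)) 2 volume then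
    (∫⁻ ξ : ℝ, ENNReal.ofReal ((1 + (2 * Real.pi * ξ) ^ 2) ^ s) *
      ‖(𝓕 (h.toLp (fun v => (g v : ℂ))) : Lp ℂ 2 (volume : Measure ℝ)) ξ‖ₑ ^ 2) ^ (1 / 2 : ℝ)
  else ⊤

/-- Membership in `H^s(ℝ)`, `s ≥ 0`. -/
def MemHs (s : ℝ) (g : ℝ → ℝ) : Prop := hsNorm s g < ⊤

/-- Lebesgue measure on one period cell `(0, T] × ℝ` of the phase space `(x, v)`. -/
def cell (T : ℝ) : Measure (ℝ × ℝ) := (volume.restrict (Ioc 0 T)).prod volume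

/-- The norm of `L²_x H^s_v` on `(0, T) × ℝ`. -/
def l2HsNorm (s T : ℝ) (g : ℝ × ℝ → ℝ) : ℝ≥0∞ :=
  (∫⁻ x in Ioc 0 T, hsNorm s (fun v => g (x, v)) ^ 2) ^ (1 / 2 : ℝ)

/-- A homogeneous profile: a nonnegative function of the velocity with integral one. -/
structure IsProfile (f₀ : ℝ → ℝ) : Prop where
  nonneg : ∀ v, 0 ≤ f₀ v
  integrable : Integrable f₀
  mass : ∫ v, f₀ v = 1

/-- `max {0, max_c ∫ f₀'(v) / (v - c) dv}`, where `c` runs over the critical points of `f₀`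
(as a supremum in `[0, ∞]`; `ENNReal.ofReal` is the positive part). -/
def criticalWaveNumberSq (f₀ : ℝ → ℝ) : ℝ≥0∞ :=
  ⨆ c ∈ {c : ℝ | deriv f₀ c = 0}, ENNReal.ofReal (∫ v, deriv f₀ v / (v - c))

/-- The critical period `T₀ ∈ (0, ∞]`: `(2π / T₀)² = criticalWaveNumberSq f₀`, with
`T₀ = ∞` if the right side is zero. -/
def criticalPeriod (f₀ : ℝ → ℝ) : ℝ≥0∞ :=
  ENNReal.ofReal (2 * Real.pi) / criticalWaveNumberSq f₀ ^ (1 / 2 : ℝ)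

/-- Test functions on the phase space: smooth, `T`-periodic in `x`, with support bounded in `v`. -/
structure IsTest (T : ℝ) (φ : ℝ × ℝ → ℝ) : Prop where
  smooth : ContDiff ℝ ∞ φ
  periodic : ∀ x v, φ (x + T, v) = φ (x, v)
  support : ∃ R : ℝ, ∀ x v, R < |v| → φ (x, v) = 0

/-- `∫∫ f(x, v) (v ∂ₓφ - E(x) ∂ᵥφ) dx dv` over one period cell. -/
def transportTerm (T : ℝ) (f : ℝ × ℝ → ℝ) (E : ℝ → ℝ) (φ : ℝ × ℝ → ℝ) : ℝ :=
  ∫ z, f z * (z.2 * deriv (fun x => φ (x, z.2)) z.1 - E z.1 * deriv (fun v => φ (z.1, v)) z.2)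
    ∂(cell T)

/-- `(f, E)` is a (weak) solution, on the time interval `I ∋ 0`, of the Vlasov-Poisson system
`∂ₜf + v ∂ₓf - E ∂ᵥf = 0`, `∂ₓE = 1 - ∫ f dv` with period `T` in `x`. Here `f t (x, v)` is the
electron distribution and `E t x` is the electric field at time `t`. -/
structure IsSolution (T : ℝ) (I : Set ℝ) (f : ℝ → ℝ × ℝ → ℝ) (E : ℝ → ℝ → ℝ) : Prop where
  measurable : AEStronglyMeasurable (fun p : ℝ × (ℝ × ℝ) => f p.1 p.2)
    ((volume.restrict I).prod (cell T))
  nonneg : ∀ t ∈ I, ∀ z, 0 ≤ f t z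
  periodic_f : ∀ t ∈ I, ∀ x v, f t (x + T, v) = f t (x, v)
  integrable : ∀ t ∈ I, Integrable (f t) (cell T)
  neutral : ∫ z, f 0 z ∂(cell T) = T
  periodic_E : ∀ t ∈ I, ∀ x, E t (x + T) = E t x
  mean_E : ∀ t ∈ I, ∫ x in (0 : ℝ)..T, E t x = 0
  /- the Poisson equation `∂ₓE = 1 - ∫ f dv`, integrated in `x` -/
  poisson : ∀ t ∈ I, ∀ x y : ℝ, E t y - E t x = ∫ z in x..y, (1 - ∫ v, f t (z, v))
  /- the Vlasov equation, tested with functions of `(x, v)` and integrated in time -/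
  vlasov : ∀ φ, IsTest T φ → ∀ t₁ ∈ I, ∀ t₂ ∈ I, t₁ ≤ t₂ →
    IntervalIntegrable (fun t => transportTerm T (f t) (E t) φ) volume t₁ t₂ ∧
    ∫ z, f t₂ z * φ z ∂(cell T) - ∫ z, f t₁ z * φ z ∂(cell T) =
      ∫ t in t₁..t₂, transportTerm T (f t) (E t) φ

/-- The initial distribution is bounded and has finite (kinetic) energy. -/
def BoundedFiniteEnergy (T : ℝ) (g : ℝ × ℝ → ℝ) : Prop :=
  eLpNorm g ⊤ (cell T) < ⊤ ∧ Integrable (fun z : ℝ × ℝ => z.2 ^ 2 * g z) (cell T)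

/-- The `L²` norm of the electric field over one period. -/
def fieldNorm (T : ℝ) (E : ℝ → ℝ) : ℝ≥0∞ := eLpNorm E 2 (volume.restrict (Ioc 0 T))

end VlasovPoisson

end

noncomputable section

namespace VlasovPoisson

/-! Write `f̂_n(t, q)` for `modePair T n (f t) (wave q)`, the Fourier coefficient in `x` and Fourier
transform in `v`, and `ρ_n(t) = f̂_n(t, 0)` for the density modes. Free streaming only shifts
frequencies, so Duhamel's formula (`IsSolution.duhamel`) reads `f̂_n(t, ξ) = f̂_n(0, ξ + nt/T) + ∫₀ᵗ
2πi p (fE)^_n(u, p) du` with `p = ξ + n(t - u)/T`.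

Linear stability. Take `ξ = 0` and split `fE = f₀E + (f - f₀)E`. By the Poisson equation the first
part turns Duhamel's formula into a Volterra equation `ρ_n - K_n * ρ_n = (free streaming) +
(forcing)` with `K_n(w) = -w f̂₀(nw/T)` for `w > 0`. The transform of `K(w) = -w f̂₀(w)` is real
only at points `-c` with `f₀'(c) = 0`, where it equals `(4π²)⁻¹ ∫ f₀'(v)/(v - c) dv`. Hence `T < T₀`
says exactly what is needed for `1 - θT²K̂` to stay away from zero for all `θ ∈ [0, 1]`
(`exists_dispersion_bound`). The modes are rescalings with `θ` replaced by `θ/n²`, so one constant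
`κ` serves them all. A lower bound at `θ = 1` alone would not give a causal inverse; the whole
homotopy does, by the method of continuity on the subspace of functions vanishing before a given
time (`lintegral_sq_le_of_volterra`).

Nonlinear estimate. Since `s > 3/2`, the weight `(1 + (2πp)²)^(1-s)` is integrable, and
Cauchy-Schwarz with Bessel's inequality in `x` bounds the forcing in `L²` of time by `ε² ∫ sup|E|²`.
The Poisson equation gives `sup|E|² ≤ C Σ|ρ_n|²`, so for small `ε` the forcing is absorbed and `∫₀^∞
Σ|ρ_n|² dt < ∞` (`exists_density_bound`).

From square integrability to decay. It remains to show that each `ρ_n` is uniformly continuous in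
time, for which `q ↦ f̂_n(t, q)` must be equicontinuous at `q = 0` uniformly in `t`. This is
tightness in velocity. The zero mode satisfies `∂ₜ f̂₀(t, q) = 2πi q (fE)^₀(t, q)`, and `(fE)^₀` is
a sum of products of field modes and modes of `f`, both square integrable in time; so it is
integrable in time, and `f̂₀(t, q)` moves by at most `C|q|` for all time. As `f ≥ 0`, the zero mode
controls all others (`norm_modePair_sub_le`). Thus every `ρ_n` tends to zero, and dominated
convergence in `n` gives the decay of the field (`tendsto_fieldNorm`).

Negative times reduce to positive ones by the symmetry `(t, x, v, E) ↦ (-t, T - x, v, -E)`. -/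

/-! ### Fourier transform on `L¹ ∩ L²` and the Sobolev norm -/

theorem integral_fourier_mul_eq {f g : ℝ → ℂ} (hf : Integrable f) (hg : Integrable g) :
    ∫ ξ, 𝓕 f ξ * g ξ = ∫ v, f v * 𝓕 g v := by
  have := VectorFourier.integral_bilin_fourierIntegral_eq_flip (ContinuousLinearMap.mul ℂ ℂ)
    (L := innerₗ ℝ) (μ := volume) (ν := volume) Real.continuous_fourierChar continuous_inner hf hg
  simpa using! this

/-- Both sides are locally integrable, so it suffices to test with smooth compactly supported
functions; there the Plancherel transform acts as on tempered distributions, and the Fourier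
integral moves across by Fubini. This links `hsNorm`, defined on `L²` classes, to pointwise Fourier
integrals. -/
theorem coeFn_fourier_toLp {f : ℝ → ℂ} (h1 : Integrable f) (h2 : MemLp f 2) :
    ((𝓕 (h2.toLp f) : Lp ℂ 2 (volume : Measure ℝ)) : ℝ → ℂ) =ᵐ[volume] 𝓕 f := by
  have hc : Continuous (𝓕 f) :=
    VectorFourier.fourierIntegral_continuous Real.continuous_fourierChar continuous_inner h1
  refine ae_eq_of_integral_contDiff_smul_eq
    ((Lp.memLp _).locallyIntegrable (by norm_num)) hc.locallyIntegrable ?_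
  intro g hg hgc
  have hG : HasCompactSupport (fun x => (g x : ℂ)) := hgc.comp_left (g := fun y : ℝ => (y : ℂ)) (by simp)
  have hG' : ContDiff ℝ ∞ (fun x => (g x : ℂ)) := Complex.ofRealCLM.contDiff.comp hg
  set G := hG.toSchwartzMap hG' with hGdef
  have e1 := congrArg (fun u : TemperedDistribution ℝ ℂ => u G)
    (Lp.fourier_toTemperedDistribution_eq (h2.toLp f))
  simp only [TemperedDistribution.fourier_apply, Lp.toTemperedDistribution_apply] at e1
  have e2 : ∫ x, (𝓕 G) x • (h2.toLp f : ℝ → ℂ) x = ∫ x, f x * 𝓕 (fun x => (g x : ℂ)) x := by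
    refine integral_congr_ae ?_
    filter_upwards [h2.coeFn_toLp] with x hx
    rw [hx, SchwartzMap.fourier_coe, smul_eq_mul, mul_comm]
    rfl
  have e3 := integral_fourier_mul_eq h1 (g := fun x => (g x : ℂ)) (by
    simpa using! G.integrable)
  have e4 : ∀ u : ℝ → ℂ, ∫ x, g x • u x = ∫ x, G x • u x := by
    intro u; rfl
  rw [e4, ← e1, e2, ← e3]
  refine integral_congr_ae (ae_of_all _ fun x => ?_)
  simp [mul_comm]

theorem memLp_fourier {f : ℝ → ℂ} (h1 : Integrable f) (h2 : MemLp f 2) : MemLp (𝓕 f) 2 :=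
  (memLp_congr_ae (coeFn_fourier_toLp h1 h2)).1 (Lp.memLp _)

/-- The weight `(1 + (2πξ)²)^s` of the Sobolev norm. -/
def weight (s ξ : ℝ) : ℝ := (1 + (2 * Real.pi * ξ) ^ 2) ^ s

theorem weight_pos (s ξ : ℝ) : 0 < weight s ξ := by unfold weight; positivity

theorem continuous_weight (s : ℝ) : Continuous (weight s) := by
  unfold weight
  refine Continuous.rpow_const (by fun_prop) fun x => Or.inl (by positivity)

/-- The squared Sobolev norm of an integrable function, computed with the Fourier integral. -/
def sobolevSq (s : ℝ) (g : ℝ → ℝ) : ℝ≥0∞ :=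
  ∫⁻ ξ, ENNReal.ofReal (weight s ξ) * ‖𝓕 (fun v => (g v : ℂ)) ξ‖ₑ ^ 2

/-- If `g` is in `L²` the two sides agree; otherwise the right side is infinite by definition. -/
theorem sobolevSq_le_hsNorm_sq (s : ℝ) {g : ℝ → ℝ} (hg : Integrable g) :
    sobolevSq s g ≤ hsNorm s g ^ 2 := by
  unfold hsNorm sobolevSq
  split_ifs with h
  · rw [← ENNReal.rpow_natCast, ← ENNReal.rpow_mul]
    simp only [Nat.cast_ofNat, one_div, isUnit_iff_ne_zero, ne_eq, OfNat.ofNat_ne_zero, not_false_eq_true,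
      IsUnit.inv_mul_cancel, ENNReal.rpow_one]
    refine le_of_eq (lintegral_congr_ae ?_)
    have hg' : Integrable fun v => (g v : ℂ) := hg.ofReal
    filter_upwards [coeFn_fourier_toLp hg' h] with x hx
    rw [hx]
    rfl
  · simp

/-! ### Fourier series on a period -/

/-- The conjugate of the `n`-th character of `ℝ / Tℤ`. -/
def mode (T : ℝ) (n : ℤ) (x : ℝ) : ℂ := Complex.exp (-(2 * Real.pi * n * x / T) * Complex.I)

theorem norm_mode (T : ℝ) (n : ℤ) (x : ℝ) : ‖mode T n x‖ = 1 := by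
  unfold mode
  rw [show (-(2 * Real.pi * n * x / T) : ℂ) = ((-(2 * Real.pi * n * x / T) : ℝ) : ℂ) by push_cast; rfl]
  exact Complex.norm_exp_ofReal_mul_I _

theorem continuous_mode (T : ℝ) (n : ℤ) : Continuous (mode T n) := by
  unfold mode; fun_prop

theorem fourier_neg_coe_eq_mode (T : ℝ) (n : ℤ) (x : ℝ) :
    fourier (-n) (x : AddCircle T) = mode T n x := by
  rw [fourier_coe_apply, mode]; congr 1; push_cast; ring

theorem fourierCoeffOn_eq_mode {T : ℝ} (hT : 0 < T) (g : ℝ → ℂ) (n : ℤ) :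
    fourierCoeffOn hT g n = (T : ℂ)⁻¹ * ∫ x in Ioc 0 T, mode T n x * g x := by
  rw [fourierCoeffOn_eq_integral, intervalIntegral.integral_of_le hT.le]
  simp only [sub_zero, one_div, Complex.real_smul, smul_eq_mul, Complex.ofReal_inv]
  congr 1
  refine integral_congr_ae (ae_of_all _ fun x => ?_)
  simp only [← fourier_neg_coe_eq_mode]
  rw [fourier_coe_apply, fourier_coe_apply]; simp

/-- Parseval's identity on a period, with values in `[0, ∞]`. -/
theorem tsum_enorm_sq_mode {T : ℝ} (hT : 0 < T) {g : ℝ → ℂ}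
    (hL : MemLp g 2 (volume.restrict (Ioc 0 T))) :
    ∑' n : ℤ, ‖∫ x in Ioc 0 T, mode T n x * g x‖ₑ ^ 2
      = ENNReal.ofReal T * ∫⁻ x in Ioc 0 T, ‖g x‖ₑ ^ 2 := by
  have hp := hasSum_sq_fourierCoeffOn hT hL
  have e1 : ∀ n : ℤ, ‖∫ x in Ioc 0 T, mode T n x * g x‖ₑ ^ 2
      = ENNReal.ofReal (T ^ 2) * ENNReal.ofReal (‖fourierCoeffOn hT g n‖ ^ 2) := by
    intro n
    rw [fourierCoeffOn_eq_mode, norm_mul, ← ENNReal.ofReal_mul (by positivity), ← ofReal_norm,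
      ← ENNReal.ofReal_pow (norm_nonneg _)]
    congr 1
    simp only [norm_inv, Complex.norm_real, Real.norm_eq_abs, abs_of_pos hT]
    field_simp
  simp_rw [e1]
  rw [ENNReal.tsum_mul_left, ← ENNReal.ofReal_tsum_of_nonneg (fun n => by positivity) hp.summable,
    hp.tsum_eq, ← ENNReal.ofReal_mul (by positivity)]
  have e2 : ENNReal.ofReal (∫ x in (0 : ℝ)..T, ‖g x‖ ^ 2) = ∫⁻ x in Ioc 0 T, ‖g x‖ₑ ^ 2 := by
    rw [intervalIntegral.integral_of_le hT.le, ofReal_integral_eq_lintegral_ofReal]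
    · refine lintegral_congr fun x => ?_
      rw [ENNReal.ofReal_pow (norm_nonneg _), ofReal_norm]
    · exact (memLp_two_iff_integrable_sq_norm hL.1).1 hL
    · exact ae_of_all _ fun x => by positivity
  rw [← e2, ← ENNReal.ofReal_mul hT.le]
  congr 1
  simp only [sub_zero, smul_eq_mul]
  field_simp

theorem tsum_enorm_sq_mode_le {T : ℝ} (hT : 0 < T) {g : ℝ → ℂ}
    (hg : AEStronglyMeasurable g (volume.restrict (Ioc 0 T))) :
    ∑' n : ℤ, ‖∫ x in Ioc 0 T, mode T n x * g x‖ₑ ^ 2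
      ≤ ENNReal.ofReal T * ∫⁻ x in Ioc 0 T, ‖g x‖ₑ ^ 2 := by
  by_cases h : ∫⁻ x in Ioc 0 T, ‖g x‖ₑ ^ 2 = ⊤
  · rw [h, ENNReal.mul_top (by simpa using hT)]; exact le_top
  refine (tsum_enorm_sq_mode hT ⟨hg, ?_⟩).le
  rw [eLpNorm_lt_top_iff_lintegral_rpow_enorm_lt_top (by norm_num) (by norm_num)]
  simpa using lt_top_iff_ne_top.2 h

/-- A continuous periodic function is the sum of its Fourier series if the latter is summable. -/
theorem hasSum_mode {T : ℝ} (hT : 0 < T) {g : ℝ → ℂ} (hg : Continuous g)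
    (hper : Function.Periodic g T)
    (hs : Summable fun n : ℤ => ‖∫ x in Ioc 0 T, mode T n x * g x‖) (x : ℝ) :
    HasSum (fun n : ℤ => (T : ℂ)⁻¹ * (∫ y in Ioc 0 T, mode T n y * g y) * mode T (-n) x) (g x) := by
  have := Fact.mk hT
  have hc : Continuous (hper.lift) := by
    exact continuous_coinduced_dom.mpr hg
  set G : C(AddCircle T, ℂ) := ⟨hper.lift, hc⟩
  have e : ∀ n, fourierCoeff G n = (T : ℂ)⁻¹ * ∫ y in Ioc 0 T, mode T n y * g y := by
    intro n
    rw [fourierCoeff_eq_intervalIntegral _ n 0, zero_add, intervalIntegral.integral_of_le hT.le]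
    simp only [one_div, Complex.real_smul, Complex.ofReal_inv, smul_eq_mul]
    congr 1
    refine integral_congr_ae (ae_of_all _ fun x => ?_)
    simp only [fourier_neg_coe_eq_mode]; rfl
  have hsum : Summable (fourierCoeff G) := by
    refine Summable.of_norm ?_
    have := hs.mul_left (T⁻¹)
    refine this.congr fun n => ?_
    rw [e, norm_mul]; simp [abs_of_pos hT]
  have := has_pointwise_sum_fourier_series_of_summable hsum (x : AddCircle T)
  convert! this using 2 with n
  rw [e, smul_eq_mul, ← fourier_neg_coe_eq_mode, neg_neg]

/-! ### Cauchy-Schwarz and Young inequalities in `[0, ∞]` -/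

theorem lintegral_mul_sq_le {α : Type*} [MeasurableSpace α] {μ : Measure α} {f g : α → ℝ≥0∞}
    (hf : AEMeasurable f μ) (hg : AEMeasurable g μ) :
    (∫⁻ a, f a * g a ∂μ) ^ 2 ≤ (∫⁻ a, f a ^ 2 ∂μ) * ∫⁻ a, g a ^ 2 ∂μ := by
  have h := ENNReal.lintegral_mul_le_Lp_mul_Lq μ Real.HolderConjugate.two_two hf hg
  have h2 := pow_le_pow_left' h 2
  refine h2.trans (le_of_eq ?_)
  rw [mul_pow]
  simp only [← ENNReal.rpow_natCast, ← ENNReal.rpow_mul]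
  simp

/-- Cauchy-Schwarz for `f^(1/2)` and `f^(1/2) g`, that is, for the measure with density `f`. -/
theorem lintegral_mul_sq_le_weighted {α : Type*} [MeasurableSpace α] {μ : Measure α}
    {f g : α → ℝ≥0∞} (hf : AEMeasurable f μ) (hg : AEMeasurable g μ) :
    (∫⁻ a, f a * g a ∂μ) ^ 2 ≤ (∫⁻ a, f a ∂μ) * ∫⁻ a, f a * g a ^ 2 ∂μ := by
  have e : ∀ y : ℝ≥0∞, (y ^ (1 / 2 : ℝ)) ^ 2 = y := by
    intro y
    rw [← ENNReal.rpow_natCast, ← ENNReal.rpow_mul]; simp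
  have h := lintegral_mul_sq_le (f := fun a => f a ^ (1 / 2 : ℝ)) (g := fun a => f a ^ (1 / 2 : ℝ) * g a)
    (hf.pow_const _) ((hf.pow_const _).mul hg)
  simp only [← mul_assoc, mul_pow, e, ← pow_two] at h
  exact h

/-- Young's inequality `‖x * K‖₂ ≤ ‖x‖₂ ‖K‖₁`. -/
theorem lintegral_convolution_sq_le {x K : ℝ → ℂ} (hx : AEStronglyMeasurable x)
    (hK : AEStronglyMeasurable K) :
    ∫⁻ t, ‖∫ u, x u * K (t - u)‖ₑ ^ 2 ≤ (∫⁻ u, ‖K u‖ₑ) ^ 2 * ∫⁻ u, ‖x u‖ₑ ^ 2 := by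
  have hprod : AEStronglyMeasurable (fun p : ℝ × ℝ => K (p.1 - p.2)) (volume.prod volume) :=
    hK.comp_quasiMeasurePreserving (quasiMeasurePreserving_sub volume volume)
  have hx2 : AEStronglyMeasurable (fun p : ℝ × ℝ => x p.2) (volume.prod volume) := hx.comp_snd
  have h1 : ∀ t, ‖∫ u, x u * K (t - u)‖ₑ ^ 2
      ≤ (∫⁻ u, ‖K u‖ₑ) * ∫⁻ u, ‖K (t - u)‖ₑ * ‖x u‖ₑ ^ 2 := by
    intro t
    have hKt : AEStronglyMeasurable (fun u => K (t - u)) :=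
      hK.comp_quasiMeasurePreserving (quasiMeasurePreserving_sub_left volume t)
    calc ‖∫ u, x u * K (t - u)‖ₑ ^ 2 ≤ (∫⁻ u, ‖x u * K (t - u)‖ₑ) ^ 2 :=
          pow_le_pow_left' (enorm_integral_le_lintegral_enorm _) 2
      _ = (∫⁻ u, ‖K (t - u)‖ₑ * ‖x u‖ₑ) ^ 2 := by simp_rw [enorm_mul, mul_comm]
      _ ≤ _ := lintegral_mul_sq_le_weighted hKt.enorm hx.enorm
      _ = _ := by rw [lintegral_sub_left_eq_self (fun u => ‖K u‖ₑ) t]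
  calc ∫⁻ t, ‖∫ u, x u * K (t - u)‖ₑ ^ 2
      ≤ ∫⁻ t, (∫⁻ u, ‖K u‖ₑ) * ∫⁻ u, ‖K (t - u)‖ₑ * ‖x u‖ₑ ^ 2 := lintegral_mono h1
    _ ≤ (∫⁻ u, ‖K u‖ₑ) * ∫⁻ t, ∫⁻ u, ‖K (t - u)‖ₑ * ‖x u‖ₑ ^ 2 := by
        rw [lintegral_const_mul'']
        exact (hprod.enorm.mul (hx2.enorm.pow_const 2)).lintegral_prod_right'
    _ = (∫⁻ u, ‖K u‖ₑ) * ∫⁻ u, ∫⁻ t, ‖K (t - u)‖ₑ * ‖x u‖ₑ ^ 2 := by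
        rw [lintegral_lintegral_swap]
        exact hprod.enorm.mul (hx2.enorm.pow_const 2)
    _ = (∫⁻ u, ‖K u‖ₑ) * ∫⁻ u, (∫⁻ v, ‖K v‖ₑ) * ‖x u‖ₑ ^ 2 := by
        congr 1
        refine lintegral_congr fun u => ?_
        rw [lintegral_mul_const', lintegral_sub_right_eq_self (fun t => ‖K t‖ₑ) u]
        simp
    _ = _ := by
        rw [lintegral_const_mul'' _ (hx.enorm.pow_const 2), pow_two, mul_assoc]

/-! ### Volterra equations in `L²` by the method of continuity -/

/-- If `1 - θN` is bounded below uniformly for `θ ∈ [0, 1]`, then `1 - N` is surjective. -/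
theorem surjective_one_sub_of_bounded_below {W : Type*} [NormedAddCommGroup W] [NormedSpace ℂ W]
    [CompleteSpace W] (N : W →L[ℂ] W) {κ : ℝ} (hκ : 0 < κ)
    (h : ∀ θ : ℝ, 0 ≤ θ → θ ≤ 1 → ∀ x, κ * ‖x‖ ≤ ‖x - (θ : ℂ) • N x‖) (y : W) :
    ∃ x, x - N x = y := by
  rcases subsingleton_or_nontrivial W with hW | hW
  · exact ⟨0, Subsingleton.elim _ _⟩
  -- The step `1/m` satisfies `‖N‖/m < κ`, while the lower bound keeps the inverse at each stage
  -- below `κ⁻¹` in norm; invertibility therefore passes from `j/m` to `(j+1)/m` by perturbation.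
  obtain ⟨m, hm⟩ := exists_nat_gt (‖N‖ / κ)
  have hm0 : 0 < (m : ℝ) := lt_of_le_of_lt (by positivity) hm
  have key : ∀ j : ℕ, j ≤ m → IsUnit (1 - ((j / m : ℝ) : ℂ) • N) := by
    intro j
    induction j with
    | zero => intro _; simp
    | succ j ih =>
      intro hj
      obtain ⟨U, hU⟩ := ih (by omega)
      have hjm : (j : ℝ) / m ≤ 1 := by
        rw [div_le_one hm0]; exact_mod_cast (by omega : j ≤ m)
      have hinv : ‖((U⁻¹ : (W →L[ℂ] W)ˣ) : W →L[ℂ] W)‖ ≤ κ⁻¹ := by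
        refine ContinuousLinearMap.opNorm_le_bound _ (by positivity) fun z => ?_
        set w := ((U⁻¹ : (W →L[ℂ] W)ˣ) : W →L[ℂ] W) z
        have hw : (U : W →L[ℂ] W) w = z := by
          exact congrArg (fun A : W →L[ℂ] W => A z) U.mul_inv
        rw [hU] at hw
        have := h (j / m) (by positivity) hjm w
        have e : w - ((j / m : ℝ) : ℂ) • N w = z := by simpa using hw
        rw [e] at this
        rw [inv_mul_eq_div, le_div_iff₀ hκ, mul_comm]; exact this
      have hne : ((U⁻¹ : (W →L[ℂ] W)ˣ) : W →L[ℂ] W) ≠ 0 := Units.ne_zero _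
      have hlt : ‖(1 - (((j + 1 : ℕ) / m : ℝ) : ℂ) • N) - (U : W →L[ℂ] W)‖
          < ‖((U⁻¹ : (W →L[ℂ] W)ˣ) : W →L[ℂ] W)‖⁻¹ := by
        have e : (1 - (((j + 1 : ℕ) / m : ℝ) : ℂ) • N) - (U : W →L[ℂ] W) = (-(1 / m : ℝ) : ℂ) • N := by
          rw [hU, sub_sub_sub_cancel_left, ← sub_smul]
          congr 1; push_cast; ring
        rw [e, norm_smul]
        refine lt_of_lt_of_le ?_ (le_inv_comm₀ hκ (norm_pos_iff.2 hne) |>.2 hinv)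
        rw [norm_neg, Complex.norm_real, Real.norm_eq_abs, abs_of_pos (by positivity)]
        rw [div_lt_iff₀ hκ] at hm
        rw [one_div, inv_mul_lt_iff₀ hm0]; exact hm
      exact (U.ofNearby _ hlt).isUnit
  obtain ⟨U, hU⟩ := key m le_rfl
  rw [div_self hm0.ne'] at hU
  refine ⟨((U⁻¹ : (W →L[ℂ] W)ˣ) : W →L[ℂ] W) y, ?_⟩
  have := congrArg (fun A : W →L[ℂ] W => A y) U.mul_inv
  rw [hU] at this
  simpa [-Units.mul_inv_eq_one] using! this

theorem norm_fourier_le {K : ℝ → ℂ} (ξ : ℝ) : ‖𝓕 K ξ‖ ≤ ∫ t, ‖K t‖ :=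
  VectorFourier.norm_fourierIntegral_le_integral_norm _ _ _ _ _

theorem continuous_fourier {K : ℝ → ℂ} (hK : Integrable K) : Continuous (𝓕 K) :=
  VectorFourier.fourierIntegral_continuous Real.continuous_fourierChar continuous_inner hK

theorem memLp_top_fourier {K : ℝ → ℂ} (hK : Integrable K) : MemLp (𝓕 K) ⊤ :=
  memLp_top_of_bound (continuous_fourier hK).aestronglyMeasurable _
    (ae_of_all _ fun ξ => norm_fourier_le ξ)

/-- Convolution with an integrable kernel on `L²(ℝ)`, as a Fourier multiplier. -/
def convOp {K : ℝ → ℂ} (hK : Integrable K) :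
    Lp ℂ 2 (volume : Measure ℝ) →L[ℂ] Lp ℂ 2 (volume : Measure ℝ) :=
  ((Lp.fourierTransformₗᵢ ℝ ℂ).symm.toContinuousLinearEquiv : _ →L[ℂ] _) ∘L
    ((ContinuousLinearMap.mul ℂ ℂ).holderL volume ⊤ 2 2 ((memLp_top_fourier hK).toLp _)) ∘L
    ((Lp.fourierTransformₗᵢ ℝ ℂ).toContinuousLinearEquiv : _ →L[ℂ] _)

theorem fourier_convOp {K : ℝ → ℂ} (hK : Integrable K) (x : Lp ℂ 2 (volume : Measure ℝ)) :
    (𝓕 (convOp hK x) : Lp ℂ 2 (volume : Measure ℝ)) =ᵐ[volume]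
      fun ξ => 𝓕 K ξ * (𝓕 x : Lp ℂ 2 (volume : Measure ℝ)) ξ := by
  have e : (𝓕 (convOp hK x) : Lp ℂ 2 (volume : Measure ℝ)) =
      (ContinuousLinearMap.mul ℂ ℂ).holder 2 ((memLp_top_fourier hK).toLp _) (𝓕 x) :=
    (Lp.fourierTransformₗᵢ ℝ ℂ).apply_symm_apply _
  rw [e]
  filter_upwards [(ContinuousLinearMap.mul ℂ ℂ).coeFn_holder (r := 2) ((memLp_top_fourier hK).toLp _)
    (𝓕 x : Lp ℂ 2 (volume : Measure ℝ)), (memLp_top_fourier hK).coeFn_toLp] with ξ h1 h2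
  rw [h1, h2]; rfl

theorem memLp_convolution {x K : ℝ → ℂ} (hK : Integrable K) (hx : MemLp x 2) (hx1 : Integrable x) :
    MemLp (fun t => ∫ u, x u * K (t - u)) 2 := by
  have hI : Integrable (fun t => ∫ u, x u * K (t - u)) :=
    hx1.integrable_convolution (ContinuousLinearMap.mul ℂ ℂ) hK
  refine ⟨hI.1, ?_⟩
  rw [eLpNorm_lt_top_iff_lintegral_rpow_enorm_lt_top (by norm_num) (by norm_num)]
  have h2 := (eLpNorm_lt_top_iff_lintegral_rpow_enorm_lt_top (by norm_num) (by norm_num)).1 hx.2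
  simp only [ENNReal.toReal_ofNat, ENNReal.rpow_ofNat] at h2 ⊢
  exact (lintegral_convolution_sq_le hx.1 hK.1).trans_lt
    (ENNReal.mul_lt_top (ENNReal.pow_lt_top hK.2) h2)

/-- The convolution theorem identifies the multiplier with an honest convolution as soon as `x` is
also integrable. -/
theorem convOp_toLp {x K : ℝ → ℂ} (hK : Integrable K) (hx : MemLp x 2) (hx1 : Integrable x) :
    convOp hK (hx.toLp x) = (memLp_convolution hK hx hx1).toLp _ := by
  have hI : Integrable (fun t => ∫ u, x u * K (t - u)) :=
    hx1.integrable_convolution (ContinuousLinearMap.mul ℂ ℂ) hK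
  apply (Lp.fourierTransformₗᵢ ℝ ℂ).injective
  change (𝓕 (convOp hK (hx.toLp x)) : Lp ℂ 2 (volume : Measure ℝ)) = 𝓕 ((memLp_convolution hK hx hx1).toLp _)
  apply Lp.ext
  filter_upwards [fourier_convOp hK (hx.toLp x), coeFn_fourier_toLp hx1 hx,
    coeFn_fourier_toLp hI (memLp_convolution hK hx hx1)] with ξ h1 h2 h3
  rw [h1, h2, h3]
  have := Real.fourier_mul_convolution_eq hx1 hK ξ
  rw [mul_comm, ← this]
  rfl

/-- By Plancherel, `1 - θ K *` is multiplication by `1 - θ K̂`, and a pointwise lower bound on the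
symbol is a lower bound on the operator. -/
theorem norm_sub_convOp_ge {K : ℝ → ℂ} (hK : Integrable K) {κ θ : ℝ}
    (h : ∀ ξ, κ ≤ ‖1 - (θ : ℂ) * 𝓕 K ξ‖) (x : Lp ℂ 2 (volume : Measure ℝ)) :
    κ * ‖x‖ ≤ ‖x - (θ : ℂ) • convOp hK x‖ := by
  rcases le_or_gt κ 0 with hκ | hκ
  · exact (mul_nonpos_of_nonpos_of_nonneg hκ (norm_nonneg _)).trans (norm_nonneg _)
  have e : (𝓕 (x - (θ : ℂ) • convOp hK x) : Lp ℂ 2 (volume : Measure ℝ))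
      = 𝓕 x - (θ : ℂ) • 𝓕 (convOp hK x) := by
    change Lp.fourierTransformₗᵢ ℝ ℂ (x - (θ : ℂ) • convOp hK x) = _
    rw [map_sub, map_smul]; rfl
  rw [← Lp.norm_fourier_eq x, ← Lp.norm_fourier_eq (x - (θ : ℂ) • convOp hK x), e]
  have : ‖(𝓕 x : Lp ℂ 2 (volume : Measure ℝ))‖ ≤
      κ⁻¹ * ‖(𝓕 x : Lp ℂ 2 (volume : Measure ℝ)) - (θ : ℂ) • 𝓕 (convOp hK x)‖ := by
    apply Lp.norm_le_mul_norm_of_ae_le_mul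
    filter_upwards [fourier_convOp hK x, Lp.coeFn_sub (𝓕 x : Lp ℂ 2 (volume : Measure ℝ))
      ((θ : ℂ) • 𝓕 (convOp hK x)), Lp.coeFn_smul (θ : ℂ) (𝓕 (convOp hK x))] with ξ h1 h2 h3
    rw [h2, Pi.sub_apply, h3, Pi.smul_apply, h1, smul_eq_mul, ← mul_assoc, ← one_sub_mul, norm_mul,
      inv_mul_eq_div, le_div_iff₀ hκ, mul_comm]
    exact mul_le_mul_of_nonneg_right (h ξ) (norm_nonneg _)
  rwa [inv_mul_eq_div, le_div_iff₀ hκ, mul_comm] at this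

/-- The square integrable functions that vanish before time `τ`. -/
def vanishBefore (τ : ℝ) : Submodule ℂ (Lp ℂ 2 (volume : Measure ℝ)) :=
  (LpToLpRestrictCLM ℝ ℂ ℂ volume 2 (Iio τ)).ker

theorem isClosed_vanishBefore (τ : ℝ) :
    IsClosed (vanishBefore τ : Set (Lp ℂ 2 (volume : Measure ℝ))) :=
  ContinuousLinearMap.isClosed_ker _

theorem mem_vanishBefore {τ : ℝ} {x : Lp ℂ 2 (volume : Measure ℝ)} :
    x ∈ vanishBefore τ ↔ ∀ᵐ t, t < τ → x t = 0 := by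
  have h := LpToLpRestrictCLM_coeFn ℂ (Iio τ) x
  have e : (∀ᵐ t, t < τ → x t = 0) ↔ x =ᵐ[volume.restrict (Iio τ)] 0 := by
    rw [Filter.EventuallyEq, ae_restrict_iff' measurableSet_Iio]; rfl
  rw [e, vanishBefore, LinearMap.mem_ker]
  change LpToLpRestrictCLM ℝ ℂ ℂ volume 2 (Iio τ) x = 0 ↔ _
  rw [Lp.eq_zero_iff_ae_eq_zero]
  exact ⟨fun hx => h.symm.trans hx, fun hx => h.trans hx⟩

/-- Causality. For integrable `x` and `t < τ`, the integrand `x u * K (t - u)` vanishes: either `u <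
τ` and `x u = 0`, or `u ≥ τ > t` and `K (t - u) = 0`. A general `x` is approximated by its
restrictions to sets of finite measure, and the subspace is closed. -/
theorem convOp_mem_vanishBefore {K : ℝ → ℂ} (hK : Integrable K) (hK0 : ∀ t < 0, K t = 0) {τ : ℝ}
    {x : Lp ℂ 2 (volume : Measure ℝ)} (hx : x ∈ vanishBefore τ) : convOp hK x ∈ vanishBefore τ := by
  rw [← SetLike.mem_coe, ← (isClosed_vanishBefore τ).closure_eq, Metric.mem_closure_iff]
  intro ε hε
  set δ : ℝ := ε / (‖convOp hK‖ + 1)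
  have hδ : 0 < δ := by positivity
  obtain ⟨s, hs, hsfin, hlt⟩ := (Lp.memLp x).exists_eLpNorm_indicator_compl_lt (by norm_num)
    (ε := ENNReal.ofReal δ) (by simpa using hδ)
  have h2 : MemLp (s.indicator x) 2 := (Lp.memLp x).indicator hs
  have h1 : Integrable (s.indicator x) := by
    rw [integrable_indicator_iff hs]
    have : IsFiniteMeasure (volume.restrict s) := ⟨by simpa using hsfin⟩
    exact ((Lp.memLp x).restrict s).integrable one_le_two
  refine ⟨convOp hK (h2.toLp _), ?_, ?_⟩
  · rw [SetLike.mem_coe, convOp_toLp hK h2 h1, mem_vanishBefore]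
    filter_upwards [(memLp_convolution hK h2 h1).coeFn_toLp] with t ht htτ
    rw [ht]
    refine integral_eq_zero_of_ae ?_
    filter_upwards [mem_vanishBefore.1 hx] with u hu
    rcases lt_or_ge u τ with h | h
    · simp [indicator, hu h]
    · simp [hK0 (t - u) (by linarith)]
  · have e : x - h2.toLp _ = (((Lp.memLp x).indicator hs.compl).toLp _) := by
      apply Lp.ext
      filter_upwards [Lp.coeFn_sub x (h2.toLp _), h2.coeFn_toLp,
        ((Lp.memLp x).indicator hs.compl).coeFn_toLp] with t e1 e2 e3
      rw [e1, Pi.sub_apply, e2, e3]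
      by_cases h : t ∈ s <;> simp [h]
    rw [dist_eq_norm, ← map_sub]
    have hn : ‖x - h2.toLp _‖ < δ := by
      rw [e, Lp.norm_toLp]
      exact (ENNReal.lt_ofReal_iff_toReal_lt (ne_top_of_lt hlt)).1 hlt
    calc ‖convOp hK (x - h2.toLp _)‖ ≤ ‖convOp hK‖ * ‖x - h2.toLp _‖ := ContinuousLinearMap.le_opNorm _ _
      _ ≤ ‖convOp hK‖ * δ := by gcongr
      _ < (‖convOp hK‖ + 1) * δ := by nlinarith
      _ = ε := by simp only [δ]; field_simp

theorem lintegral_sq_eq_enorm_sq (g : Lp ℂ 2 (volume : Measure ℝ)) :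
    ∫⁻ v, ‖g v‖ₑ ^ 2 = ‖g‖ₑ ^ 2 := by
  rw [Lp.enorm_def, eLpNorm_eq_lintegral_rpow_enorm_toReal (by norm_num) (by norm_num),
    ← ENNReal.rpow_natCast, ← ENNReal.rpow_mul]
  simp

/-- The `L²` estimate for a Volterra equation whose kernel satisfies the stability condition along
the homotopy `θ K`, `0 ≤ θ ≤ 1`. -/
theorem lintegral_sq_le_of_volterra {K x : ℝ → ℂ} (hK : Integrable K) (hK0 : ∀ t < 0, K t = 0)
    {κ : ℝ} (hκ : 0 < κ) (h : ∀ θ : ℝ, 0 ≤ θ → θ ≤ 1 → ∀ ξ, κ ≤ ‖1 - (θ : ℂ) * 𝓕 K ξ‖)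
    {τ : ℝ} (hx : MemLp x 2) (hx1 : Integrable x) (hxτ : ∀ t, τ ≤ t → x t = 0) :
    ENNReal.ofReal (κ ^ 2) * ∫⁻ t, ‖x t‖ₑ ^ 2
      ≤ ∫⁻ t in Iio τ, ‖x t - ∫ u, x u * K (t - u)‖ₑ ^ 2 := by
  set g : ℝ → ℂ := fun t => x t - ∫ u, x u * K (t - u)
  have hg : MemLp g 2 := hx.sub (memLp_convolution hK hx hx1)
  have hgy := hg.indicator (measurableSet_Iio (a := τ))
  have hgw := hg.indicator (measurableSet_Iio (a := τ)).compl
  set X := hx.toLp x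
  have hX : X - convOp hK X = hgy.toLp _ + hgw.toLp _ := by
    rw [convOp_toLp hK hx hx1, ← MemLp.toLp_sub, ← MemLp.toLp_add]
    congr 1
    exact (indicator_self_add_compl _ g).symm
  have hw : hgw.toLp _ ∈ vanishBefore τ := by
    rw [mem_vanishBefore]
    filter_upwards [hgw.coeFn_toLp] with t ht htτ
    rw [ht]; simp [htτ]
  have : CompleteSpace (vanishBefore τ) := (isClosed_vanishBefore τ).completeSpace_coe
  set N : vanishBefore τ →L[ℂ] vanishBefore τ :=
    ((convOp hK).comp (vanishBefore τ).subtypeL).codRestrict (vanishBefore τ)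
      (fun y => convOp_mem_vanishBefore hK hK0 y.2)
  -- Solve the equation for the part of `g` that lives after `τ`; the solution `W` vanishes before
  -- `τ`. Then `X - W` has only the part of `g` before `τ` as datum and agrees with `X` before `τ`,
  -- where all of `X` lives.
  obtain ⟨w, hwN⟩ := surjective_one_sub_of_bounded_below N hκ (fun θ h0 h1 y => by
    have := norm_sub_convOp_ge hK (h θ h0 h1) (y : Lp ℂ 2 (volume : Measure ℝ))
    exact this) ⟨_, hw⟩
  have hwN' : (w : Lp ℂ 2 (volume : Measure ℝ)) - convOp hK w = hgw.toLp _ := congrArg Subtype.val hwN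
  set W : Lp ℂ 2 (volume : Measure ℝ) := w.1
  have e1 : (X - W) - convOp hK (X - W) = hgy.toLp _ := by
    rw [map_sub, sub_sub_sub_comm, hX, hwN', add_sub_cancel_right]
  have e2 : κ * ‖X - W‖ ≤ ‖hgy.toLp _‖ := by
    have := norm_sub_convOp_ge hK (h 1 zero_le_one le_rfl) (X - W)
    rwa [Complex.ofReal_one, one_smul, e1] at this
  have e3 : ∫⁻ t, ‖x t‖ₑ ^ 2 ≤ ‖X - W‖ₑ ^ 2 := by
    rw [← lintegral_sq_eq_enorm_sq]
    refine lintegral_mono_ae ?_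
    filter_upwards [hx.coeFn_toLp, Lp.coeFn_sub X W, mem_vanishBefore.1 w.2] with t h1 h2 h3
    rcases lt_or_ge t τ with h | h
    · rw [h2, Pi.sub_apply, h1, h3 h, sub_zero]
    · simp [hxτ t h]
  have e4 : ∫⁻ t in Iio τ, ‖g t‖ₑ ^ 2 = ‖hgy.toLp _‖ₑ ^ 2 := by
    rw [← lintegral_sq_eq_enorm_sq, ← lintegral_indicator measurableSet_Iio]
    refine lintegral_congr_ae ?_
    filter_upwards [hgy.coeFn_toLp] with t ht
    rw [ht]
    by_cases h : t ∈ Iio τ <;> simp [h]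
  rw [e4]
  calc ENNReal.ofReal (κ ^ 2) * ∫⁻ t, ‖x t‖ₑ ^ 2 ≤ ENNReal.ofReal (κ ^ 2) * ‖X - W‖ₑ ^ 2 := by gcongr
    _ = ENNReal.ofReal (κ * ‖X - W‖) ^ 2 := by
      rw [ENNReal.ofReal_mul hκ.le, mul_pow, ENNReal.ofReal_pow hκ.le, ofReal_norm]
    _ ≤ _ := by
      rw [← ofReal_norm]; gcongr

/-! ### Regularity of a profile in `H^s`, `s > 3/2` -/

theorem integrable_weight_neg {r : ℝ} (hr : 1 / 2 < r) : Integrable (weight (-r)) := by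
  have h := (integrable_rpow_neg_one_add_norm_sq (E := ℝ) (μ := volume) (r := 2 * r)
    (by rw [Module.finrank_self]; push_cast; linarith)).comp_mul_left' (R := 2 * Real.pi) (by positivity)
  refine h.congr (ae_of_all _ fun ξ => ?_)
  simp only [weight, Real.norm_eq_abs, sq_abs]
  congr 1; ring

theorem one_le_weight {s : ℝ} (hs : 0 ≤ s) (ξ : ℝ) : 1 ≤ weight s ξ :=
  Real.one_le_rpow (by nlinarith [sq_nonneg (2 * Real.pi * ξ)]) hs

theorem weight_mono {s r : ℝ} (h : s ≤ r) (ξ : ℝ) : weight s ξ ≤ weight r ξ :=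
  Real.rpow_le_rpow_of_exponent_le (by nlinarith [sq_nonneg (2 * Real.pi * ξ)]) h

theorem weight_add (s r ξ : ℝ) : weight (s + r) ξ = weight s ξ * weight r ξ :=
  Real.rpow_add (by positivity) _ _

theorem sq_le_weight {s : ℝ} (hs : 1 ≤ s) (ξ : ℝ) : (2 * Real.pi * ξ) ^ 2 ≤ weight s ξ := by
  refine le_trans ?_ (weight_mono hs ξ)
  rw [weight, Real.rpow_one]; linarith

theorem abs_rpow_le_weight {a : ℝ} (ha : 0 ≤ a) (ξ : ℝ) : |2 * Real.pi * ξ| ^ a ≤ weight (a / 2) ξ := by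
  have : |2 * Real.pi * ξ| ^ a = ((2 * Real.pi * ξ) ^ 2) ^ (a / 2) := by
    rw [← sq_abs, ← Real.rpow_natCast, ← Real.rpow_mul (abs_nonneg _)]; congr 1; push_cast; ring
  rw [this, weight]
  exact Real.rpow_le_rpow (sq_nonneg _) (by linarith) (by linarith)

/-- Cauchy-Schwarz with `r/2 = (r - s)/2 + s/2`: the weight with exponent `r - s` is integrable
because `s - r > 1/2`, and the rest is the Sobolev norm. -/
theorem integrable_weight_mul_fourier {s r : ℝ} (hr : r < s - 1 / 2) {g : ℝ → ℝ} (hg : Integrable g)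
    (hs : sobolevSq s g < ⊤) :
    Integrable (fun ξ => (weight (r / 2) ξ : ℂ) * 𝓕 (fun v => (g v : ℂ)) ξ) := by
  have hg' : Integrable fun v => (g v : ℂ) := hg.ofReal
  have hcont := continuous_fourier hg'
  refine ⟨((Complex.continuous_ofReal.comp (continuous_weight _)).mul hcont).aestronglyMeasurable, ?_⟩
  rw [hasFiniteIntegral_iff_enorm]
  have e : ∀ ξ, ‖(weight (r / 2) ξ : ℂ) * 𝓕 (fun v => (g v : ℂ)) ξ‖ₑ =
      ENNReal.ofReal (weight ((r - s) / 2) ξ) *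
        (ENNReal.ofReal (weight (s / 2) ξ) * ‖𝓕 (fun v => (g v : ℂ)) ξ‖ₑ) := by
    intro ξ
    rw [← mul_assoc, ← ENNReal.ofReal_mul (weight_pos _ _).le, ← weight_add, enorm_mul]
    congr 1
    rw [← ofReal_norm, Complex.norm_real, Real.norm_eq_abs, abs_of_pos (weight_pos _ _)]
    congr 2; ring
  have sq : ∀ a ξ, ENNReal.ofReal (weight (a / 2) ξ) ^ 2 = ENNReal.ofReal (weight a ξ) := by
    intro a ξ
    rw [← ENNReal.ofReal_pow (weight_pos _ _).le, pow_two, ← weight_add]; congr 2; ring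
  simp_rw [e]
  have := lintegral_mul_sq_le (μ := volume) (f := fun ξ => ENNReal.ofReal (weight ((r - s) / 2) ξ))
    (g := fun ξ => ENNReal.ofReal (weight (s / 2) ξ) * ‖𝓕 (fun v => (g v : ℂ)) ξ‖ₑ)
    (continuous_weight _).measurable.ennreal_ofReal.aemeasurable
    ((continuous_weight _).measurable.ennreal_ofReal.mul hcont.measurable.enorm).aemeasurable
  simp_rw [mul_pow, sq] at this
  have h1 : ∫⁻ ξ, ENNReal.ofReal (weight (r - s) ξ) < ⊤ := by
    have := (integrable_weight_neg (r := s - r) (by linarith))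
    rw [neg_sub] at this
    rw [← ofReal_integral_eq_lintegral_ofReal this (ae_of_all _ fun ξ => (weight_pos _ _).le)]
    exact ENNReal.ofReal_lt_top
  have h2 := this.trans_lt (ENNReal.mul_lt_top h1 hs)
  rwa [ENNReal.pow_lt_top_iff, or_iff_left (by norm_num)] at h2

/-- A profile of Sobolev regularity `s > 3/2`. -/
structure IsRegularProfile (s : ℝ) (f₀ : ℝ → ℝ) : Prop where
  gt : 3 / 2 < s
  profile : IsProfile f₀
  continuous : Continuous f₀
  sobolev : sobolevSq s f₀ < ⊤

/-- The Fourier transform of the derivative of `f₀`. -/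
def derivSymbol (f₀ : ℝ → ℝ) (ξ : ℝ) : ℂ :=
  2 * Real.pi * Complex.I * ξ * 𝓕 (fun v => (f₀ v : ℂ)) ξ

namespace IsRegularProfile

variable {s : ℝ} {f₀ : ℝ → ℝ}

theorem integrable_ofReal (h : IsRegularProfile s f₀) : Integrable fun v => (f₀ v : ℂ) :=
  h.profile.integrable.ofReal

theorem continuous_fourier (h : IsRegularProfile s f₀) : Continuous (𝓕 fun v => (f₀ v : ℂ)) :=
  VlasovPoisson.continuous_fourier h.integrable_ofReal

theorem integrable_rpow_mul_fourier (h : IsRegularProfile s f₀) {a : ℝ} (ha0 : 0 ≤ a)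
    (ha : a < s - 1 / 2) :
    Integrable (fun ξ => |2 * Real.pi * ξ| ^ a * ‖𝓕 (fun v => (f₀ v : ℂ)) ξ‖) := by
  refine (integrable_weight_mul_fourier ha h.profile.integrable h.sobolev).norm.mono' ?_
    (ae_of_all _ fun ξ => ?_)
  · refine Continuous.aestronglyMeasurable ?_
    exact ((by fun_prop : Continuous fun ξ : ℝ => |2 * Real.pi * ξ|).rpow_const
      (fun _ => Or.inr ha0)).mul h.continuous_fourier.norm
  · rw [norm_mul, norm_mul, norm_norm, Complex.norm_real, Real.norm_eq_abs, Real.norm_eq_abs,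
      abs_of_pos (weight_pos _ _), abs_of_nonneg (by positivity)]
    gcongr
    exact abs_rpow_le_weight ha0 ξ

theorem integrable_fourier (h : IsRegularProfile s f₀) : Integrable (𝓕 fun v => (f₀ v : ℂ)) := by
  have := h.integrable_rpow_mul_fourier (a := 0) le_rfl (by linarith [h.gt])
  simp only [Real.rpow_zero, one_mul] at this
  exact (integrable_norm_iff h.continuous_fourier.aestronglyMeasurable).1 this

theorem continuous_derivSymbol (h : IsRegularProfile s f₀) : Continuous (derivSymbol f₀) := by
  unfold derivSymbol
  exact (by fun_prop : Continuous fun ξ : ℝ => (2 * Real.pi * Complex.I * ξ : ℂ)).mul h.continuous_fourier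

theorem norm_derivSymbol (ξ : ℝ) :
    ‖derivSymbol f₀ ξ‖ = |2 * Real.pi * ξ| * ‖𝓕 (fun v => (f₀ v : ℂ)) ξ‖ := by
  unfold derivSymbol
  simp [abs_mul, abs_of_pos Real.pi_pos]

theorem integrable_derivSymbol (h : IsRegularProfile s f₀) : Integrable (derivSymbol f₀) := by
  have := h.integrable_rpow_mul_fourier (a := 1) zero_le_one (by linarith [h.gt])
  rw [← integrable_norm_iff h.continuous_derivSymbol.aestronglyMeasurable]
  simpa only [norm_derivSymbol, Real.rpow_one] using this

theorem memLp_derivSymbol (h : IsRegularProfile s f₀) : MemLp (derivSymbol f₀) 2 := by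
  refine ⟨h.continuous_derivSymbol.aestronglyMeasurable, ?_⟩
  rw [eLpNorm_lt_top_iff_lintegral_rpow_enorm_lt_top (by norm_num) (by norm_num)]
  refine lt_of_le_of_lt (lintegral_mono fun ξ => ?_) h.sobolev
  simp only [ENNReal.toReal_ofNat, ENNReal.rpow_ofNat]
  rw [← ofReal_norm, norm_derivSymbol, ENNReal.ofReal_mul (abs_nonneg _), mul_pow,
    ← ENNReal.ofReal_pow (abs_nonneg _), sq_abs, ofReal_norm]
  gcongr
  exact sq_le_weight (by linarith [h.gt]) ξ

/-- Fourier inversion writes `f₀ v` as the double transform at `-v`, and the transform may be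
differentiated under the integral because `ξ f̂₀(ξ)` is integrable. -/
theorem hasDerivAt_ofReal (h : IsRegularProfile s f₀) (v : ℝ) :
    HasDerivAt (fun v => (f₀ v : ℂ)) (𝓕 (derivSymbol f₀) (-v)) v := by
  have hinv : (fun v => (f₀ v : ℂ)) = fun v => 𝓕 (𝓕 fun v => (f₀ v : ℂ)) (-v) := by
    have := Continuous.fourierInv_fourier_eq (f := fun v => (f₀ v : ℂ))
      (Complex.continuous_ofReal.comp h.continuous) h.integrable_ofReal h.integrable_fourier
    conv_lhs => rw [← this]
    ext v
    rw [Real.fourierInv_eq_fourier_neg]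
  have hx : Integrable (fun x : ℝ => x • 𝓕 (fun v => (f₀ v : ℂ)) x) := by
    refine (h.integrable_derivSymbol.const_mul (2 * Real.pi * Complex.I)⁻¹).congr
      (ae_of_all _ fun ξ => ?_)
    simp only [derivSymbol, Complex.real_smul]
    have := Complex.two_pi_I_ne_zero
    field_simp
  have h1 := (Real.hasDerivAt_fourier h.integrable_fourier hx (-v)).scomp v (hasDerivAt_neg v)
  rw [hinv]
  convert! h1 using 1
  rw [show derivSymbol f₀ = fun ξ : ℝ => -((-2 * Real.pi * Complex.I * ξ) • 𝓕 (fun v => (f₀ v : ℂ)) ξ) by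
    ext ξ; simp [derivSymbol]]
  simp only [Real.fourier_real_eq_integral_exp_smul, smul_neg, integral_neg, neg_smul, one_smul]

theorem hasDerivAt (h : IsRegularProfile s f₀) (v : ℝ) :
    HasDerivAt f₀ ((𝓕 (derivSymbol f₀) (-v)).re) v := by
  have := (Complex.reCLM.hasFDerivAt).comp_hasDerivAt v (h.hasDerivAt_ofReal v)
  simpa using! this

theorem ofReal_deriv (h : IsRegularProfile s f₀) (v : ℝ) :
    ((deriv f₀ v : ℝ) : ℂ) = 𝓕 (derivSymbol f₀) (-v) := by
  have h1 := (h.hasDerivAt v).ofReal_comp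
  rw [(h.hasDerivAt v).deriv]
  exact h1.unique (h.hasDerivAt_ofReal v)

theorem continuous_deriv (h : IsRegularProfile s f₀) : Continuous (deriv f₀) := by
  have : deriv f₀ = fun v => (𝓕 (derivSymbol f₀) (-v)).re := funext fun v => (h.hasDerivAt v).deriv
  rw [this]
  exact Complex.continuous_re.comp
    ((VlasovPoisson.continuous_fourier h.integrable_derivSymbol).comp continuous_neg)

theorem integrable_sq_deriv (h : IsRegularProfile s f₀) : Integrable fun v => deriv f₀ v ^ 2 := by
  have := (memLp_fourier h.integrable_derivSymbol h.memLp_derivSymbol).comp_measurePreserving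
    (Measure.measurePreserving_neg volume)
  have h2 := (memLp_two_iff_integrable_sq_norm this.1).1 this
  refine h2.congr (ae_of_all _ fun v => ?_)
  simp only [Function.comp, ← h.ofReal_deriv, Complex.norm_real, Real.norm_eq_abs, sq_abs]

/-- Inserting `|e^{iθ} - 1| ≤ 2|θ|^α` into the Fourier formula for `f₀'` leaves the integral of
`|ξ|^(1+α) |f̂₀|`, finite since `1 + α < s - 1/2`. -/
theorem deriv_holder (h : IsRegularProfile s f₀) {α : ℝ} (h0 : 0 < α) (h1 : α ≤ 1)
    (h2 : α < s - 3 / 2) :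
    ∃ C, ∀ v c, |deriv f₀ v - deriv f₀ c| ≤ C * |v - c| ^ α := by
  have hI := h.integrable_rpow_mul_fourier (a := 1 + α) (by linarith) (by linarith)
  refine ⟨∫ ξ, 2 * (|2 * Real.pi * ξ| ^ (1 + α) * ‖𝓕 (fun v => (f₀ v : ℂ)) ξ‖), fun v c => ?_⟩
  have hpt : ∀ θ : ℝ, ‖Complex.exp (Complex.I * θ) - 1‖ ≤ 2 * |θ| ^ α := by
    intro θ
    rcases le_or_gt |θ| 1 with hθ | hθ
    · refine Real.norm_exp_I_mul_ofReal_sub_one_le.trans ?_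
      have := Real.rpow_le_rpow_of_exponent_ge' (abs_nonneg θ) hθ h0.le h1
      rw [Real.rpow_one] at this
      rw [Real.norm_eq_abs]; linarith [abs_nonneg θ]
    · have := Real.one_le_rpow hθ.le h0.le
      calc ‖Complex.exp (Complex.I * θ) - 1‖ ≤ ‖Complex.exp (Complex.I * θ)‖ + ‖(1 : ℂ)‖ := norm_sub_le _ _
        _ = 2 := by rw [mul_comm, Complex.norm_exp_ofReal_mul_I, norm_one]; norm_num
        _ ≤ _ := by linarith
  have e : ((deriv f₀ v - deriv f₀ c : ℝ) : ℂ) = 𝓕 (derivSymbol f₀) (-v) - 𝓕 (derivSymbol f₀) (-c) := by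
    rw [← h.ofReal_deriv, ← h.ofReal_deriv]; push_cast; rfl
  have hint : ∀ w : ℝ, Integrable fun ξ : ℝ =>
      Complex.exp ((-2 * Real.pi * ξ * w : ℝ) * Complex.I) • derivSymbol f₀ ξ := by
    intro w
    refine h.integrable_derivSymbol.mono ?_ (ae_of_all _ fun ξ => ?_)
    · exact ((by fun_prop : Continuous fun ξ : ℝ => Complex.exp ((-2 * Real.pi * ξ * w : ℝ) * Complex.I)).smul
        h.continuous_derivSymbol).aestronglyMeasurable
    · rw [norm_smul, Complex.norm_exp_ofReal_mul_I, one_mul]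
  rw [← Real.norm_eq_abs, ← Complex.norm_real, e, Real.fourier_real_eq_integral_exp_smul,
    Real.fourier_real_eq_integral_exp_smul, ← integral_sub (hint _) (hint _), ← integral_mul_const]
  refine norm_integral_le_of_norm_le ((hI.const_mul 2).mul_const _) (ae_of_all _ fun ξ => ?_)
  rw [← sub_smul, norm_smul, norm_derivSymbol]
  have e2 : Complex.exp ((-2 * Real.pi * ξ * -v : ℝ) * Complex.I) - Complex.exp ((-2 * Real.pi * ξ * -c : ℝ) * Complex.I)
      = Complex.exp ((-2 * Real.pi * ξ * -c : ℝ) * Complex.I) *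
        (Complex.exp (Complex.I * ((2 * Real.pi * ξ) * (v - c) : ℝ)) - 1) := by
    rw [mul_sub, ← Complex.exp_add, mul_one]; congr 2; push_cast; ring
  rw [e2, norm_mul, Complex.norm_exp_ofReal_mul_I, one_mul]
  have := hpt ((2 * Real.pi * ξ) * (v - c))
  rw [abs_mul, Real.mul_rpow (abs_nonneg _) (abs_nonneg _)] at this
  rcases eq_or_ne ξ 0 with rfl | hξ
  · simp [Real.zero_rpow (by linarith : 1 + α ≠ 0)]
  · rw [Real.rpow_add (by positivity), Real.rpow_one]
    calc _ ≤ (2 * (|2 * Real.pi * ξ| ^ α * |v - c| ^ α)) * (|2 * Real.pi * ξ| * ‖𝓕 (fun v => (f₀ v : ℂ)) ξ‖) := by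
          gcongr
      _ = _ := by ring

/-- At a critical point `c`, the function `f₀'(v) / (v - c)` is integrable. -/
theorem integrable_deriv_div (h : IsRegularProfile s f₀) {c : ℝ} (hc : deriv f₀ c = 0) :
    Integrable fun v => deriv f₀ v / (v - c) := by
  have hg := h.gt
  -- The half keeps the exponent strictly below `s - 3/2`, as the Hölder estimate demands.
  set α := min 1 ((s - 3 / 2) / 2)
  have hα0 : 0 < α := lt_min one_pos (by linarith)
  obtain ⟨C, hC⟩ := h.deriv_holder hα0 (min_le_left _ _)
    (lt_of_le_of_lt (min_le_right _ _) (by linarith))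
  have hm : AEStronglyMeasurable (fun v => deriv f₀ v / (v - c)) :=
    (h.continuous_deriv.measurable.div (measurable_id.sub_const c)).aestronglyMeasurable
  have hnear : Integrable ((Icc (-1 : ℝ) 1).indicator fun v => |v| ^ (α - 1)) := by
    rw [integrable_indicator_iff measurableSet_Icc, ← intervalIntegrable_iff_integrableOn_Icc_of_le (by norm_num)]
    have h1 : IntervalIntegrable (fun v : ℝ => |v| ^ (α - 1)) volume 0 1 := by
      refine (intervalIntegral.intervalIntegrable_rpow' (by linarith : -1 < α - 1)).congr (fun v hv => ?_)
      rw [uIoc_of_le zero_le_one] at hv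
      simp only [abs_of_pos hv.1]
    have h2 : IntervalIntegrable (fun v : ℝ => |v| ^ (α - 1)) volume (-1) 0 := by
      have := h1.comp_mul_left (c := -1)
      simp only [neg_mul, one_mul, abs_neg] at this
      simpa using this.symm
    exact h2.trans h1
  have hfar : Integrable fun v : ℝ => 2 * (1 + v ^ 2)⁻¹ := integrable_inv_one_add_sq.const_mul 2
  have hC0 : 0 ≤ C := by
    have := hC (c + 1) c
    simp only [add_sub_cancel_left, abs_one, Real.one_rpow, mul_one] at this
    exact (abs_nonneg _).trans this
  -- Majorant: within distance one of `c`, the Hölder bound and `f₀'(c) = 0` give `C|v - c|^(α-1)`;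
  -- farther away, `ab ≤ a² + b²` with `b = |v - c|⁻¹` and `b² ≤ 2/(1 + (v - c)²)`.
  refine (((hnear.comp_sub_right c).const_mul C).add
    (h.integrable_sq_deriv.add (hfar.comp_sub_right c))).mono' hm (ae_of_all _ fun v => ?_)
  have hb := hC v c
  rw [hc, sub_zero] at hb
  simp only [Pi.add_apply]
  rw [Real.norm_eq_abs, abs_div]
  have p1 : 0 ≤ deriv f₀ v ^ 2 := sq_nonneg _
  have p2 : 0 ≤ 2 * (1 + (v - c) ^ 2)⁻¹ := by positivity
  by_cases hv : v - c ∈ Icc (-1 : ℝ) 1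
  · rw [indicator_of_mem hv]
    have : |deriv f₀ v| / |v - c| ≤ C * |v - c| ^ (α - 1) := by
      rcases eq_or_ne (v - c) 0 with h0 | h0
      · rw [h0]; simp; positivity
      · rw [Real.rpow_sub_one (by simpa using h0), ← mul_div_assoc]
        gcongr
    linarith
  · rw [indicator_of_notMem hv, mul_zero, zero_add]
    have h1 : 1 < |v - c| := by
      by_contra hcon
      exact hv (abs_le.1 (not_lt.1 hcon))
    have h2 : |v - c|⁻¹ ^ 2 ≤ 2 * (1 + (v - c) ^ 2)⁻¹ := by
      rw [inv_pow, sq_abs, ← div_eq_mul_inv, inv_eq_one_div, div_le_div_iff₀ (by rw [← sq_abs]; positivity) (by positivity)]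
      have : 1 < |v - c| ^ 2 := one_lt_pow₀ h1 (by norm_num)
      rw [sq_abs] at this; linarith
    rw [div_eq_mul_inv]
    nlinarith [sq_nonneg (|deriv f₀ v| - |v - c|⁻¹), sq_abs (deriv f₀ v), sq_nonneg (|v - c|⁻¹)]

end IsRegularProfile

/-! ### The dispersion relation and the stability condition -/

theorem hasDerivAt_laplace_primitive {a : ℂ} (ha : a ≠ 0) (w : ℝ) :
    HasDerivAt (fun w : ℝ => -((w : ℂ) / a + 1 / a ^ 2) * Complex.exp (-(a * w)))
      (w * Complex.exp (-(a * w))) w := by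
  have h1 : HasDerivAt (fun w : ℝ => (w : ℂ)) 1 w := Complex.ofRealCLM.hasDerivAt
  have h2 := ((h1.div_const a).add_const (1 / a ^ 2)).neg
  have h3 := ((h1.const_mul a).neg).cexp
  convert! h2.mul h3 using 1
  simp only [Pi.neg_apply]
  field_simp
  ring

theorem integrableOn_mul_exp_neg {a : ℂ} (ha : 0 < a.re) :
    IntegrableOn (fun w : ℝ => (w : ℂ) * Complex.exp (-(a * w))) (Ioi 0) := by
  have h := integrableOn_rpow_mul_exp_neg_mul_rpow (p := 1) (s := 1) (b := a.re) (by norm_num) one_pos ha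
  refine Integrable.mono' h ?_ ?_
  · exact (by fun_prop : Continuous fun w : ℝ => (w : ℂ) * Complex.exp (-(a * w))).aestronglyMeasurable
  · refine (ae_restrict_iff' measurableSet_Ioi).2 (ae_of_all _ fun w hw => ?_)
    rw [norm_mul, Complex.norm_exp, Complex.norm_real, Real.norm_eq_abs, abs_of_pos hw]
    simp

theorem integral_mul_exp_neg {a : ℂ} (ha : 0 < a.re) :
    ∫ w in Ioi (0 : ℝ), (w : ℂ) * Complex.exp (-(a * w)) = 1 / a ^ 2 := by
  have ha0 : a ≠ 0 := by rintro rfl; simp at ha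
  have hlim : Tendsto (fun w : ℝ => -((w : ℂ) / a + 1 / a ^ 2) * Complex.exp (-(a * w))) atTop (𝓝 0) := by
    rw [tendsto_zero_iff_norm_tendsto_zero]
    have e1 : Tendsto (fun w : ℝ => w * Real.exp (-(a.re * w))) atTop (𝓝 0) := by
      have := tendsto_rpow_mul_exp_neg_mul_atTop_nhds_zero 1 a.re ha
      simpa using this
    have e2 : Tendsto (fun w : ℝ => Real.exp (-(a.re * w))) atTop (𝓝 0) :=
      Real.tendsto_exp_neg_atTop_nhds_zero.comp (tendsto_id.const_mul_atTop ha)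
    have e3 := (e1.mul_const ‖a‖⁻¹).add (e2.mul_const (‖a‖ ^ 2)⁻¹)
    simp only [zero_mul, add_zero] at e3
    refine squeeze_zero_norm' ?_ e3
    filter_upwards [eventually_ge_atTop 0] with w hw
    rw [norm_norm, norm_mul, Complex.norm_exp, norm_neg]
    have : ‖(w : ℂ) / a + 1 / a ^ 2‖ ≤ w * ‖a‖⁻¹ + (‖a‖ ^ 2)⁻¹ := by
      refine (norm_add_le _ _).trans (le_of_eq ?_)
      simp [abs_of_nonneg hw, div_eq_mul_inv]
    have e : (-(a * (w : ℂ))).re = -(a.re * w) := by simp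
    rw [e]
    calc _ ≤ (w * ‖a‖⁻¹ + (‖a‖ ^ 2)⁻¹) * Real.exp (-(a.re * w)) := by gcongr
      _ = _ := by ring
  have := integral_Ioi_of_hasDerivAt_of_tendsto' (fun w _ => hasDerivAt_laplace_primitive ha0 w)
    (integrableOn_mul_exp_neg ha) hlim
  rw [this]; simp

/-- The kernel of the linearized equation for the density, at unit wave number. -/
def dispersionKernel (f₀ : ℝ → ℝ) : ℝ → ℂ :=
  (Ioi (0 : ℝ)).indicator fun w => -(w : ℂ) * 𝓕 (fun v => (f₀ v : ℂ)) w

namespace IsRegularProfile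

variable {s : ℝ} {f₀ : ℝ → ℝ}

theorem integrable_mul_fourier (h : IsRegularProfile s f₀) :
    Integrable fun w : ℝ => (w : ℂ) * 𝓕 (fun v => (f₀ v : ℂ)) w := by
  refine (h.integrable_derivSymbol.const_mul (2 * Real.pi * Complex.I)⁻¹).congr
    (ae_of_all _ fun ξ => ?_)
  simp only [derivSymbol]
  have := Complex.two_pi_I_ne_zero
  field_simp

theorem integrable_dispersionKernel (h : IsRegularProfile s f₀) :
    Integrable (dispersionKernel f₀) := by
  refine Integrable.indicator ?_ measurableSet_Ioi
  simp only [neg_mul]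
  exact h.integrable_mul_fourier.neg

theorem fourier_dispersionKernel (y : ℝ) : 𝓕 (dispersionKernel f₀) y =
    ∫ w in Ioi (0 : ℝ), -(w : ℂ) * 𝓕 (fun v => (f₀ v : ℂ)) w * Complex.exp (-2 * Real.pi * w * y * Complex.I) := by
  rw [Real.fourier_real_eq_integral_exp_smul, ← integral_indicator measurableSet_Ioi]
  refine integral_congr_ae (ae_of_all _ fun w => ?_)
  by_cases hw : w ∈ Ioi (0 : ℝ)
  · simp only [dispersionKernel, indicator_of_mem hw, smul_eq_mul]
    push_cast; ring
  · simp [dispersionKernel, hw]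

theorem normSq_sub_ge {c δ : ℝ} (v : ℝ) :
    min 1 (δ ^ 2) * (1 + (v - c) ^ 2) ≤ ‖(v : ℂ) - (c + δ * Complex.I)‖ ^ 2 := by
  rw [← Complex.normSq_eq_norm_sq, Complex.normSq_apply]
  have e1 : ((v : ℂ) - (c + δ * Complex.I)).re = v - c := by simp
  have e2 : ((v : ℂ) - (c + δ * Complex.I)).im = -δ := by simp
  rw [e1, e2]
  nlinarith [min_le_left 1 (δ ^ 2), min_le_right 1 (δ ^ 2), sq_nonneg (v - c)]

theorem sub_ne_zero_of_pos {c δ : ℝ} (hδ : 0 < δ) (v : ℝ) : (v : ℂ) - (c + δ * Complex.I) ≠ 0 := by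
  intro h
  have := congrArg Complex.im h
  simp at this
  exact hδ.ne' this

theorem integrable_inv_normSq_sub {c δ : ℝ} (hδ : 0 < δ) :
    Integrable fun v : ℝ => (‖(v : ℂ) - (c + δ * Complex.I)‖ ^ 2)⁻¹ := by
  have hm : 0 < min 1 (δ ^ 2) := lt_min one_pos (by positivity)
  refine ((integrable_inv_one_add_sq.comp_sub_right c).const_mul (min 1 (δ ^ 2))⁻¹).mono' ?_ ?_
  · exact (by fun_prop : Measurable fun v : ℝ => (‖(v : ℂ) - (c + δ * Complex.I)‖ ^ 2)⁻¹).aestronglyMeasurable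
  · refine ae_of_all _ fun v => ?_
    rw [Real.norm_eq_abs, abs_of_nonneg (by positivity), ← mul_inv]
    exact inv_anti₀ (by positivity) (normSq_sub_ge v)

theorem integrable_deriv_div_complex (h : IsRegularProfile s f₀) {c δ : ℝ} (hδ : 0 < δ) :
    Integrable fun v : ℝ => ((deriv f₀ v : ℝ) : ℂ) * ((v : ℂ) - (c + δ * Complex.I))⁻¹ := by
  refine (h.integrable_sq_deriv.add (integrable_inv_normSq_sub (c := c) hδ)).mono' ?_ ?_
  · have := h.continuous_deriv.measurable
    exact (by fun_prop : Measurable fun v : ℝ =>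
      ((deriv f₀ v : ℝ) : ℂ) * ((v : ℂ) - (c + δ * Complex.I))⁻¹).aestronglyMeasurable
  · refine ae_of_all _ fun v => ?_
    rw [norm_mul, norm_inv, Complex.norm_real, Real.norm_eq_abs, Pi.add_apply, ← inv_pow]
    nlinarith [sq_nonneg (|deriv f₀ v| - ‖(v : ℂ) - (c + δ * Complex.I)‖⁻¹), sq_abs (deriv f₀ v),
      sq_nonneg (|deriv f₀ v|), sq_nonneg (‖(v : ℂ) - (c + δ * Complex.I)‖⁻¹)]

theorem norm_inv_sub_le {c δ : ℝ} (hδ : 0 < δ) (v : ℝ) : ‖((v : ℂ) - (c + δ * Complex.I))⁻¹‖ ≤ δ⁻¹ := by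
  rw [norm_inv]
  refine inv_anti₀ hδ ?_
  have := Complex.abs_im_le_norm ((v : ℂ) - (c + δ * Complex.I))
  simpa [abs_of_pos hδ] using this

/-- Integration by parts, legitimate because the pole `c + iδ` is off the real axis, so that all
three products are integrable. -/
theorem integral_mul_inv_sq (h : IsRegularProfile s f₀) {c δ : ℝ} (hδ : 0 < δ) :
    ∫ v : ℝ, (f₀ v : ℂ) * (((v : ℂ) - (c + δ * Complex.I)) ^ 2)⁻¹ =
      ∫ v : ℝ, ((deriv f₀ v : ℝ) : ℂ) * ((v : ℂ) - (c + δ * Complex.I))⁻¹ := by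
  have hd : ∀ v : ℝ, HasDerivAt (fun v : ℝ => ((v : ℂ) - (c + δ * Complex.I))⁻¹)
      (-(((v : ℂ) - (c + δ * Complex.I)) ^ 2)⁻¹) v := by
    intro v
    have h1 : HasDerivAt (fun v : ℝ => (v : ℂ)) 1 v := Complex.ofRealCLM.hasDerivAt
    have := (h1.sub_const ((c : ℂ) + δ * Complex.I)).inv (sub_ne_zero_of_pos hδ v)
    convert! this using 1
    rw [neg_div, one_div]
  have hb : ∀ v : ℝ, ‖((v : ℂ) - (c + δ * Complex.I))⁻¹‖ ≤ δ⁻¹ := norm_inv_sub_le hδ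
  have hm : AEStronglyMeasurable fun v : ℝ => ((v : ℂ) - (c + δ * Complex.I))⁻¹ :=
    (by fun_prop : Measurable fun v : ℝ => ((v : ℂ) - (c + δ * Complex.I))⁻¹).aestronglyMeasurable
  have hm2 : AEStronglyMeasurable fun v : ℝ => -(((v : ℂ) - (c + δ * Complex.I)) ^ 2)⁻¹ :=
    (by fun_prop : Measurable fun v : ℝ => -(((v : ℂ) - (c + δ * Complex.I)) ^ 2)⁻¹).aestronglyMeasurable
  have := integral_mul_deriv_eq_deriv_mul_of_integrable (u := fun v : ℝ => (f₀ v : ℂ))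
    (v := fun v : ℝ => ((v : ℂ) - (c + δ * Complex.I))⁻¹) (u' := fun v => ((deriv f₀ v : ℝ) : ℂ))
    (fun v _ => by rw [h.ofReal_deriv]; exact h.hasDerivAt_ofReal v) (fun v _ => hd v)
    (h.integrable_ofReal.mul_bdd (c := δ⁻¹ ^ 2) hm2 (ae_of_all _ fun v => by
      rw [norm_neg, ← inv_pow, norm_pow]; exact pow_le_pow_left₀ (norm_nonneg _) (hb v) 2))
    (h.integrable_deriv_div_complex hδ)
    (h.integrable_ofReal.mul_bdd hm (ae_of_all _ hb))
  simp only [mul_neg, integral_neg, neg_inj] at this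
  exact this

/-- Write out `f̂₀` and exchange the integrals: the `w`-integral is `∫ w e^{-aw} dw = a⁻²` with `a =
2πi(v - ζ)` and `Re a = 2πδ > 0`, where `ζ = c + iδ`. The double pole is then lowered by
`integral_mul_inv_sq`. -/
theorem laplace_dispersion_eq (h : IsRegularProfile s f₀) {c δ : ℝ} (hδ : 0 < δ) :
    ∫ w in Ioi (0 : ℝ), -(w : ℂ) * 𝓕 (fun v => (f₀ v : ℂ)) w *
        Complex.exp (2 * Real.pi * w * (c + δ * Complex.I) * Complex.I) =
      (4 * Real.pi ^ 2 : ℂ)⁻¹ * ∫ v : ℝ, ((deriv f₀ v : ℝ) : ℂ) * ((v : ℂ) - (c + δ * Complex.I))⁻¹ := by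
  rw [← h.integral_mul_inv_sq hδ]
  set ζ : ℂ := c + δ * Complex.I
  have hI : IntegrableOn (fun w : ℝ => (w : ℂ) * Complex.exp (2 * Real.pi * w * ζ * Complex.I)) (Ioi 0) := by
    have := integrableOn_mul_exp_neg (a := -(2 * Real.pi * ζ * Complex.I)) (by simp [ζ]; positivity)
    refine this.congr_fun (fun w _ => ?_) measurableSet_Ioi
    simp only; congr 2; ring
  have hprod := (hI.neg.mul_prod h.integrable_ofReal)
  have hprod2 : Integrable (fun p : ℝ × ℝ => -((p.1 : ℂ) * Complex.exp (2 * Real.pi * p.1 * ζ * Complex.I))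
      * (f₀ p.2 : ℂ) * Complex.exp ((-2 * Real.pi * p.2 * p.1 : ℝ) * Complex.I))
      ((volume.restrict (Ioi 0)).prod volume) := by
    refine hprod.mul_bdd (c := 1) ?_ (ae_of_all _ fun p => ?_)
    · exact (by fun_prop : Continuous fun p : ℝ × ℝ =>
        Complex.exp ((-2 * Real.pi * p.2 * p.1 : ℝ) * Complex.I)).aestronglyMeasurable
    · rw [Complex.norm_exp_ofReal_mul_I]
  calc ∫ w in Ioi (0 : ℝ), -(w : ℂ) * 𝓕 (fun v => (f₀ v : ℂ)) w * Complex.exp (2 * Real.pi * w * ζ * Complex.I)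
      = ∫ w in Ioi (0 : ℝ), ∫ v, -((w : ℂ) * Complex.exp (2 * Real.pi * w * ζ * Complex.I))
      * (f₀ v : ℂ) * Complex.exp ((-2 * Real.pi * v * w : ℝ) * Complex.I) := by
        refine integral_congr_ae (ae_of_all _ fun w => ?_)
        simp only
        rw [Real.fourier_real_eq_integral_exp_smul, mul_right_comm, ← integral_const_mul]
        refine integral_congr_ae (ae_of_all _ fun v => ?_)
        simp only [smul_eq_mul]; ring
    _ = ∫ v, ∫ w in Ioi (0 : ℝ), -((w : ℂ) * Complex.exp (2 * Real.pi * w * ζ * Complex.I))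
      * (f₀ v : ℂ) * Complex.exp ((-2 * Real.pi * v * w : ℝ) * Complex.I) :=
        integral_integral_swap hprod2
    _ = ∫ v, (4 * Real.pi ^ 2 : ℂ)⁻¹ * ((f₀ v : ℂ) * (((v : ℂ) - ζ) ^ 2)⁻¹) := by
        refine integral_congr_ae (ae_of_all _ fun v => ?_)
        have := integral_mul_exp_neg (a := 2 * Real.pi * ((v : ℂ) - ζ) * Complex.I) (by simp [ζ]; positivity)
        have e : ∀ w : ℝ, -((w : ℂ) * Complex.exp (2 * Real.pi * w * ζ * Complex.I))
            * (f₀ v : ℂ) * Complex.exp ((-2 * Real.pi * v * w : ℝ) * Complex.I) =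
            -(f₀ v : ℂ) * ((w : ℂ) * Complex.exp (-(2 * Real.pi * ((v : ℂ) - ζ) * Complex.I * w))) := by
          intro w
          have : Complex.exp (-(2 * Real.pi * ((v : ℂ) - ζ) * Complex.I * w)) =
            Complex.exp (2 * Real.pi * w * ζ * Complex.I) * Complex.exp ((-2 * Real.pi * v * w : ℝ) * Complex.I) := by
            rw [← Complex.exp_add]; congr 1; push_cast; ring
          rw [this]; ring
        simp only [e]
        rw [integral_const_mul, this, mul_pow, mul_pow, mul_pow, Complex.I_sq]
        have := sub_ne_zero_of_pos (c := c) hδ v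
        field_simp
        norm_num
    _ = _ := integral_const_mul _ _

/-- Let `δ → 0+` in `laplace_dispersion_eq`. On the left the exponential has modulus at most one. On
the right `|v - c - iδ| ≥ |v - c|`, and at a critical point `f₀'(v)/(v - c)` is itself integrable,
so dominated convergence applies and no principal value or residue term arises. -/
theorem fourier_dispersionKernel_of_critical (h : IsRegularProfile s f₀) {c : ℝ} (hc : deriv f₀ c = 0) :
    𝓕 (dispersionKernel f₀) (-c) = ((4 * Real.pi ^ 2)⁻¹ * ∫ v, deriv f₀ v / (v - c) : ℝ) := by
  have hδ : Tendsto (fun n : ℕ => 1 / ((n : ℝ) + 1)) atTop (𝓝 0) := tendsto_one_div_add_atTop_nhds_zero_nat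
  have h1 : Tendsto (fun n : ℕ => ∫ w in Ioi (0 : ℝ), -(w : ℂ) * 𝓕 (fun v => (f₀ v : ℂ)) w *
        Complex.exp (2 * Real.pi * w * (c + (1 / ((n : ℝ) + 1) : ℝ) * Complex.I) * Complex.I)) atTop
      (𝓝 (𝓕 (dispersionKernel f₀) (-c))) := by
    rw [fourier_dispersionKernel]
    refine tendsto_integral_of_dominated_convergence _ ?_
      (h.integrable_mul_fourier.norm.integrableOn (s := Ioi 0)) ?_ ?_
    · intro n
      have := h.continuous_fourier
      exact (by fun_prop : Continuous fun w : ℝ => -(w : ℂ) * 𝓕 (fun v => (f₀ v : ℂ)) w *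
        Complex.exp (2 * Real.pi * w * (c + (1 / ((n : ℝ) + 1) : ℝ) * Complex.I) * Complex.I)).aestronglyMeasurable
    · intro n
      refine (ae_restrict_iff' measurableSet_Ioi).2 (ae_of_all _ fun w hw => ?_)
      rw [norm_mul, neg_mul, norm_neg]
      refine mul_le_of_le_one_right (norm_nonneg _) ?_
      rw [Complex.norm_exp]
      refine Real.exp_le_one_iff.2 ?_
      have hw' : (0 : ℝ) < w := hw
      have : (2 * Real.pi * w * (c + (1 / ((n : ℝ) + 1) : ℝ) * Complex.I) * Complex.I : ℂ).re =
          -(2 * Real.pi * w * (1 / ((n : ℝ) + 1))) := by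
        rw [show (2 * Real.pi * w * (c + (1 / ((n : ℝ) + 1) : ℝ) * Complex.I) * Complex.I : ℂ) =
          ((2 * Real.pi * w * c : ℝ) : ℂ) * Complex.I + ((2 * Real.pi * w * (1 / ((n : ℝ) + 1)) : ℝ) : ℂ) * (Complex.I * Complex.I) by
            push_cast; ring, Complex.I_mul_I, mul_neg_one]
        simp only [Complex.add_re, Complex.re_ofReal_mul, Complex.I_re, mul_zero, zero_add, Complex.neg_re,
          Complex.ofReal_re]
      rw [this]
      simp only [Left.neg_nonpos_iff]; positivity
    · refine ae_of_all _ fun w => ?_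
      refine Tendsto.const_mul _ ?_
      have : Continuous fun δ : ℝ => Complex.exp (2 * Real.pi * w * (c + δ * Complex.I) * Complex.I) := by fun_prop
      have := (this.tendsto 0).comp hδ
      convert! this using 2
      congr 1; push_cast; ring
  have h2 : Tendsto (fun n : ℕ => (4 * Real.pi ^ 2 : ℂ)⁻¹ *
      ∫ v : ℝ, ((deriv f₀ v : ℝ) : ℂ) * ((v : ℂ) - (c + (1 / ((n : ℝ) + 1) : ℝ) * Complex.I))⁻¹) atTop
      (𝓝 ((4 * Real.pi ^ 2 : ℂ)⁻¹ * ∫ v, ((deriv f₀ v / (v - c) : ℝ) : ℂ))) := by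
    refine Tendsto.const_mul _ ?_
    refine tendsto_integral_of_dominated_convergence _ ?_ (h.integrable_deriv_div hc).norm ?_ ?_
    · intro n
      exact (h.integrable_deriv_div_complex (by positivity)).1
    · intro n
      refine ae_of_all _ fun v => ?_
      rw [norm_mul, norm_inv, norm_div, Complex.norm_real, div_eq_mul_inv]
      rcases eq_or_ne (v - c) 0 with h0 | h0
      · have : v = c := by linarith
        rw [this, hc]; simp
      · refine mul_le_mul_of_nonneg_left (inv_anti₀ (norm_pos_iff.2 h0) ?_) (norm_nonneg _)
        have := Complex.abs_re_le_norm ((v : ℂ) - (c + (1 / ((n : ℝ) + 1) : ℝ) * Complex.I))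
        rw [Real.norm_eq_abs]
        convert! this using 2
        simp
    · have : ∀ᵐ v : ℝ, v ≠ c := by simp [ae_iff]
      filter_upwards [this] with v hv
      have hv' : (v : ℂ) - c ≠ 0 := by
        rw [← Complex.ofReal_sub]; exact Complex.ofReal_ne_zero.2 (sub_ne_zero.2 hv)
      have e : ((deriv f₀ v / (v - c) : ℝ) : ℂ) = ((deriv f₀ v : ℝ) : ℂ) * ((v : ℂ) - (c + (0 : ℝ) * Complex.I))⁻¹ := by
        push_cast; rw [zero_mul, add_zero, div_eq_mul_inv]
      rw [e]
      refine Tendsto.const_mul _ (Tendsto.inv₀ ?_ (by simpa using hv'))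
      have : Continuous fun δ : ℝ => (v : ℂ) - (c + δ * Complex.I) := by fun_prop
      exact (this.tendsto 0).comp hδ
  have h3 := tendsto_nhds_unique h1 (h2.congr fun n => (h.laplace_dispersion_eq (by positivity)).symm)
  rw [h3, integral_complex_ofReal]
  push_cast; rfl

theorem fourier_neg_eq_conj (w : ℝ) : 𝓕 (fun v => (f₀ v : ℂ)) (-w) =
    (starRingEnd ℂ) (𝓕 (fun v => (f₀ v : ℂ)) w) := by
  rw [Real.fourier_real_eq_integral_exp_smul, Real.fourier_real_eq_integral_exp_smul, ← integral_conj]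
  refine integral_congr_ae (ae_of_all _ fun v => ?_)
  simp only [smul_eq_mul, map_mul, Complex.conj_ofReal, ← Complex.exp_conj, Complex.conj_I]
  congr 2; push_cast; ring

/-- Since `f₀` is real, conjugating the half-line integral that defines the transform gives minus
the integral of the same integrand over the negative half-line. If the transform is real, the
integral over the whole line is therefore zero, and that integral is a multiple of `f₀'(-y)`. -/
theorem deriv_eq_zero_of_im_eq_zero (h : IsRegularProfile s f₀) {y : ℝ}
    (hy : (𝓕 (dispersionKernel f₀) y).im = 0) : deriv f₀ (-y) = 0 := by
  have hconj := Complex.conj_eq_iff_im.2 hy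
  set G : ℝ → ℂ := fun w => -(w : ℂ) * 𝓕 (fun v => (f₀ v : ℂ)) w * Complex.exp (-2 * Real.pi * w * y * Complex.I)
  have hG : Integrable G := by
    refine h.integrable_mul_fourier.neg.mono ?_ (ae_of_all _ fun w => ?_)
    · have := h.continuous_fourier
      exact (by fun_prop : Continuous G).aestronglyMeasurable
    · simp only [G, norm_mul, Pi.neg_apply, norm_neg]
      rw [show (-2 * Real.pi * w * y * Complex.I : ℂ) = ((-2 * Real.pi * w * y : ℝ) : ℂ) * Complex.I by push_cast; ring,
        Complex.norm_exp_ofReal_mul_I, mul_one]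
  have e1 : 𝓕 (dispersionKernel f₀) y = ∫ w in Ioi (0 : ℝ), G w := fourier_dispersionKernel y
  have e2 : (starRingEnd ℂ) (𝓕 (dispersionKernel f₀) y) = -∫ w in Iic (0 : ℝ), G w := by
    rw [e1, ← integral_conj, ← neg_zero, ← integral_comp_neg_Ioi, ← integral_neg, neg_zero]
    refine integral_congr_ae (ae_of_all _ fun w => ?_)
    simp only [G, fourier_neg_eq_conj, map_mul, map_neg, Complex.conj_ofReal, ← Complex.exp_conj, Complex.conj_I]
    push_cast
    rw [show (starRingEnd ℂ) 2 = 2 from Complex.conj_ofNat 2]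
    ring_nf
  have e3 : ∫ w, G w = 0 := by
    rw [← intervalIntegral.integral_Iic_add_Ioi (b := 0) hG.integrableOn hG.integrableOn, ← e1, ← hconj, e2]; ring
  have e4 : 𝓕 (derivSymbol f₀) y = -(2 * Real.pi * Complex.I) * ∫ w, G w := by
    rw [Real.fourier_real_eq_integral_exp_smul, ← integral_const_mul]
    refine integral_congr_ae (ae_of_all _ fun w => ?_)
    simp only [G, derivSymbol, smul_eq_mul]; push_cast; ring
  have := h.ofReal_deriv (-y)
  rw [neg_neg, e4, e3, mul_zero] at this
  exact_mod_cast this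

/-- At a zero, `θT²K̂(y) = 1` forces `K̂(y)` to be real, so `c = -y` is critical and `∫ f₀'/(v - c)
= (2π)²/(θT²) ≥ (2π/T)²`. This contradicts `T < T₀`; the case `θ < 1` only makes the integral
larger. -/
theorem dispersion_ne_zero (h : IsRegularProfile s f₀) {T : ℝ} (hT : 0 < T)
    (hTc : ENNReal.ofReal T < criticalPeriod f₀) {θ : ℝ} (hθ : 0 ≤ θ) (hθ1 : θ ≤ 1) (y : ℝ) :
    1 - (θ * T ^ 2 : ℝ) * 𝓕 (dispersionKernel f₀) y ≠ 0 := by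
  intro h0
  have h1 : ((θ * T ^ 2 : ℝ) : ℂ) * 𝓕 (dispersionKernel f₀) y = 1 := (sub_eq_zero.1 h0).symm
  have ha : 0 < θ * T ^ 2 := by
    rcases hθ.eq_or_lt with rfl | hpos
    · simp at h1
    · positivity
  have him : (𝓕 (dispersionKernel f₀) y).im = 0 := by
    have := congrArg Complex.im h1
    rw [Complex.im_ofReal_mul] at this
    simpa [ha.ne'] using this
  have hc := h.deriv_eq_zero_of_im_eq_zero him
  have hcrit := h.fourier_dispersionKernel_of_critical hc
  rw [neg_neg] at hcrit
  set J := ∫ v, deriv f₀ v / (v - -y)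
  rw [hcrit, ← Complex.ofReal_mul] at h1
  have h2 : θ * T ^ 2 * ((4 * Real.pi ^ 2)⁻¹ * J) = 1 := by exact_mod_cast h1
  have hJ : (2 * Real.pi / T) ^ 2 ≤ J := by
    have hJ0 : 0 < J := by
      by_contra hcon
      have : θ * T ^ 2 * ((4 * Real.pi ^ 2)⁻¹ * J) ≤ 0 :=
        mul_nonpos_of_nonneg_of_nonpos ha.le (mul_nonpos_of_nonneg_of_nonpos (by positivity) (not_lt.1 hcon))
      linarith
    rw [div_pow, div_le_iff₀ (by positivity)]
    have h3 : θ * (J * T ^ 2) = (2 * Real.pi) ^ 2 := by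
      field_simp at h2; nlinarith
    rw [← h3]
    exact mul_le_of_le_one_left (by positivity) hθ1
  have hle : ENNReal.ofReal J ≤ criticalWaveNumberSq f₀ :=
    le_iSup₂_of_le (f := fun c (_ : c ∈ {c : ℝ | deriv f₀ c = 0}) => ENNReal.ofReal (∫ v, deriv f₀ v / (v - c)))
      (-y) hc le_rfl
  have hW : ENNReal.ofReal (2 * Real.pi / T) ≤ criticalWaveNumberSq f₀ ^ (1 / 2 : ℝ) := by
    rw [one_div, ENNReal.le_rpow_inv_iff (by norm_num)]
    refine le_trans ?_ hle
    rw [show (2 : ℝ) = ((2 : ℕ) : ℝ) by norm_num, ENNReal.rpow_natCast, ← ENNReal.ofReal_pow (by positivity)]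
    exact ENNReal.ofReal_le_ofReal (by simpa using hJ)
  have : criticalPeriod f₀ ≤ ENNReal.ofReal T := by
    unfold criticalPeriod
    refine (ENNReal.div_le_div_left hW _).trans (le_of_eq ?_)
    rw [← ENNReal.ofReal_div_of_pos (by positivity)]
    congr 1; field_simp
  exact absurd hTc (not_lt.2 this)

/-- The stability condition, uniformly along the homotopy. -/
theorem exists_dispersion_bound (h : IsRegularProfile s f₀) {T : ℝ} (hT : 0 < T)
    (hTc : ENNReal.ofReal T < criticalPeriod f₀) :
    ∃ κ : ℝ, 0 < κ ∧ ∀ θ : ℝ, 0 ≤ θ → θ ≤ 1 → ∀ y,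
      κ ≤ ‖1 - (θ * T ^ 2 : ℝ) * 𝓕 (dispersionKernel f₀) y‖ := by
  -- Large `y` are handled by the Riemann-Lebesgue lemma: the threshold `(2T²)⁻¹` makes `θT²|K̂| ≤
  -- 1/2`. The remaining `(θ, y)` form a compact set on which the continuous modulus has a positive
  -- minimum.
  have hlim := Real.zero_at_infty_fourier (dispersionKernel f₀)
  have hev : ∀ᶠ y in cocompact ℝ, ‖𝓕 (dispersionKernel f₀) y‖ < (2 * T ^ 2)⁻¹ := by
    have := hlim.norm
    rw [norm_zero] at this
    exact this.eventually_lt_const (by positivity)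
  obtain ⟨S, hS, hSub⟩ := mem_cocompact.1 hev
  have hcont : Continuous fun p : ℝ × ℝ => ‖1 - (p.1 * T ^ 2 : ℝ) * 𝓕 (dispersionKernel f₀) p.2‖ := by
    have := VlasovPoisson.continuous_fourier h.integrable_dispersionKernel
    fun_prop
  obtain ⟨κ, hκ, hκS⟩ : ∃ κ : ℝ, 0 < κ ∧ ∀ θ : ℝ, 0 ≤ θ → θ ≤ 1 → ∀ y ∈ S,
      κ ≤ ‖1 - (θ * T ^ 2 : ℝ) * 𝓕 (dispersionKernel f₀) y‖ := by
    rcases S.eq_empty_or_nonempty with hE | hne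
    · exact ⟨1, one_pos, fun θ _ _ y hy => by simp [hE] at hy⟩
    obtain ⟨p, hp, hmin⟩ := (isCompact_Icc.prod hS).exists_isMinOn
      ((nonempty_Icc.2 (zero_le_one (α := ℝ))).prod hne) hcont.continuousOn
    refine ⟨_, norm_pos_iff.2 (h.dispersion_ne_zero hT hTc hp.1.1 hp.1.2 p.2), fun θ h0 h1 y hy => ?_⟩
    exact hmin (⟨⟨h0, h1⟩, hy⟩ : (θ, y) ∈ Icc (0 : ℝ) 1 ×ˢ S)
  refine ⟨min κ (1 / 2), lt_min hκ (by norm_num), fun θ h0 h1 y => ?_⟩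
  by_cases hy : y ∈ S
  · exact (min_le_left _ _).trans (hκS θ h0 h1 y hy)
  · refine (min_le_right _ _).trans ?_
    have hlt : ‖𝓕 (dispersionKernel f₀) y‖ < (2 * T ^ 2)⁻¹ := hSub hy
    have hb : ‖((θ * T ^ 2 : ℝ) : ℂ) * 𝓕 (dispersionKernel f₀) y‖ ≤ 1 / 2 := by
      rw [norm_mul, Complex.norm_real, Real.norm_eq_abs, abs_of_nonneg (by positivity)]
      calc θ * T ^ 2 * ‖𝓕 (dispersionKernel f₀) y‖ ≤ 1 * T ^ 2 * (2 * T ^ 2)⁻¹ := by gcongr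
        _ = 1 / 2 := by field_simp
    have := norm_sub_norm_le (1 : ℂ) (((θ * T ^ 2 : ℝ) : ℂ) * 𝓕 (dispersionKernel f₀) y)
    rw [norm_one] at this
    linarith

end IsRegularProfile

/-! ### A priori bounds, the Poisson equation in Fourier variables, measurability -/

instance sigmaFinite_cell (T : ℝ) : SigmaFinite (cell T) := by unfold cell; infer_instance

namespace IsSolution

variable {T : ℝ} {I : Set ℝ} {f : ℝ → ℝ × ℝ → ℝ} {E : ℝ → ℝ → ℝ}

theorem integrable_density (h : IsSolution T I f E) {t : ℝ} (ht : t ∈ I) :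
    IntegrableOn (fun x => ∫ v, f t (x, v)) (Ioc 0 T) :=
  (h.integrable t ht).integral_prod_left

theorem intervalIntegrable_density (h : IsSolution T I f E) (hT : 0 < T) {t : ℝ} (ht : t ∈ I)
    (a b : ℝ) : IntervalIntegrable (fun x => 1 - ∫ v, f t (x, v)) volume a b := by
  have hper : Function.Periodic (fun x => 1 - ∫ v, f t (x, v)) T := by
    intro x
    simp only [h.periodic_f t ht]
  refine hper.intervalIntegrable₀ hT.ne' ?_ a b
  refine intervalIntegrable_const.sub ?_
  rw [intervalIntegrable_iff_integrableOn_Ioc_of_le hT.le]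
  exact h.integrable_density ht

theorem continuous_field (h : IsSolution T I f E) (hT : 0 < T) {t : ℝ} (ht : t ∈ I) :
    Continuous (E t) := by
  have e : E t = fun y => E t 0 + ∫ z in (0 : ℝ)..y, (1 - ∫ v, f t (z, v)) := by
    ext y; rw [← h.poisson t ht]; ring
  rw [e]
  exact continuous_const.add
    (intervalIntegral.continuous_primitive (h.intervalIntegrable_density hT ht) 0)

/-- Periodicity of the field makes `1 - ∫ f dv` integrate to zero over a period, so the mass is `T`
at each time without any use of the Vlasov equation. -/
theorem integral_eq (h : IsSolution T I f E) (hT : 0 < T) {t : ℝ} (ht : t ∈ I) :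
    ∫ z, f t z ∂(cell T) = T := by
  have h1 := h.poisson t ht 0 T
  have h2 := h.periodic_E t ht 0
  rw [zero_add] at h2
  rw [h2, sub_self, intervalIntegral.integral_of_le hT.le,
    integral_sub (integrable_const _) (h.integrable_density ht)] at h1
  rw [cell, integral_prod _ (h.integrable t ht)]
  simp at h1
  rw [max_eq_left hT.le] at h1
  linarith

theorem abs_field_sub_le (h : IsSolution T I f E) (hT : 0 < T) {t : ℝ} (ht : t ∈ I) {x y : ℝ}
    (hx : x ∈ Icc 0 T) (hy : y ∈ Icc 0 T) : |E t y - E t x| ≤ 2 * T := by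
  rw [h.poisson t ht, ← Real.norm_eq_abs]
  have hint := h.intervalIntegrable_density hT ht 0 T
  rw [intervalIntegrable_iff_integrableOn_Ioc_of_le hT.le] at hint
  have hsub : uIoc x y ⊆ Ioc 0 T := Ioc_subset_Ioc (le_min hx.1 hy.1) (max_le hx.2 hy.2)
  calc ‖∫ z in x..y, (1 - ∫ v, f t (z, v))‖ ≤ ∫ z in uIoc x y, ‖1 - ∫ v, f t (z, v)‖ :=
        intervalIntegral.norm_integral_le_integral_norm_uIoc
    _ ≤ ∫ z in Ioc 0 T, ‖1 - ∫ v, f t (z, v)‖ :=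
        setIntegral_mono_set hint.norm (ae_of_all _ fun _ => norm_nonneg _) hsub.eventuallyLE
    _ ≤ ∫ z in Ioc 0 T, (1 + ∫ v, f t (z, v)) := by
        refine integral_mono hint.norm ((integrable_const _).add (h.integrable_density ht)) fun z => ?_
        have : 0 ≤ ∫ v, f t (z, v) := integral_nonneg fun v => h.nonneg t ht _
        simp only [Real.norm_eq_abs]
        exact abs_le.2 ⟨by linarith, by linarith⟩
    _ = 2 * T := by
        rw [integral_add (integrable_const _) (h.integrable_density ht)]
        have := h.integral_eq hT ht
        rw [cell, integral_prod _ (h.integrable t ht)] at this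
        rw [this]; simp [hT.le]; ring

/-- The mean is zero, so `T E(y)` is the integral of `E(y) - E(x)` over a period, and these
differences are at most `∫ |1 - ρ| ≤ 2T`. This bound holds without smallness and makes all later
quantities finite a priori. -/
theorem abs_field_le (h : IsSolution T I f E) (hT : 0 < T) {t : ℝ} (ht : t ∈ I) (x : ℝ) :
    |E t x| ≤ 2 * T := by
  have hper : Function.Periodic (E t) T := h.periodic_E t ht
  obtain ⟨y, hy, hxy⟩ := hper.exists_mem_Ico₀ hT x
  rw [hxy]
  have hcont := h.continuous_field hT ht
  have e : T * E t y = ∫ x in (0 : ℝ)..T, (E t y - E t x) := by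
    rw [intervalIntegral.integral_sub intervalIntegrable_const (hcont.intervalIntegrable _ _),
      h.mean_E t ht]
    simp
  have hb : |T * E t y| ≤ 2 * T * |T - 0| := by
    rw [e, ← Real.norm_eq_abs]
    refine intervalIntegral.norm_integral_le_of_norm_le_const fun x hx => ?_
    rw [uIoc_of_le hT.le] at hx
    exact h.abs_field_sub_le hT ht (Ioc_subset_Icc_self hx) (Ico_subset_Icc_self hy)
  rw [abs_mul, sub_zero, abs_of_pos hT] at hb
  nlinarith

/-- The Poisson equation in Fourier variables. -/
theorem integral_mode_mul_field (h : IsSolution T I f E) (hT : 0 < T) {t : ℝ} (ht : t ∈ I) {n : ℤ}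
    (hn : n ≠ 0) : ∫ x in Ioc 0 T, mode T n x * E t x =
      -(T / (2 * Real.pi * n * Complex.I)) * ∫ x in Ioc 0 T, mode T n x * (∫ v, f t (x, v) : ℝ) := by
  set g : ℝ → ℝ := fun x => 1 - ∫ v, f t (x, v)
  have hg : IntegrableOn g (Ioc 0 T) := by
    have := h.intervalIntegrable_density hT ht 0 T
    rwa [intervalIntegrable_iff_integrableOn_Ioc_of_le hT.le] at this
  have hT' : (T : ℂ) ≠ 0 := Complex.ofReal_ne_zero.2 hT.ne'
  have hn' : (n : ℂ) ≠ 0 := Int.cast_ne_zero.2 hn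
  have hpi : (Real.pi : ℂ) ≠ 0 := Complex.ofReal_ne_zero.2 Real.pi_ne_zero
  set c : ℂ := -(T / (2 * Real.pi * n * Complex.I)) with hc
  have hprim : ∀ x, HasDerivAt (fun x => c * mode T n x) (mode T n x) x := by
    intro x
    have h1 : HasDerivAt (fun x : ℝ => (x : ℂ)) 1 x := Complex.ofRealCLM.hasDerivAt
    have := ((((h1.const_mul (2 * Real.pi * n : ℂ)).div_const (T : ℂ)).neg.mul_const Complex.I).cexp).const_mul c
    convert! this using 1
    simp only [mode, hc, Pi.neg_apply]
    field_simp
  have hcm := continuous_mode T n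
  have hper : mode T n T = 1 := by
    rw [mode, Complex.exp_eq_one_iff]
    exact ⟨-n, by push_cast; field_simp⟩
  have hint : ∀ a b : ℝ, ∫ x in a..b, mode T n x = c * mode T n b - c * mode T n a := fun a b =>
    intervalIntegral.integral_eq_sub_of_hasDerivAt (fun x _ => hprim x) (hcm.intervalIntegrable _ _)
  have hzero : ∫ x in Ioc 0 T, mode T n x = 0 := by
    rw [← intervalIntegral.integral_of_le hT.le, hint, hper]; simp [mode]
  -- The field is merely a primitive of the integrable function `g`, so integration by parts is
  -- carried out as Fubini's theorem on the triangle `z ≤ x`.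
  have e1 : ∀ x ∈ Ioc 0 T, mode T n x * E t x = mode T n x * E t 0 +
      ∫ z in Ioc 0 T, (indicator {p : ℝ × ℝ | p.2 ≤ p.1} (fun p => mode T n p.1 * (g p.2 : ℂ)) (x, z)) := by
    intro x hx
    have : E t x = E t 0 + ∫ z in (0 : ℝ)..x, g z := by rw [← h.poisson t ht]; ring
    rw [this, Complex.ofReal_add, mul_add]
    congr 1
    rw [intervalIntegral.integral_of_le hx.1.le, ← integral_complex_ofReal, ← integral_const_mul,
      ← integral_indicator measurableSet_Ioc, ← integral_indicator measurableSet_Ioc]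
    refine integral_congr_ae (ae_of_all _ fun z => ?_)
    by_cases h1 : 0 < z
    · by_cases h2 : z ≤ x
      · have h3 : z ≤ T := h2.trans hx.2
        simp [indicator, h1, h2, h3]
      · simp [indicator, h2]
    · simp [indicator, h1]
  have hprod : Integrable (indicator {p : ℝ × ℝ | p.2 ≤ p.1} (fun p => mode T n p.1 * (g p.2 : ℂ)))
      ((volume.restrict (Ioc 0 T)).prod (volume.restrict (Ioc 0 T))) := by
    refine Integrable.indicator ?_ (measurableSet_le measurable_snd measurable_fst)
    have hgC : Integrable (fun z => (g z : ℂ)) (volume.restrict (Ioc 0 T)) := hg.ofReal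
    exact Integrable.mul_prod (f := mode T n) (g := fun z => (g z : ℂ))
      (hcm.integrableOn_Icc.mono_set Ioc_subset_Icc_self) hgC
  have e2 : ∀ z ∈ Ioc 0 T, ∫ x in Ioc 0 T, (indicator {p : ℝ × ℝ | p.2 ≤ p.1} (fun p => mode T n p.1 * (g p.2 : ℂ)) (x, z))
      = (c - c * mode T n z) * g z := by
    intro z hz
    have : ∫ x in z..T, mode T n x * (g z : ℂ) = (c - c * mode T n z) * g z := by
      rw [intervalIntegral.integral_mul_const, hint, hper, mul_one]
    rw [← this, intervalIntegral.integral_of_le hz.2, ← integral_indicator measurableSet_Ioc,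
      ← integral_indicator measurableSet_Ioc]
    refine integral_congr_ae ?_
    have : ∀ᵐ x : ℝ, x ≠ z := by simp [ae_iff]
    filter_upwards [this] with x hx
    by_cases h1 : z < x
    · have := hz.1.trans h1
      simp [indicator, h1, h1.le, this]
    · have : ¬ z ≤ x := fun h' => h1 (lt_of_le_of_ne h' (Ne.symm hx))
      simp [indicator, h1, this]
  have hE0 : Integrable (fun x => mode T n x * (E t 0 : ℂ)) (volume.restrict (Ioc 0 T)) :=
    ((hcm.mul continuous_const).integrableOn_Icc.mono_set Ioc_subset_Icc_self)
  have hswap := integral_integral_swap (μ := volume.restrict (Ioc 0 T)) (ν := volume.restrict (Ioc 0 T))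
    (f := fun x z => indicator {p : ℝ × ℝ | p.2 ≤ p.1} (fun p => mode T n p.1 * (g p.2 : ℂ)) (x, z)) hprod
  rw [setIntegral_congr_fun measurableSet_Ioc e1, integral_add hE0 hprod.integral_prod_left,
    integral_mul_const, hzero, zero_mul, zero_add, hswap,
    setIntegral_congr_fun measurableSet_Ioc e2]
  have hgint : ∫ z in Ioc 0 T, (g z : ℂ) = 0 := by
    rw [integral_complex_ofReal, ← intervalIntegral.integral_of_le hT.le, ← h.poisson t ht]
    have := h.periodic_E t ht 0
    rw [zero_add] at this
    rw [this]; simp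
  have hgC : Integrable (fun z => (g z : ℂ)) (volume.restrict (Ioc 0 T)) := hg.ofReal
  have hmg : Integrable (fun z => mode T n z * (g z : ℂ)) (volume.restrict (Ioc 0 T)) :=
    hgC.bdd_mul (c := 1) hcm.aestronglyMeasurable (ae_of_all _ fun x => (norm_mode T n x).le)
  have hρC : Integrable (fun z => ((∫ v, f t (z, v) : ℝ) : ℂ)) (volume.restrict (Ioc 0 T)) :=
    (h.integrable_density ht).ofReal
  have hmρ : Integrable (fun z => mode T n z * ((∫ v, f t (z, v) : ℝ) : ℂ)) (volume.restrict (Ioc 0 T)) :=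
    hρC.bdd_mul (c := 1) hcm.aestronglyMeasurable (ae_of_all _ fun x => (norm_mode T n x).le)
  have e3 : ∫ z in Ioc 0 T, (c - c * mode T n z) * g z = c * (∫ z in Ioc 0 T, (g z : ℂ)) - c * ∫ z in Ioc 0 T, mode T n z * g z := by
    rw [← integral_const_mul, ← integral_const_mul, ← integral_sub (hgC.const_mul c) (hmg.const_mul c)]
    refine integral_congr_ae (ae_of_all _ fun z => ?_)
    simp only; ring
  have e4 : ∫ z in Ioc 0 T, mode T n z * g z = -∫ z in Ioc 0 T, mode T n z * (∫ v, f t (z, v) : ℝ) := by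
    have : ∀ z, mode T n z * (g z : ℂ) = mode T n z - mode T n z * (∫ v, f t (z, v) : ℝ) := by
      intro z; simp only [g]; push_cast; ring
    simp only [this]
    rw [integral_sub (hcm.integrableOn_Icc.mono_set Ioc_subset_Icc_self) hmρ, hzero, zero_sub]
  rw [e3, hgint, e4]; ring

/-- Jointly measurable versions of the distribution and of the field. -/
theorem exists_measurable (h : IsSolution T I f E) (hT : 0 < T) (hI : MeasurableSet I) :
    ∃ (F : ℝ × (ℝ × ℝ) → ℝ) (G : ℝ × ℝ → ℝ), StronglyMeasurable F ∧ StronglyMeasurable G ∧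
      ∀ᵐ t ∂(volume.restrict I), (∀ᵐ z ∂(cell T), f t z = F (t, z)) ∧
        ∀ x ∈ Ioc 0 T, E t x = G (t, x) := by
  set F := h.measurable.mk _
  have hF : StronglyMeasurable F := h.measurable.stronglyMeasurable_mk
  set ρ : ℝ × ℝ → ℝ := fun p => 1 - ∫ v, F (p.1, (p.2, v))
  have hρ : StronglyMeasurable ρ := by
    refine stronglyMeasurable_const.sub ?_
    exact StronglyMeasurable.integral_prod_right' (f := fun q : (ℝ × ℝ) × ℝ => F (q.1.1, (q.1.2, q.2)))
      (hF.comp_measurable (by fun_prop))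
  -- For almost every `t`, `J (t, y) = E t y - E t 0` on the period. As `E t` has mean zero,
  -- subtracting the mean of `J` recovers `E t y`; the joint measurability of the field thus follows
  -- from that of `f`.
  set J : ℝ × ℝ → ℝ := fun p => ∫ z in Ioc 0 T, indicator {q : ℝ × ℝ | q.2 ≤ q.1} (fun q => ρ (p.1, q.2)) (p.2, z)
  have hJ : StronglyMeasurable J := by
    refine StronglyMeasurable.integral_prod_right' (ν := volume.restrict (Ioc 0 T))
      (f := fun q : (ℝ × ℝ) × ℝ => indicator {r : ℝ × ℝ | r.2 ≤ r.1} (fun r => ρ (q.1.1, r.2)) (q.1.2, q.2)) ?_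
    have : (fun q : (ℝ × ℝ) × ℝ => indicator {r : ℝ × ℝ | r.2 ≤ r.1} (fun r => ρ (q.1.1, r.2)) (q.1.2, q.2))
      = indicator {q : (ℝ × ℝ) × ℝ | q.2 ≤ q.1.2} (fun q => ρ (q.1.1, q.2)) := by
      ext q; simp [indicator]
    rw [this]
    exact (hρ.comp_measurable (by fun_prop)).indicator (measurableSet_le (by fun_prop) (by fun_prop))
  refine ⟨F, fun p => J p - T⁻¹ * ∫ x in Ioc 0 T, J (p.1, x), hF, ?_, ?_⟩
  · refine hJ.sub (stronglyMeasurable_const.mul ?_)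
    exact StronglyMeasurable.integral_prod_right' (ν := volume.restrict (Ioc 0 T))
      (f := fun q : (ℝ × ℝ) × ℝ => J (q.1.1, q.2)) (hJ.comp_measurable (by fun_prop))
  have hae := Measure.ae_ae_of_ae_prod h.measurable.ae_eq_mk
  filter_upwards [hae, ae_restrict_mem hI] with t ht htI
  refine ⟨ht, fun x hx => ?_⟩
  have hρt : ∀ᵐ z ∂(volume.restrict (Ioc 0 T)), 1 - ∫ v, f t (z, v) = ρ (t, z) := by
    filter_upwards [Measure.ae_ae_of_ae_prod ht] with z hz
    simp only [ρ]
    congr 1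
    exact integral_congr_ae hz
  have hJx : ∀ y ∈ Ioc 0 T, J (t, y) = E t y - E t 0 := by
    intro y hy
    rw [h.poisson t htI, intervalIntegral.integral_of_le hy.1.le]
    simp only [J]
    have : ∀ᵐ z ∂(volume.restrict (Ioc 0 T)), indicator {q : ℝ × ℝ | q.2 ≤ q.1} (fun q => ρ (t, q.2)) (y, z)
        = (Iic y).indicator (fun z => 1 - ∫ v, f t (z, v)) z := by
      filter_upwards [hρt] with z hz
      simp [indicator, hz]
    rw [integral_congr_ae this, setIntegral_indicator measurableSet_Iic]
    congr 2
    ext z; simp only [mem_inter_iff, mem_Ioc, mem_Iic]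
    exact ⟨fun h => ⟨h.1.1, h.2⟩, fun h => ⟨⟨h.1, h.2.trans hy.2⟩, h.2⟩⟩
  have hcont := h.continuous_field hT htI
  have hm : ∫ y in Ioc 0 T, J (t, y) = -(T * E t 0) := by
    rw [setIntegral_congr_fun measurableSet_Ioc hJx,
      integral_sub (hcont.integrableOn_Icc.mono_set Ioc_subset_Icc_self) (integrable_const _)]
    have := h.mean_E t htI
    rw [intervalIntegral.integral_of_le hT.le] at this
    rw [this]; simp [hT.le]
  simp only [hm, hJx x hx]
  field_simp; ring

end IsSolution

/-! ### Characters and pairings with Fourier modes -/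

/-- The character `v ↦ e^{-2πiqv}` of the velocity variable. -/
def wave (q v : ℝ) : ℂ := Complex.exp ((-2 * Real.pi * v * q : ℝ) * Complex.I)

theorem norm_wave (q v : ℝ) : ‖wave q v‖ = 1 := Complex.norm_exp_ofReal_mul_I _

theorem continuous_wave_uncurry : Continuous fun p : ℝ × ℝ => wave p.1 p.2 := by
  unfold wave; fun_prop

theorem continuous_wave (q : ℝ) : Continuous (wave q) :=
  continuous_wave_uncurry.comp (by fun_prop : Continuous fun v : ℝ => (q, v))

theorem contDiff_wave (q : ℝ) : ContDiff ℝ ∞ (wave q) := by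
  unfold wave
  have h1 : ContDiff ℝ ∞ fun v : ℝ => -2 * Real.pi * v * q :=
    (contDiff_const.mul contDiff_id).mul contDiff_const
  exact ((Complex.ofRealCLM.contDiff.comp h1).mul contDiff_const).cexp

theorem wave_add (p q v : ℝ) : wave (p + q) v = wave p v * wave q v := by
  rw [wave, wave, wave, ← Complex.exp_add]; congr 1; push_cast; ring

theorem wave_zero (v : ℝ) : wave 0 v = 1 := by simp [wave]

theorem hasDerivAt_wave (q v : ℝ) :
    HasDerivAt (wave q) (-(2 * Real.pi * q * Complex.I) * wave q v) v := by
  have h1 : HasDerivAt (fun v : ℝ => -2 * Real.pi * v * q) (-2 * Real.pi * q) v := by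
    simpa using ((hasDerivAt_id v).const_mul (-2 * Real.pi)).mul_const q
  have := (h1.ofReal_comp.mul_const Complex.I).cexp
  convert! this using 1
  unfold wave; push_cast; ring

theorem hasDerivAt_mode (T : ℝ) (n : ℤ) (x : ℝ) :
    HasDerivAt (mode T n) (-(2 * Real.pi * n / T * Complex.I) * mode T n x) x := by
  have h1 : HasDerivAt (fun x : ℝ => (x : ℂ)) 1 x := Complex.ofRealCLM.hasDerivAt
  have := ((((h1.const_mul (2 * Real.pi * n : ℂ)).div_const (T : ℂ)).neg.mul_const Complex.I).cexp)
  convert! this using 1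
  simp only [mode, Pi.neg_apply]
  ring

theorem contDiff_mode (T : ℝ) (n : ℤ) : ContDiff ℝ ∞ (mode T n) := by
  unfold mode
  refine ContDiff.cexp (ContDiff.mul (ContDiff.neg (ContDiff.div_const (ContDiff.mul contDiff_const ?_) _)) contDiff_const)
  exact Complex.ofRealCLM.contDiff

theorem norm_exp_sub_one_sub_le (θ : ℝ) : ‖Complex.exp (θ * Complex.I) - 1 - θ * Complex.I‖ ≤ 2 * θ ^ 2 := by
  have hn : ‖(θ * Complex.I : ℂ)‖ = |θ| := by simp
  rcases le_or_gt |θ| 1 with h | h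
  · have := Complex.norm_exp_sub_one_sub_id_le (x := θ * Complex.I) (by rw [hn]; exact h)
    rw [hn, sq_abs] at this
    nlinarith [sq_nonneg θ]
  · have h1 : ‖Complex.exp (θ * Complex.I) - 1‖ ≤ |θ| := by
      rw [mul_comm]; exact Real.norm_exp_I_mul_ofReal_sub_one_le
    have := norm_sub_le (Complex.exp (θ * Complex.I) - 1) (θ * Complex.I)
    rw [hn] at this
    rw [← sq_abs]
    nlinarith

theorem norm_wave_sub_le (p q v : ℝ) : ‖wave p v - wave q v‖ ≤ 2 * Real.pi * |p - q| * |v| := by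
  have : wave p v - wave q v = wave q v * (Complex.exp (Complex.I * (-2 * Real.pi * v * (p - q) : ℝ)) - 1) := by
    rw [mul_sub, mul_one, wave, wave, ← Complex.exp_add]; congr 2; push_cast; ring
  rw [this, norm_mul, norm_wave, one_mul]
  refine Real.norm_exp_I_mul_ofReal_sub_one_le.trans (le_of_eq ?_)
  rw [Real.norm_eq_abs, abs_mul, abs_mul, abs_mul, abs_neg, abs_two, abs_of_pos Real.pi_pos]; ring

/-- The second order remainder in the frequency; it provides the quadratic increments in
`duhamel_cutoff`. -/
theorem norm_wave_taylor_le (q d v : ℝ) :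
    ‖wave q v - wave (q + d) v - 2 * Real.pi * d * Complex.I * (v * wave q v)‖ ≤ 2 * (2 * Real.pi * d * v) ^ 2 := by
  have : wave q v - wave (q + d) v - 2 * Real.pi * d * Complex.I * (v * wave q v) =
      -(wave q v * (Complex.exp ((-2 * Real.pi * v * d : ℝ) * Complex.I) - 1 - (-2 * Real.pi * v * d : ℝ) * Complex.I)) := by
    rw [wave_add, wave, wave]; push_cast; ring
  rw [this, norm_neg, norm_mul, norm_wave, one_mul]
  refine (norm_exp_sub_one_sub_le _).trans (le_of_eq ?_)
  ring

/-- The integral of `φ(x, v)` against `e^{-2πinx/T} g(v)` over a period cell. -/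
def modePair (T : ℝ) (n : ℤ) (φ : ℝ × ℝ → ℝ) (g : ℝ → ℂ) : ℂ :=
  ∫ z, (φ z : ℂ) * (mode T n z.1 * g z.2) ∂(cell T)

section modePair

variable {T : ℝ} {n : ℤ} {φ : ℝ × ℝ → ℝ} {g g₁ g₂ : ℝ → ℂ} {C : ℝ}

theorem integrable_modePair (hφ : Integrable φ (cell T)) (hg : Continuous g) (hC : ∀ v, ‖g v‖ ≤ C) :
    Integrable (fun z => (φ z : ℂ) * (mode T n z.1 * g z.2)) (cell T) := by
  have hφ' : Integrable (fun z => (φ z : ℂ)) (cell T) := hφ.ofReal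
  refine hφ'.mul_bdd (c := C) ?_ (ae_of_all _ fun z => ?_)
  · exact (((continuous_mode T n).comp continuous_fst).mul (hg.comp continuous_snd)).aestronglyMeasurable
  · rw [norm_mul, norm_mode, one_mul]; exact hC _

theorem norm_modePair_le (hφ : Integrable φ (cell T)) (hC : ∀ v, ‖g v‖ ≤ C) :
    ‖modePair T n φ g‖ ≤ C * ∫ z, |φ z| ∂(cell T) := by
  rw [← integral_const_mul]
  refine norm_integral_le_of_norm_le (hφ.abs.const_mul C) (ae_of_all _ fun z => ?_)
  rw [norm_mul, norm_mul, norm_mode, one_mul, Complex.norm_real, Real.norm_eq_abs, mul_comm]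
  gcongr
  exact hC _

theorem modePair_sub {C' : ℝ} (hφ : Integrable φ (cell T)) (h₁ : Continuous g₁) (hC : ∀ v, ‖g₁ v‖ ≤ C)
    (h₂ : Continuous g₂) (hC' : ∀ v, ‖g₂ v‖ ≤ C') :
    modePair T n φ (fun v => g₁ v - g₂ v) = modePair T n φ g₁ - modePair T n φ g₂ := by
  unfold modePair
  rw [← integral_sub (integrable_modePair hφ h₁ hC) (integrable_modePair hφ h₂ hC')]
  refine integral_congr_ae (ae_of_all _ fun z => ?_)
  simp only; ring

theorem modePair_const_mul (c : ℂ) :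
    modePair T n φ (fun v => c * g v) = c * modePair T n φ g := by
  unfold modePair
  rw [← integral_const_mul]
  refine integral_congr_ae (ae_of_all _ fun z => ?_)
  simp only; ring

end modePair

/-- Quadratic increments make `F` continuous with zero right derivative. This allows identities
along the free flow to be derived from the time-integrated equation with fixed test functions,
without differentiating `f` in time. -/
theorem eq_of_norm_sub_le_sq {F : ℝ → ℂ} {a b K : ℝ} (hab : a ≤ b)
    (h : ∀ x y, a ≤ x → x ≤ y → y ≤ b → ‖F y - F x‖ ≤ K * (y - x) ^ 2) : F b = F a := by
  have hcont : ContinuousOn F (Icc a b) := by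
    intro x hx
    rw [Metric.continuousWithinAt_iff]
    intro ε hε
    have hK : ∀ y ∈ Icc a b, dist (F y) (F x) ≤ |K| * dist y x ^ 2 := by
      intro y hy
      rw [dist_eq_norm, Real.dist_eq, sq_abs]
      rcases le_total x y with h1 | h1
      · exact (h x y hx.1 h1 hy.2).trans (by gcongr; exact le_abs_self K)
      · rw [norm_sub_rev]
        refine (h y x hy.1 h1 hx.2).trans ?_
        rw [show (y - x) ^ 2 = (x - y) ^ 2 by ring]
        gcongr; exact le_abs_self K
    have h0 : Tendsto (fun d : ℝ => |K| * d ^ 2) (𝓝 0) (𝓝 0) := by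
      have : Continuous fun d : ℝ => |K| * d ^ 2 := by fun_prop
      simpa using this.tendsto 0
    obtain ⟨δ, hδ, hlt⟩ := Metric.tendsto_nhds_nhds.1 h0 ε hε
    refine ⟨δ, hδ, fun y hy hd => (hK y hy).trans_lt ?_⟩
    have := hlt (x := dist y x) (by simpa using hd)
    rw [dist_zero_right, Real.norm_eq_abs, abs_of_nonneg (by positivity)] at this
    exact this
  refine constant_of_has_deriv_right_zero hcont (fun x hx => ?_) b (right_mem_Icc.2 hab)
  rw [hasDerivWithinAt_iff_isLittleO]
  simp only [smul_zero, sub_zero]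
  rw [Asymptotics.isLittleO_iff]
  intro c hc
  have h1 : ∀ᶠ y in 𝓝[Ici x] x, y ∈ Icc x b := Icc_mem_nhdsGE hx.2
  have h2 : ∀ᶠ y in 𝓝[Ici x] x, |K| * |y - x| < c := by
    refine nhdsWithin_le_nhds ?_
    have : Continuous fun y : ℝ => |K| * |y - x| := by fun_prop
    exact this.continuousAt.eventually_lt continuousAt_const (by simpa using hc)
  filter_upwards [h1, h2] with y hy hy2
  refine (h x y hx.1 hy.1 hy.2).trans ?_
  rw [Real.norm_eq_abs, ← sq_abs, pow_two, ← mul_assoc]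
  gcongr
  exact (mul_le_mul_of_nonneg_right (le_abs_self K) (abs_nonneg _)).trans hy2.le

/-! ### The weak equation for the modes and Duhamel's formula -/

namespace IsSolution

variable {T : ℝ} {I : Set ℝ} {f : ℝ → ℝ × ℝ → ℝ} {E : ℝ → ℝ → ℝ}

theorem integrable_mul_field (h : IsSolution T I f E) (hT : 0 < T) {t : ℝ} (ht : t ∈ I) :
    Integrable (fun z => f t z * E t z.1) (cell T) :=
  (h.integrable t ht).mul_bdd (c := 2 * T)
    ((h.continuous_field hT ht).comp continuous_fst).aestronglyMeasurable
    (ae_of_all _ fun _ => h.abs_field_le hT ht _)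

theorem integral_abs (h : IsSolution T I f E) (hT : 0 < T) {t : ℝ} (ht : t ∈ I) :
    ∫ z, |f t z| ∂(cell T) = T := by
  refine Eq.trans ?_ (h.integral_eq hT ht)
  exact integral_congr_ae (ae_of_all _ fun z => abs_of_nonneg (h.nonneg t ht z))

theorem integral_abs_mul_field_le (h : IsSolution T I f E) (hT : 0 < T) {t : ℝ} (ht : t ∈ I) :
    ∫ z, |f t z * E t z.1| ∂(cell T) ≤ 2 * T ^ 2 := by
  calc ∫ z, |f t z * E t z.1| ∂(cell T) ≤ ∫ z, |f t z| * (2 * T) ∂(cell T) := by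
        refine integral_mono (h.integrable_mul_field hT ht).abs ((h.integrable t ht).abs.mul_const _) fun z => ?_
        simp only [abs_mul]
        exact mul_le_mul_of_nonneg_left (h.abs_field_le hT ht _) (abs_nonneg _)
    _ = 2 * T ^ 2 := by rw [integral_mul_const, h.integral_abs hT ht]; ring

theorem norm_modePair_le (h : IsSolution T I f E) (hT : 0 < T) {t : ℝ} (ht : t ∈ I) {n : ℤ}
    {g : ℝ → ℂ} {C : ℝ} (hC : ∀ v, ‖g v‖ ≤ C) : ‖modePair T n (f t) g‖ ≤ C * T := by
  have := VlasovPoisson.norm_modePair_le (n := n) (h.integrable t ht) hC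
  rwa [h.integral_abs hT ht] at this

theorem norm_modePair_field_le (h : IsSolution T I f E) (hT : 0 < T) {t : ℝ} (ht : t ∈ I) {n : ℤ}
    {g : ℝ → ℂ} {C : ℝ} (hC : ∀ v, ‖g v‖ ≤ C) :
    ‖modePair T n (fun z => f t z * E t z.1) g‖ ≤ C * (2 * T ^ 2) := by
  refine (VlasovPoisson.norm_modePair_le (h.integrable_mul_field hT ht) hC).trans ?_
  exact mul_le_mul_of_nonneg_left (h.integral_abs_mul_field_le hT ht) ((norm_nonneg _).trans (hC 0))

/-- The Vlasov equation tested with `e^{-2πinx/T} g(v)`. -/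
theorem vlasov_mode (h : IsSolution T I f E) (hT : 0 < T) (hI : I.OrdConnected) (n : ℤ) {g : ℝ → ℂ}
    (hg : ContDiff ℝ ∞ g) (hgc : HasCompactSupport g) {t₁ t₂ : ℝ} (h₁ : t₁ ∈ I) (h₂ : t₂ ∈ I) (h₁₂ : t₁ ≤ t₂) :
    IntervalIntegrable (fun u => -(2 * Real.pi * n / T * Complex.I) * modePair T n (f u) (fun v => v * g v)
      - modePair T n (fun z => f u z * E u z.1) (deriv g)) volume t₁ t₂ ∧
    modePair T n (f t₂) g - modePair T n (f t₁) g =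
      ∫ u in t₁..t₂, (-(2 * Real.pi * n / T * Complex.I) * modePair T n (f u) (fun v => v * g v)
        - modePair T n (fun z => f u z * E u z.1) (deriv g)) := by
  have hgd : ∀ v, HasDerivAt g (deriv g v) v := fun v =>
    ((hg.differentiable (by simp)) v).hasDerivAt
  have hgcont := hg.continuous
  have hg'cont : Continuous (deriv g) := hg.continuous_deriv (by simp)
  obtain ⟨C₀, hC₀⟩ := hgc.exists_bound_of_continuous hgcont
  obtain ⟨C₁, hC₁⟩ := (hgc.mul_left (f := fun v : ℝ => (v : ℂ))).exists_bound_of_continuous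
    (Complex.continuous_ofReal.mul hgcont)
  obtain ⟨C₂, hC₂⟩ := hgc.deriv.exists_bound_of_continuous hg'cont
  set Z : ℝ → ℂ := fun u => -(2 * Real.pi * n / T * Complex.I) * modePair T n (f u) (fun v => v * g v)
      - modePair T n (fun z => f u z * E u z.1) (deriv g) with hZ
  -- Test functions are real valued, so the complex identity is obtained from its images under
  -- real-linear functionals, applied below to the real and imaginary parts.
  have key : ∀ L : ℂ →L[ℝ] ℝ, IntervalIntegrable (fun u => L (Z u)) volume t₁ t₂ ∧
      L (modePair T n (f t₂) g - modePair T n (f t₁) g) = ∫ u in t₁..t₂, L (Z u) := by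
    intro L
    have htest : IsTest T (fun z => L (mode T n z.1 * g z.2)) := by
      refine ⟨L.contDiff.comp (((contDiff_mode T n).comp contDiff_fst).mul (hg.comp contDiff_snd)), ?_, ?_⟩
      · intro x v
        have : mode T n (x + T) = mode T n x := by
          rw [mode, mode, Complex.exp_eq_exp_iff_exists_int]
          have : (T : ℂ) ≠ 0 := Complex.ofReal_ne_zero.2 hT.ne'
          exact ⟨-n, by push_cast; field_simp; ring⟩
        simp only [this]
      · obtain ⟨R, hR⟩ := hgc.isBounded.subset_closedBall 0
        refine ⟨R, fun x v hv => ?_⟩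
        have : g v = 0 := by
          by_contra hne
          have := hR (subset_tsupport g hne)
          rw [mem_closedBall_zero_iff, Real.norm_eq_abs] at this
          linarith
        simp [this]
    have hpair : ∀ t ∈ I, ∫ z, f t z * L (mode T n z.1 * g z.2) ∂(cell T) = L (modePair T n (f t) g) := by
      intro t ht
      rw [modePair, ← L.integral_comp_comm (integrable_modePair (h.integrable t ht) hgcont hC₀)]
      refine integral_congr_ae (ae_of_all _ fun z => ?_)
      simp only
      rw [← Complex.real_smul, map_smul, smul_eq_mul]
    have htr : ∀ t ∈ I, transportTerm T (f t) (E t) (fun z => L (mode T n z.1 * g z.2)) = L (Z t) := by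
      intro t ht
      have i1 := integrable_modePair (n := n) (g := fun v => (v : ℂ) * g v) (h.integrable t ht)
        (Complex.continuous_ofReal.mul hgcont) hC₁
      have i2 := integrable_modePair (n := n) (h.integrable_mul_field hT ht) hg'cont hC₂
      simp only [hZ, modePair]
      rw [← integral_const_mul, ← integral_sub (i1.const_mul _) i2]
      refine Eq.trans ?_ (L.integral_comp_comm ((i1.const_mul _).sub i2))
      rw [transportTerm]
      refine integral_congr_ae (ae_of_all _ fun z => ?_)
      have d1 : deriv (fun x => L (mode T n x * g z.2)) z.1 =
          L (-(2 * Real.pi * n / T * Complex.I) * mode T n z.1 * g z.2) :=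
        (L.hasFDerivAt.comp_hasDerivAt z.1 ((hasDerivAt_mode T n z.1).mul_const (g z.2))).deriv
      have d2 : deriv (fun v => L (mode T n z.1 * g v)) z.2 = L (mode T n z.1 * deriv g z.2) :=
        (L.hasFDerivAt.comp_hasDerivAt z.2 ((hgd z.2).const_mul (mode T n z.1))).deriv
      simp only [d1, d2]
      rw [← smul_eq_mul (z.2), ← smul_eq_mul (E t z.1), ← map_smul, ← map_smul, ← map_sub, ← smul_eq_mul,
        ← map_smul]
      congr 1
      simp only [Complex.real_smul]
      push_cast; ring
    obtain ⟨hi, he⟩ := h.vlasov _ htest t₁ h₁ t₂ h₂ h₁₂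
    have hsub : ∀ u ∈ uIcc t₁ t₂, u ∈ I := fun u hu => hI.uIcc_subset h₁ h₂ hu
    refine ⟨hi.congr fun u hu => htr u (hsub u (uIoc_subset_uIcc hu)), ?_⟩
    rw [map_sub, ← hpair _ h₂, ← hpair _ h₁, he]
    exact intervalIntegral.integral_congr fun u hu => htr u (hsub u hu)
  have hre := key Complex.reCLM
  have him := key Complex.imCLM
  have hint : IntervalIntegrable Z volume t₁ t₂ := by
    rw [intervalIntegrable_iff] at *
    have a : IntegrableOn (fun u => ((Complex.reCLM (Z u) : ℝ) : ℂ)) (uIoc t₁ t₂) :=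
      Integrable.ofReal hre.1
    have b : IntegrableOn (fun u => ((Complex.imCLM (Z u) : ℝ) : ℂ) * Complex.I) (uIoc t₁ t₂) :=
      Integrable.mul_const (Integrable.ofReal him.1) _
    refine (a.add b).congr (ae_of_all _ fun u => ?_)
    exact Complex.re_add_im (Z u)
  refine ⟨hint, ?_⟩
  apply Complex.ext
  · have := hre.2
    rw [Complex.reCLM.intervalIntegral_comp_comm hint] at this
    exact this
  · have := him.2
    rw [Complex.imCLM.intervalIntegral_comp_comm hint] at this
    exact this

theorem aestronglyMeasurable_modePair_field (h : IsSolution T I f E) (hT : 0 < T) (hI : MeasurableSet I)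
    (n : ℤ) {Ψ : ℝ × ℝ → ℂ} (hΨ : StronglyMeasurable Ψ) :
    AEStronglyMeasurable (fun u => modePair T n (fun z => f u z * E u z.1) (fun v => Ψ (u, v)))
      (volume.restrict I) := by
  obtain ⟨F, G, hF, hG, hFG⟩ := h.exists_measurable hT hI
  refine ⟨fun u => ∫ z, ((F (u, z) * G (u, z.1) : ℝ) : ℂ) * (mode T n z.1 * Ψ (u, z.2)) ∂(cell T), ?_, ?_⟩
  · refine StronglyMeasurable.integral_prod_right' (ν := cell T)
      (f := fun p : ℝ × (ℝ × ℝ) => ((F p * G (p.1, p.2.1) : ℝ) : ℂ) * (mode T n p.2.1 * Ψ (p.1, p.2.2))) ?_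
    have e1 : StronglyMeasurable fun p : ℝ × (ℝ × ℝ) => F p * G (p.1, p.2.1) :=
      hF.mul (hG.comp_measurable (by fun_prop))
    have e2 : StronglyMeasurable fun p : ℝ × (ℝ × ℝ) => mode T n p.2.1 :=
      ((continuous_mode T n).comp (by fun_prop)).stronglyMeasurable
    exact (Complex.continuous_ofReal.comp_stronglyMeasurable e1).mul (e2.mul (hΨ.comp_measurable (by fun_prop)))
  · filter_upwards [hFG] with u hu
    refine integral_congr_ae ?_
    have hx : ∀ᵐ z ∂(cell T), z.1 ∈ Ioc 0 T :=
      Measure.quasiMeasurePreserving_fst.ae (ae_restrict_mem measurableSet_Ioc)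
    filter_upwards [hu.1, hx] with z hz hzx
    rw [hz, hu.2 _ hzx]

end IsSolution

theorem hasDerivAt_mul_wave {χ : ℝ → ℂ} (hχ : ContDiff ℝ ∞ χ) (q v : ℝ) :
    HasDerivAt (fun v => χ v * wave q v) ((deriv χ v - 2 * Real.pi * q * Complex.I * χ v) * wave q v) v := by
  have h1 := ((hχ.differentiable (by simp)) v).hasDerivAt
  convert! h1.mul (hasDerivAt_wave q v) using 1
  ring

namespace IsSolution

variable {T : ℝ} {I : Set ℝ} {f : ℝ → ℝ × ℝ → ℝ} {E : ℝ → ℝ → ℝ}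

theorem intervalIntegrable_modePair_field (h : IsSolution T I f E) (hT : 0 < T) (hI : I.OrdConnected)
    (n : ℤ) {Ψ : ℝ × ℝ → ℂ} (hΨ : StronglyMeasurable Ψ) {C : ℝ} {t₀ t : ℝ} (h₀ : t₀ ∈ I) (ht : t ∈ I)
    (h₀t : t₀ ≤ t) (hC : ∀ u ∈ Icc t₀ t, ∀ v, ‖Ψ (u, v)‖ ≤ C) :
    IntervalIntegrable (fun u => modePair T n (fun z => f u z * E u z.1) (fun v => Ψ (u, v))) volume t₀ t := by
  have hsub : Ioc t₀ t ⊆ I := fun u hu => hI.out h₀ ht (Ioc_subset_Icc_self hu)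
  rw [intervalIntegrable_iff_integrableOn_Ioc_of_le h₀t]
  have hm := (h.aestronglyMeasurable_modePair_field hT hI.measurableSet n hΨ).mono_set hsub
  refine Integrable.of_bound (C := C * (2 * T ^ 2)) hm ?_
  refine (ae_restrict_iff' measurableSet_Ioc).2 (ae_of_all _ fun u hu => ?_)
  exact h.norm_modePair_field_le hT (hsub hu) (hC u (Ioc_subset_Icc_self hu))

/-- Duhamel's formula along the free flow, for a velocity cutoff `χ`. -/
theorem duhamel_cutoff (h : IsSolution T I f E) (hT : 0 < T) (hI : I.OrdConnected) (n : ℤ) (ξ : ℝ)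
    {χ : ℝ → ℂ} (hχ : ContDiff ℝ ∞ χ) (hχc : HasCompactSupport χ) (hχ1 : ∀ v, ‖χ v‖ ≤ 1)
    {t₀ t : ℝ} (h₀ : t₀ ∈ I) (ht : t ∈ I) (h₀t : t₀ ≤ t) :
    modePair T n (f t) (fun v => χ v * wave ξ v) -
        modePair T n (f t₀) (fun v => χ v * wave (ξ + n / T * (t - t₀)) v) =
      -∫ u in t₀..t, modePair T n (fun z => f u z * E u z.1) (fun v =>
        (deriv χ v - 2 * Real.pi * (ξ + n / T * (t - u) : ℝ) * Complex.I * χ v) *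
          wave (ξ + n / T * (t - u)) v) := by
  set k : ℝ := n / T
  set p : ℝ → ℝ := fun u => ξ + k * (t - u)
  set D : ℝ → ℝ → ℂ := fun q v => (deriv χ v - 2 * Real.pi * q * Complex.I * χ v) * wave q v
  set H : ℝ → ℂ := fun u => modePair T n (fun z => f u z * E u z.1) (D (p u))
  have hmem : ∀ u, t₀ ≤ u → u ≤ t → u ∈ I := fun u h1 h2 => hI.out h₀ ht ⟨h1, h2⟩
  have hχ'cont : Continuous (deriv χ) := hχ.continuous_deriv (by simp)
  obtain ⟨C₁, hC₁⟩ := hχc.deriv.exists_bound_of_continuous hχ'cont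
  have hC₁0 : 0 ≤ C₁ := (norm_nonneg _).trans (hC₁ 0)
  obtain ⟨R, hR0, hR⟩ : ∃ R : ℝ, 0 ≤ R ∧ ∀ v, v ∈ tsupport χ → |v| ≤ R := by
    obtain ⟨R, hR⟩ := hχc.isBounded.subset_closedBall 0
    exact ⟨max R 0, le_max_right _ _, fun v hv => le_max_of_le_left (by simpa using hR hv)⟩
  have hχ0 : ∀ v, R < |v| → χ v = 0 := fun v hv => by
    by_contra hne
    exact absurd (hR v (subset_tsupport χ hne)) (not_le.2 hv)
  have hχ'0 : ∀ v, R < |v| → deriv χ v = 0 := fun v hv => by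
    by_contra hne
    exact absurd (hR v (support_deriv_subset hne)) (not_le.2 hv)
  set Q : ℝ := |ξ| + |k| * (t - t₀)
  have hQ0 : 0 ≤ Q := by have := sub_nonneg.2 h₀t; positivity
  have hpQ : ∀ u, t₀ ≤ u → u ≤ t → |p u| ≤ Q := by
    intro u h1 h2
    refine (abs_add_le _ _).trans ?_
    rw [abs_mul, abs_of_nonneg (sub_nonneg.2 h2)]
    have : t - u ≤ t - t₀ := by linarith
    simp only [Q]; gcongr
  have hpi := Real.pi_pos
  have hD1 : ∀ q v, |q| ≤ Q → ‖deriv χ v - 2 * Real.pi * q * Complex.I * χ v‖ ≤ C₁ + 2 * Real.pi * Q := by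
    intro q v hq
    refine (norm_sub_le _ _).trans (add_le_add (hC₁ v) ?_)
    rw [norm_mul, norm_mul, norm_mul, norm_mul, Complex.norm_I, Complex.norm_real, Complex.norm_real,
      Complex.norm_ofNat, mul_one, Real.norm_eq_abs, Real.norm_eq_abs, abs_of_pos hpi]
    calc 2 * Real.pi * |q| * ‖χ v‖ ≤ 2 * Real.pi * Q * 1 := by gcongr; exact hχ1 v
      _ = _ := mul_one _
  have hDn : ∀ q v, |q| ≤ Q → ‖D q v‖ ≤ C₁ + 2 * Real.pi * Q := by
    intro q v hq
    simp only [D]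
    rw [norm_mul, norm_wave, mul_one]; exact hD1 q v hq
  have hDlip : ∀ q q' v, |q| ≤ Q → ‖D q v - D q' v‖ ≤
      ((C₁ + 2 * Real.pi * Q) * (2 * Real.pi * R) + 2 * Real.pi) * |q - q'| := by
    intro q q' v hq
    rcases lt_or_ge R |v| with hv | hv
    · simp only [D, hχ0 v hv, hχ'0 v hv]; simp; positivity
    have e : D q v - D q' v = (deriv χ v - 2 * Real.pi * q * Complex.I * χ v) * (wave q v - wave q' v)
        - 2 * Real.pi * (q - q') * Complex.I * χ v * wave q' v := by simp only [D]; ring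
    rw [e]
    refine (norm_sub_le _ _).trans ?_
    rw [norm_mul]
    have a1 : ‖(2 * Real.pi * (q - q') * Complex.I * χ v * wave q' v : ℂ)‖ ≤ 2 * Real.pi * |q - q'| := by
      rw [norm_mul, norm_mul, norm_mul, norm_mul, norm_mul, norm_wave, Complex.norm_I, Complex.norm_real,
        ← Complex.ofReal_sub, Complex.norm_real, Complex.norm_ofNat, mul_one, mul_one, Real.norm_eq_abs,
        Real.norm_eq_abs, abs_of_pos hpi]
      exact mul_le_of_le_one_right (by positivity) (hχ1 v)
    have a2 : ‖wave q v - wave q' v‖ ≤ 2 * Real.pi * |q - q'| * R :=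
      (norm_wave_sub_le q q' v).trans (by gcongr)
    calc _ ≤ (C₁ + 2 * Real.pi * Q) * (2 * Real.pi * |q - q'| * R) + 2 * Real.pi * |q - q'| := by
          gcongr; exact hD1 q v hq
      _ = _ := by ring
  have hDcont : Continuous fun x : ℝ × ℝ => D x.1 x.2 := by
    have := hχ.continuous
    have := continuous_wave_uncurry
    simp only [D]; fun_prop
  have hDcont' : ∀ q, Continuous (D q) := fun q => hDcont.comp (by fun_prop : Continuous fun v : ℝ => (q, v))
  have hgc : ∀ q, Continuous fun v => χ v * wave q v := fun q => hχ.continuous.mul (continuous_wave q)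
  have hg1 : ∀ q v, ‖χ v * wave q v‖ ≤ 1 := fun q v => by rw [norm_mul, norm_wave, mul_one]; exact hχ1 v
  have hvχ : ∀ v, |v| * ‖χ v‖ ≤ R := by
    intro v
    rcases lt_or_ge R |v| with hv | hv
    · rw [hχ0 v hv]; simpa using hR0
    · exact (mul_le_of_le_one_right (abs_nonneg _) (hχ1 v)).trans hv
  have hg2 : ∀ q v : ℝ, ‖(v : ℂ) * (χ v * wave q v)‖ ≤ R := fun q v => by
    rw [norm_mul, norm_mul, norm_wave, mul_one, Complex.norm_real]; exact hvχ v
  have hg3 : ∀ q v : ℝ, ‖(v : ℂ) * ((v : ℂ) * (χ v * wave q v))‖ ≤ R ^ 2 := fun q v => by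
    rcases lt_or_ge R |v| with hv | hv
    · rw [hχ0 v hv]; simp; positivity
    · rw [norm_mul, pow_two, Complex.norm_real]
      exact mul_le_mul hv (hg2 q v) (norm_nonneg _) hR0
  have hgs : ∀ q, ContDiff ℝ ∞ fun v => χ v * wave q v := fun q => hχ.mul (contDiff_wave q)
  have hgcs : ∀ q, HasCompactSupport fun v => χ v * wave q v := fun q => hχc.mul_right
  have hg's : ∀ q, ContDiff ℝ ∞ fun v : ℝ => (v : ℂ) * (χ v * wave q v) := fun q =>
    Complex.ofRealCLM.contDiff.mul (hgs q)
  have hderiv : ∀ q, deriv (fun v => χ v * wave q v) = D q := fun q =>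
    funext fun v => (hasDerivAt_mul_wave hχ q v).deriv
  have hderiv' : ∀ q v : ℝ, |q| ≤ Q → ‖deriv (fun v : ℝ => (v : ℂ) * (χ v * wave q v)) v‖ ≤
      1 + R * (C₁ + 2 * Real.pi * Q) := by
    intro q v hq
    have h1 : HasDerivAt (fun v : ℝ => (v : ℂ)) 1 v := Complex.ofRealCLM.hasDerivAt
    have h2 : deriv (fun v : ℝ => (v : ℂ) * (χ v * wave q v)) v = 1 * (χ v * wave q v) + v * D q v :=
      (h1.mul (hasDerivAt_mul_wave hχ q v)).deriv
    rw [h2, one_mul]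
    refine (norm_add_le _ _).trans (add_le_add (hg1 q v) ?_)
    rcases lt_or_ge R |v| with hv | hv
    · simp only [D, hχ0 v hv, hχ'0 v hv]; simp; positivity
    · rw [norm_mul, Complex.norm_real]
      exact mul_le_mul hv (hDn q v hq) (norm_nonneg _) hR0
  set L : ℝ := 2 * Real.pi * |k| * (R ^ 2 * T) + (1 + R * (C₁ + 2 * Real.pi * Q)) * (2 * T ^ 2)
  have hL0 : 0 ≤ L := by positivity
  have hcoef : ‖(-(2 * Real.pi * n / T * Complex.I) : ℂ)‖ = 2 * Real.pi * |k| := by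
    rw [show (-(2 * Real.pi * n / T * Complex.I) : ℂ) = -(((2 * Real.pi * k : ℝ) : ℂ) * Complex.I) by
      simp only [k]; push_cast; ring, norm_neg, norm_mul, Complex.norm_I, Complex.norm_real, mul_one,
      Real.norm_eq_abs, abs_mul, abs_of_pos (by positivity : 0 < 2 * Real.pi)]
  -- The cutoff bounds the test function `v² χ` and the derivative of `v χ · wave`, so the Vlasov
  -- equation itself shows that the transport term is Lipschitz in time.
  have hlip : ∀ q, |q| ≤ Q → ∀ a u, t₀ ≤ a → a ≤ u → u ≤ t →
      ‖modePair T n (f u) (fun v => v * (χ v * wave q v)) - modePair T n (f a) (fun v => v * (χ v * wave q v))‖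
        ≤ L * (u - a) := by
    intro q hq a u h1 h2 h3
    rw [(h.vlasov_mode hT hI n (hg's q) ((hgcs q).mul_left (f := fun v : ℝ => (v : ℂ))) (hmem a h1 (h2.trans h3)) (hmem u (h1.trans h2) h3) h2).2,
      ← abs_of_nonneg (sub_nonneg.2 h2)]
    refine intervalIntegral.norm_integral_le_of_norm_le_const fun w hw => ?_
    rw [uIoc_of_le h2] at hw
    have hwI := hmem w (h1.trans hw.1.le) (hw.2.trans h3)
    refine (norm_sub_le _ _).trans (add_le_add ?_ ?_)
    · rw [norm_mul, hcoef]
      gcongr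
      exact h.norm_modePair_le hT hwI (hg3 q)
    · exact h.norm_modePair_field_le hT hwI (fun v => hderiv' q v hq)
  have hHint : IntervalIntegrable H volume t₀ t := by
    refine h.intervalIntegrable_modePair_field hT hI n (Ψ := fun x => D (p x.1) x.2) (C := C₁ + 2 * Real.pi * Q) ?_ h₀ ht h₀t ?_
    · exact (hDcont.comp (by fun_prop : Continuous fun x : ℝ × ℝ => (p x.1, x.2))).stronglyMeasurable
    · exact fun u hu v => hDn _ v (hpQ u hu.1 hu.2)
  -- The pairing at the frequency `p u` carried by the free flow, corrected by the accumulated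
  -- forcing. The formula says `F t = F t₀`, and `K` below bounds the increments of `F` by `K (b -
  -- a)²`.
  set F : ℝ → ℂ := fun u => modePair T n (f u) (fun v => χ v * wave (p u) v) + ∫ w in t₀..u, H w
  set K : ℝ := (2 * Real.pi * |k| * L +
    ((C₁ + 2 * Real.pi * Q) * (2 * Real.pi * R) + 2 * Real.pi) * |k| * (2 * T ^ 2)) + 2 * (2 * Real.pi * k * R) ^ 2 * T
  have hF : F t = F t₀ := by
    refine eq_of_norm_sub_le_sq (K := K) h₀t fun a b h1 h2 h3 => ?_
    have ha := hmem a h1 (h2.trans h3)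
    have hb := hmem b (h1.trans h2) h3
    have hpb := hpQ b (h1.trans h2) h3
    have hpab : p a = p b + k * (b - a) := by simp only [p]; ring
    obtain ⟨hZi, hZ⟩ := h.vlasov_mode hT hI n (hgs (p b)) (hgcs (p b)) ha hb h2
    have hHab : IntervalIntegrable H volume a b := hHint.mono_set (by
      rw [uIcc_of_le h2, uIcc_of_le h₀t]; exact Icc_subset_Icc h1 h3)
    have hHa : IntervalIntegrable H volume t₀ a := hHint.mono_set (by
      rw [uIcc_of_le h1, uIcc_of_le h₀t]; exact Icc_subset_Icc le_rfl (h2.trans h3))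
    set M := modePair T n (f a) (fun v => (v : ℂ) * (χ v * wave (p b) v))
    set c : ℂ := -(2 * Real.pi * n / T * Complex.I) with hc
    have hrem : modePair T n (f a) (fun v => χ v * wave (p b) v) - modePair T n (f a) (fun v => χ v * wave (p a) v)
        + c * (b - a) * M = modePair T n (f a) (fun v => (χ v * wave (p b) v - χ v * wave (p a) v) -
          (-(c * (b - a))) * (v * (χ v * wave (p b) v))) := by
      rw [modePair_sub (g₁ := fun v => χ v * wave (p b) v - χ v * wave (p a) v)
        (g₂ := fun v : ℝ => (-(c * (b - a))) * ((v : ℂ) * (χ v * wave (p b) v)))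
        (C := 2) (C' := ‖-(c * (b - a))‖ * R) (h.integrable a ha) ((hgc _).sub (hgc _)) ?_
        (continuous_const.mul (Complex.continuous_ofReal.mul (hgc _))) ?_,
        modePair_sub (h.integrable a ha) (hgc _) (hg1 _) (hgc _) (hg1 _), modePair_const_mul]
      · ring
      · intro v
        refine (norm_sub_le _ _).trans ?_
        linarith [hg1 (p b) v, hg1 (p a) v]
      · intro v
        rw [norm_mul]; gcongr; exact hg2 _ v
    have hremn : ‖modePair T n (f a) (fun v => χ v * wave (p b) v) - modePair T n (f a) (fun v => χ v * wave (p a) v)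
        + c * (b - a) * M‖ ≤ 2 * (2 * Real.pi * k * R) ^ 2 * (b - a) ^ 2 * T := by
      rw [hrem]
      refine h.norm_modePair_le hT ha fun v => ?_
      have e : χ v * wave (p b) v - χ v * wave (p a) v - (-(c * (b - a))) * (v * (χ v * wave (p b) v)) =
          χ v * (wave (p b) v - wave (p b + k * (b - a)) v - 2 * Real.pi * (k * (b - a) : ℝ) * Complex.I * (v * wave (p b) v)) := by
        rw [hpab, hc]; simp only [k]; push_cast; ring
      rw [e, norm_mul]
      rcases lt_or_ge R |v| with hv | hv
      · rw [hχ0 v hv]; simp; positivity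
      · calc ‖χ v‖ * _ ≤ 1 * (2 * (2 * Real.pi * (k * (b - a)) * v) ^ 2) := by
              gcongr
              · exact hχ1 v
              · exact norm_wave_taylor_le _ _ _
          _ = 2 * (2 * Real.pi * k) ^ 2 * (b - a) ^ 2 * |v| ^ 2 := by rw [sq_abs]; ring
          _ ≤ 2 * (2 * Real.pi * k) ^ 2 * (b - a) ^ 2 * R ^ 2 := by gcongr
          _ = _ := by ring
    -- The frequency is frozen at `p b`. The first-order term `c (b - a) M` is subtracted inside the
    -- time integral, where it cancels the transport term up to the Lipschitz error `hlip`, and is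
    -- added in the bracket, where it is the first Taylor term of the change of frequency. Both
    -- remainders are quadratic in `b - a`.
    have hFab : F b - F a = (∫ u in a..b, ((c * modePair T n (f u) (fun v => v * (χ v * wave (p b) v))
        - modePair T n (fun z => f u z * E u z.1) (deriv fun v => χ v * wave (p b) v)) + H u - c * M)) +
        (modePair T n (f a) (fun v => χ v * wave (p b) v) - modePair T n (f a) (fun v => χ v * wave (p a) v)
        + c * (b - a) * M) := by
      rw [intervalIntegral.integral_sub (hZi.add hHab) intervalIntegrable_const,
        intervalIntegral.integral_add hZi hHab, ← hZ]
      simp only [F]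
      rw [← intervalIntegral.integral_add_adjacent_intervals hHa hHab, intervalIntegral.integral_const,
        Complex.real_smul]
      push_cast; ring
    rw [hFab]
    refine (norm_add_le _ _).trans ?_
    have hI1 : ‖∫ u in a..b, ((c * modePair T n (f u) (fun v => v * (χ v * wave (p b) v))
        - modePair T n (fun z => f u z * E u z.1) (deriv fun v => χ v * wave (p b) v)) + H u - c * M)‖ ≤
        ((2 * Real.pi * |k| * L + ((C₁ + 2 * Real.pi * Q) * (2 * Real.pi * R) + 2 * Real.pi) * |k| * (2 * T ^ 2)) * (b - a))
          * (b - a) := by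
      rw [← abs_of_nonneg (sub_nonneg.2 h2)]
      nth_rewrite 1 [abs_of_nonneg (sub_nonneg.2 h2)]
      refine intervalIntegral.norm_integral_le_of_norm_le_const fun u hu => ?_
      rw [uIoc_of_le h2] at hu
      have huI := hmem u (h1.trans hu.1.le) (hu.2.trans h3)
      have hpu := hpQ u (h1.trans hu.1.le) (hu.2.trans h3)
      have e : (c * modePair T n (f u) (fun v => v * (χ v * wave (p b) v))
        - modePair T n (fun z => f u z * E u z.1) (deriv fun v => χ v * wave (p b) v)) + H u - c * M =
        c * (modePair T n (f u) (fun v => v * (χ v * wave (p b) v)) - M) +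
          modePair T n (fun z => f u z * E u z.1) (fun v => D (p u) v - D (p b) v) := by
        rw [modePair_sub (h.integrable_mul_field hT huI) (hDcont' _) (fun v => hDn _ v hpu) (hDcont' _)
          (fun v => hDn _ v hpb), hderiv]
        simp only [H]; ring
      rw [e]
      refine (norm_add_le _ _).trans ?_
      have n1 : ‖c * (modePair T n (f u) (fun v => v * (χ v * wave (p b) v)) - M)‖ ≤ 2 * Real.pi * |k| * (L * (b - a)) := by
        rw [norm_mul, hcoef]
        gcongr
        exact (hlip (p b) hpb a u h1 hu.1.le (hu.2.trans h3)).trans (by gcongr; exact hu.2)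
      have n2 := h.norm_modePair_field_le (n := n) hT huI (g := fun v => D (p u) v - D (p b) v)
        (C := ((C₁ + 2 * Real.pi * Q) * (2 * Real.pi * R) + 2 * Real.pi) * (|k| * (b - a))) (fun v => by
          refine (hDlip (p u) (p b) v hpu).trans ?_
          gcongr
          have : p u - p b = k * (b - u) := by simp only [p]; ring
          rw [this, abs_mul, abs_of_nonneg (sub_nonneg.2 hu.2)]
          gcongr
          exact hu.1.le)
      calc _ ≤ _ := add_le_add n1 n2
        _ = _ := by ring
    calc _ ≤ _ := add_le_add hI1 hremn
      _ = K * (b - a) ^ 2 := by simp only [K]; ring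
  simp only [F, intervalIntegral.integral_same, add_zero] at hF
  have hpt : p t = ξ := by simp [p]
  rw [hpt] at hF
  rw [← hF]
  simp only [H, D]
  ring

end IsSolution

theorem tendsto_modePair {T : ℝ} {n : ℤ} {φ : ℝ × ℝ → ℝ} {g : ℕ → ℝ → ℂ} {g₀ : ℝ → ℂ} {C : ℝ}
    (hφ : Integrable φ (cell T)) (hg : ∀ j, Continuous (g j)) (hC : ∀ j v, ‖g j v‖ ≤ C)
    (hlim : ∀ v, Tendsto (fun j => g j v) atTop (𝓝 (g₀ v))) :
    Tendsto (fun j => modePair T n φ (g j)) atTop (𝓝 (modePair T n φ g₀)) := by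
  refine tendsto_integral_of_dominated_convergence (fun z => |φ z| * C)
    (fun j => (integrable_modePair hφ (hg j) (hC j)).1) (hφ.abs.mul_const C) (fun j => ae_of_all _ fun z => ?_)
    (ae_of_all _ fun z => ?_)
  · rw [norm_mul, norm_mul, norm_mode, one_mul, Complex.norm_real, Real.norm_eq_abs]
    gcongr
    exact hC _ _
  · exact ((hlim z.2).const_mul _).const_mul _

/-- Smooth velocity cutoffs that exhaust the line, with bounded derivatives. -/
theorem exists_cutoffs : ∃ (χ : ℕ → ℝ → ℂ) (C : ℝ), (∀ j, ContDiff ℝ ∞ (χ j)) ∧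
    (∀ j, HasCompactSupport (χ j)) ∧ (∀ j v, ‖χ j v‖ ≤ 1) ∧ (∀ j v, ‖deriv (χ j) v‖ ≤ C) ∧
    (∀ v, Tendsto (fun j => χ j v) atTop (𝓝 1)) ∧ ∀ v, Tendsto (fun j => deriv (χ j) v) atTop (𝓝 0) := by
  let b : ContDiffBump (0 : ℝ) := ⟨1, 2, one_pos, one_lt_two⟩
  set ψ : ℝ → ℂ := fun v => (b v : ℂ)
  have hψ : ContDiff ℝ ∞ ψ := Complex.ofRealCLM.contDiff.comp b.contDiff
  have hψc : HasCompactSupport ψ := b.hasCompactSupport.comp_left (g := fun y : ℝ => (y : ℂ)) (by simp)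
  obtain ⟨C, hC⟩ := hψc.deriv.exists_bound_of_continuous (hψ.continuous_deriv (by simp))
  set a : ℕ → ℝ := fun j => ((j : ℝ) + 1)⁻¹
  have ha : ∀ j, 0 < a j := fun j => by positivity
  have ha1 : ∀ j, a j ≤ 1 := fun j => inv_le_one_of_one_le₀ (by simp)
  have halim : Tendsto a atTop (𝓝 0) := by
    simpa [a, one_div] using tendsto_one_div_add_atTop_nhds_zero_nat (𝕜 := ℝ)
  have hd : ∀ j v, HasDerivAt (fun v => ψ (a j * v)) (a j * deriv ψ (a j * v)) v := by
    intro j v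
    have h1 := ((hψ.differentiable (by simp)) (a j * v)).hasDerivAt
    have h2 : HasDerivAt (fun v => a j * v) (a j) v := by simpa using (hasDerivAt_id v).const_mul (a j)
    have := h1.scomp v h2
    rwa [Complex.real_smul] at this
  refine ⟨fun j v => ψ (a j * v), C, fun j => hψ.comp (contDiff_const.mul contDiff_id), fun j => ?_, fun j v => ?_,
    fun j v => ?_, fun v => ?_, fun v => ?_⟩
  · exact hψc.comp_homeomorph (Homeomorph.mulLeft₀ (a j) (ha j).ne')
  · simp only [ψ, Complex.norm_real, Real.norm_eq_abs]
    exact abs_le.2 ⟨by linarith [b.nonneg (x := a j * v)], b.le_one⟩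
  · rw [(hd j v).deriv, norm_mul, Complex.norm_real, Real.norm_eq_abs, abs_of_pos (ha j)]
    exact (mul_le_of_le_one_left (norm_nonneg _) (ha1 j)).trans (hC _)
  · have h0 : Tendsto (fun j => a j * v) atTop (𝓝 0) := by simpa using halim.mul_const v
    have := (hψ.continuous.tendsto 0).comp h0
    have e : ψ 0 = 1 := by
      simp only [ψ]
      rw [b.one_of_mem_closedBall (Metric.mem_closedBall_self b.rIn_pos.le)]; simp
    rwa [e] at this
  · have : (fun j => deriv (fun v => ψ (a j * v)) v) = fun j => (a j : ℂ) * deriv ψ (a j * v) :=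
      funext fun j => (hd j v).deriv
    rw [this]
    refine squeeze_zero_norm (a := fun j => a j * C) (fun j => ?_) (by simpa using halim.mul_const C)
    rw [norm_mul, Complex.norm_real, Real.norm_eq_abs, abs_of_pos (ha j)]
    exact mul_le_mul_of_nonneg_left (hC _) (ha j).le

namespace IsSolution

variable {T : ℝ} {I : Set ℝ} {f : ℝ → ℝ × ℝ → ℝ} {E : ℝ → ℝ → ℝ}

/-- Duhamel's formula along the free flow, in Fourier variables. -/
theorem duhamel (h : IsSolution T I f E) (hT : 0 < T) (hI : I.OrdConnected) (n : ℤ) (ξ : ℝ)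
    {t₀ t : ℝ} (h₀ : t₀ ∈ I) (ht : t ∈ I) (h₀t : t₀ ≤ t) :
    modePair T n (f t) (wave ξ) = modePair T n (f t₀) (wave (ξ + n / T * (t - t₀))) +
      ∫ u in t₀..t, 2 * Real.pi * (ξ + n / T * (t - u) : ℝ) * Complex.I *
        modePair T n (fun z => f u z * E u z.1) (wave (ξ + n / T * (t - u))) := by
  obtain ⟨χ, C, hχ, hχc, hχ1, hC, hlim, hlim'⟩ := exists_cutoffs
  have hC0 : 0 ≤ C := (norm_nonneg _).trans (hC 0 0)
  have hmem : ∀ u ∈ uIoc t₀ t, u ∈ I := fun u hu => by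
    rw [uIoc_of_le h₀t] at hu; exact hI.out h₀ ht (Ioc_subset_Icc_self hu)
  set k : ℝ := n / T
  set p : ℝ → ℝ := fun u => ξ + k * (t - u)
  have l1 : ∀ s ∈ I, ∀ q, Tendsto (fun j => modePair T n (f s) (fun v => χ j v * wave q v)) atTop
      (𝓝 (modePair T n (f s) (wave q))) := by
    intro s hs q
    refine tendsto_modePair (C := 1) (h.integrable s hs) (fun j => (hχ j).continuous.mul (continuous_wave q))
      (fun j v => ?_) (fun v => ?_)
    · rw [norm_mul, norm_wave, mul_one]; exact hχ1 j v
    · simpa using (hlim v).mul_const (wave q v)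
  set D : ℕ → ℝ → ℝ → ℂ := fun j q v => (deriv (χ j) v - 2 * Real.pi * q * Complex.I * χ j v) * wave q v
  have hDn : ∀ j q v, ‖D j q v‖ ≤ C + 2 * Real.pi * |q| := by
    intro j q v
    simp only [D]
    rw [norm_mul, norm_wave, mul_one]
    refine (norm_sub_le _ _).trans (add_le_add (hC j v) ?_)
    rw [norm_mul, norm_mul, norm_mul, norm_mul, Complex.norm_I, Complex.norm_real, Complex.norm_real,
      Complex.norm_ofNat, mul_one, Real.norm_eq_abs, Real.norm_eq_abs, abs_of_pos Real.pi_pos]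
    exact mul_le_of_le_one_right (by positivity) (hχ1 j v)
  have hDc : ∀ j, Continuous fun x : ℝ × ℝ => D j x.1 x.2 := by
    intro j
    have := (hχ j).continuous
    have := (hχ j).continuous_deriv (by simp)
    have := continuous_wave_uncurry
    simp only [D]; fun_prop
  -- As the cutoffs exhaust the line, the term with their derivative disappears and only the factor
  -- `-2πi p` from the character remains.
  have l2 : ∀ u ∈ I, Tendsto (fun j => modePair T n (fun z => f u z * E u z.1) (D j (p u))) atTop
      (𝓝 (-(2 * Real.pi * (p u : ℝ) * Complex.I) * modePair T n (fun z => f u z * E u z.1) (wave (p u)))) := by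
    intro u hu
    rw [← modePair_const_mul]
    refine tendsto_modePair (h.integrable_mul_field hT hu)
      (fun j => (hDc j).comp (by fun_prop : Continuous fun v : ℝ => (p u, v))) (fun j v => hDn j _ v) (fun v => ?_)
    have := ((hlim' v).sub ((hlim v).const_mul (2 * Real.pi * (p u : ℝ) * Complex.I : ℂ))).mul_const (wave (p u) v)
    simpa using this
  have hsm : ∀ j, StronglyMeasurable fun x : ℝ × ℝ => D j (p x.1) x.2 := fun j =>
    ((hDc j).comp (by fun_prop : Continuous fun x : ℝ × ℝ => (p x.1, x.2))).stronglyMeasurable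
  set Q : ℝ := |ξ| + |k| * (t - t₀)
  have hpQ : ∀ u ∈ uIoc t₀ t, |p u| ≤ Q := by
    intro u hu
    rw [uIoc_of_le h₀t] at hu
    refine (abs_add_le _ _).trans ?_
    rw [abs_mul, abs_of_nonneg (sub_nonneg.2 hu.2)]
    have : t - u ≤ t - t₀ := by linarith [hu.1]
    simp only [Q]; gcongr
  have l3 : Tendsto (fun j => ∫ u in t₀..t, modePair T n (fun z => f u z * E u z.1) (D j (p u))) atTop
      (𝓝 (∫ u in t₀..t, -(2 * Real.pi * (p u : ℝ) * Complex.I) * modePair T n (fun z => f u z * E u z.1) (wave (p u)))) := by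
    refine intervalIntegral.tendsto_integral_filter_of_dominated_convergence
      (fun _ => (C + 2 * Real.pi * Q) * (2 * T ^ 2)) (Eventually.of_forall fun j => ?_)
      (Eventually.of_forall fun j => ae_of_all _ fun u hu => ?_) intervalIntegrable_const
      (ae_of_all _ fun u hu => l2 u (hmem u hu))
    · exact (h.aestronglyMeasurable_modePair_field hT hI.measurableSet n (hsm j)).mono_set hmem
    · refine h.norm_modePair_field_le hT (hmem u hu) fun v => (hDn j _ v).trans ?_
      have := hpQ u hu
      gcongr
  have e := fun j => h.duhamel_cutoff hT hI n ξ (hχ j) (hχc j) (hχ1 j) h₀ ht h₀t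
  have := tendsto_nhds_unique (((l1 t ht ξ).sub (l1 t₀ h₀ (p t₀))).congr e) l3.neg
  rw [← intervalIntegral.integral_neg] at this
  rw [← sub_eq_iff_eq_add', this]
  refine intervalIntegral.integral_congr fun u _ => ?_
  simp only [neg_mul, neg_neg]
  rfl

end IsSolution

/-! ### Bessel's inequality and `L²` bounds in time for Duhamel's formula -/

theorem fourier_eq_integral_wave (g : ℝ → ℂ) (q : ℝ) : 𝓕 g q = ∫ v, g v * wave q v := by
  rw [Real.fourier_real_eq_integral_exp_smul]
  refine integral_congr_ae (ae_of_all _ fun v => ?_)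
  simp only [wave, smul_eq_mul, mul_comm (g v)]

theorem modePair_wave_eq {T : ℝ} {n : ℤ} {φ : ℝ × ℝ → ℝ} (hφ : Integrable φ (cell T)) (q : ℝ) :
    modePair T n φ (wave q) = ∫ x in Ioc 0 T, mode T n x * 𝓕 (fun v => (φ (x, v) : ℂ)) q := by
  rw [modePair, cell, integral_prod]
  · refine integral_congr_ae (ae_of_all _ fun x => ?_)
    simp only [fourier_eq_integral_wave]
    rw [← integral_const_mul]
    refine integral_congr_ae (ae_of_all _ fun v => ?_)
    simp only; ring
  · exact integrable_modePair hφ (continuous_wave q) (fun v => (norm_wave q v).le)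

theorem measurable_modePair_wave {T : ℝ} {n : ℤ} {φ : ℝ × ℝ → ℝ} (hφ : Integrable φ (cell T)) :
    StronglyMeasurable fun q => modePair T n φ (wave q) := by
  set ψ := hφ.1.mk φ
  have hψ : StronglyMeasurable ψ := hφ.1.stronglyMeasurable_mk
  have e : (fun q => modePair T n φ (wave q)) = fun q : ℝ =>
      ∫ z, (ψ z : ℂ) * (mode T n z.1 * wave q z.2) ∂(cell T) := by
    ext q
    refine integral_congr_ae ?_
    filter_upwards [hφ.1.ae_eq_mk] with z hz
    rw [hz]
  rw [e]
  refine StronglyMeasurable.integral_prod_right' (ν := cell T)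
    (f := fun p : ℝ × (ℝ × ℝ) => (ψ p.2 : ℂ) * (mode T n p.2.1 * wave p.1 p.2.2)) ?_
  refine (Complex.continuous_ofReal.comp_stronglyMeasurable
    (hψ.comp_measurable measurable_snd)).mul (Continuous.stronglyMeasurable ?_)
  exact ((continuous_mode T n).comp (continuous_fst.comp continuous_snd)).mul
    (continuous_wave_uncurry.comp (continuous_fst.prodMk (continuous_snd.comp continuous_snd)))

/-- Bessel's inequality in `x` for a phase space function with velocity sections in `H^s`. -/
theorem tsum_lintegral_modePair_sq_le {T : ℝ} (hT : 0 < T) (s : ℝ) {φ : ℝ × ℝ → ℝ}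
    (hφ : Integrable φ (cell T)) :
    ∑' n : ℤ, ∫⁻ q, ENNReal.ofReal (weight s q) * ‖modePair T n φ (wave q)‖ₑ ^ 2
      ≤ ENNReal.ofReal T * ∫⁻ x in Ioc 0 T, sobolevSq s fun v => φ (x, v) := by
  set ψ := hφ.1.mk φ
  have hψ : StronglyMeasurable ψ := hφ.1.stronglyMeasurable_mk
  have hx : ∀ᵐ x ∂(volume.restrict (Ioc 0 T)), ∀ q, 𝓕 (fun v => (φ (x, v) : ℂ)) q =
      𝓕 (fun v => (ψ (x, v) : ℂ)) q := by
    filter_upwards [Measure.ae_ae_of_ae_prod hφ.1.ae_eq_mk] with x hx q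
    rw [fourier_eq_integral_wave, fourier_eq_integral_wave]
    refine integral_congr_ae ?_
    filter_upwards [hx] with v hv
    rw [hv]
  set Θ : ℝ × ℝ → ℂ := fun p => 𝓕 (fun v => (ψ (p.1, v) : ℂ)) p.2
  have hΘ : StronglyMeasurable Θ := by
    simp only [Θ, fourier_eq_integral_wave]
    refine StronglyMeasurable.integral_prod_right'
      (f := fun p : (ℝ × ℝ) × ℝ => (ψ (p.1.1, p.2) : ℂ) * wave p.1.2 p.2) ?_
    exact (Complex.continuous_ofReal.comp_stronglyMeasurable (hψ.comp_measurable (by fun_prop))).mul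
      (continuous_wave_uncurry.comp
        (by fun_prop : Continuous fun p : (ℝ × ℝ) × ℝ => (p.1.2, p.2))).stronglyMeasurable
  have hw : Measurable fun q => ENNReal.ofReal (weight s q) :=
    (continuous_weight s).measurable.ennreal_ofReal
  have hpt : ∀ q, ∑' n : ℤ, ‖modePair T n φ (wave q)‖ₑ ^ 2 ≤
      ENNReal.ofReal T * ∫⁻ x in Ioc 0 T, ‖Θ (x, q)‖ₑ ^ 2 := by
    intro q
    have e : ∀ n, modePair T n φ (wave q) = ∫ x in Ioc 0 T, mode T n x * Θ (x, q) := by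
      intro n
      rw [modePair_wave_eq hφ]
      refine integral_congr_ae ?_
      filter_upwards [hx] with x hx
      simp only [hx, Θ]
    simp_rw [e]
    exact tsum_enorm_sq_mode_le hT (hΘ.comp_measurable (by fun_prop)).aestronglyMeasurable
  have hΘ2 : Measurable fun p : ℝ × ℝ => ‖Θ p‖ₑ ^ 2 := hΘ.enorm.pow_const 2
  calc ∑' n : ℤ, ∫⁻ q, ENNReal.ofReal (weight s q) * ‖modePair T n φ (wave q)‖ₑ ^ 2
      = ∫⁻ q, ENNReal.ofReal (weight s q) * ∑' n : ℤ, ‖modePair T n φ (wave q)‖ₑ ^ 2 := by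
        rw [← lintegral_tsum]
        · simp_rw [ENNReal.tsum_mul_left]
        · exact fun n => (hw.mul ((measurable_modePair_wave hφ).enorm.pow_const 2)).aemeasurable
    _ ≤ ∫⁻ q, ENNReal.ofReal T * ∫⁻ x in Ioc 0 T, ENNReal.ofReal (weight s q) * ‖Θ (x, q)‖ₑ ^ 2 := by
        refine lintegral_mono fun q => ?_
        rw [lintegral_const_mul' _ _ ENNReal.ofReal_ne_top]
        refine (mul_le_mul_right (hpt q) _).trans (le_of_eq ?_)
        ring
    _ = ENNReal.ofReal T * ∫⁻ x in Ioc 0 T, ∫⁻ q, ENNReal.ofReal (weight s q) * ‖Θ (x, q)‖ₑ ^ 2 := by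
        rw [lintegral_const_mul' _ _ ENNReal.ofReal_ne_top, lintegral_lintegral_swap]
        exact ((hw.comp measurable_fst).mul (hΘ2.comp measurable_swap)).aemeasurable
    _ = _ := by
        congr 1
        refine lintegral_congr_ae ?_
        filter_upwards [hx] with x hx
        simp only [sobolevSq, hx, Θ]

theorem lintegral_comp_affine {f : ℝ → ℝ≥0∞} (hf : Measurable f) {c : ℝ} (hc : c ≠ 0) (q t : ℝ) :
    ∫⁻ u, f (q + c * (t - u)) = ENNReal.ofReal |c⁻¹| * ∫⁻ u, f u := by
  rw [lintegral_sub_left_eq_self (fun u => f (q + c * u)) t]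
  have hg : Measurable fun u => f (q + u) := hf.comp (by fun_prop)
  rw [← lintegral_map hg (measurable_const_mul c), Real.map_volume_mul_left hc, lintegral_smul_measure,
    lintegral_add_left_eq_self f q]
  rfl

theorem lintegral_comp_affine' {f : ℝ → ℝ≥0∞} (hf : Measurable f) {c : ℝ} (hc : c ≠ 0) (q t₀ : ℝ) :
    ∫⁻ t, f (q + c * (t - t₀)) = ENNReal.ofReal |c⁻¹| * ∫⁻ u, f u := by
  have := lintegral_comp_affine hf (neg_ne_zero.2 hc) q t₀
  rw [inv_neg, abs_neg] at this
  rw [← this]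
  refine lintegral_congr fun t => ?_
  congr 1; ring

theorem abs_inv_intCast_div_le {T : ℝ} (hT : 0 < T) {n : ℤ} (hn : n ≠ 0) : |((n : ℝ) / T)⁻¹| ≤ T := by
  rw [inv_div, abs_div, abs_of_pos hT]
  refine div_le_self hT.le ?_
  exact_mod_cast Int.one_le_abs hn

/-- The `L²` in time bound for the forcing term in Duhamel's formula for a mode. -/
theorem lintegral_duhamel_sq_le {T s : ℝ} (hT : 0 < T) {n : ℤ} (hn : n ≠ 0)
    {b : ℝ × ℝ → ℂ} (hb : StronglyMeasurable b) (q τ : ℝ) :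
    ∫⁻ t in Ioc 0 τ, ‖∫ u in (0 : ℝ)..t, 2 * Real.pi * (q + n / T * (t - u) : ℝ) * Complex.I *
        b (u, q + n / T * (t - u))‖ₑ ^ 2 ≤
      ENNReal.ofReal (T ^ 2) * (∫⁻ p, ENNReal.ofReal (weight (1 - s) p)) *
        ∫⁻ u in Ioc 0 τ, ∫⁻ p, ENNReal.ofReal (weight s p) * ‖b (u, p)‖ₑ ^ 2 := by
  have hc : (n / T : ℝ) ≠ 0 := div_ne_zero (by exact_mod_cast hn) hT.ne'
  have hw : ∀ r, Measurable fun q => ENNReal.ofReal (weight r q) := fun r =>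
    (continuous_weight r).measurable.ennreal_ofReal
  have hb2 : Measurable fun p : ℝ × ℝ => ‖b p‖ₑ := hb.enorm
  set W := ∫⁻ p, ENNReal.ofReal (weight (1 - s) p)
  set Q : ℝ → ℝ → ℝ := fun t u => q + n / T * (t - u)
  have hQ : Measurable (Function.uncurry Q) := by
    simp only [Q, Function.uncurry_def]; fun_prop
  -- Both `u ↦ q + n(t - u)/T` and `t ↦ q + n(t - u)/T` have Jacobian `T/|n|` when the frequency
  -- becomes the variable; each substitution is used once, which accounts for the factor `T²`.
  have hTinv : ENNReal.ofReal |((n : ℝ) / T)⁻¹| ≤ ENNReal.ofReal T :=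
    ENNReal.ofReal_le_ofReal (abs_inv_intCast_div_le hT hn)
  have hH : Measurable fun p : ℝ × ℝ => ENNReal.ofReal (weight s (Q p.1 p.2)) * ‖b (p.2, Q p.1 p.2)‖ₑ ^ 2 :=
    ((hw s).comp hQ).mul ((hb2.comp (measurable_snd.prodMk hQ)).pow_const 2)
  -- The factor `|2πp|` from the velocity derivative costs half a power of the weight `1 + (2πp)²`.
  -- The factor with exponent `(1 - s)/2` is square integrable exactly when `s > 3/2`, and the one
  -- with exponent `s/2` goes to the forcing.
  have hsplit : ∀ p, ENNReal.ofReal |2 * Real.pi * p| ≤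
      ENNReal.ofReal (weight ((1 - s) / 2) p) * ENNReal.ofReal (weight (s / 2) p) := by
    intro p
    rw [← ENNReal.ofReal_mul (weight_pos _ _).le, ← weight_add]
    refine ENNReal.ofReal_le_ofReal ?_
    have := abs_rpow_le_weight (a := 1) zero_le_one p
    rw [Real.rpow_one] at this
    refine this.trans (le_of_eq ?_)
    congr 1; ring
  have hsq : ∀ r p, ENNReal.ofReal (weight (r / 2) p) ^ 2 = ENNReal.ofReal (weight r p) := by
    intro r p
    rw [pow_two, ← ENNReal.ofReal_mul (weight_pos _ _).le, ← weight_add]; congr 2; ring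
  have h1 : ∀ t ∈ Ioc 0 τ, ‖∫ u in (0 : ℝ)..t, 2 * Real.pi * (q + n / T * (t - u) : ℝ) * Complex.I *
        b (u, q + n / T * (t - u))‖ₑ ^ 2 ≤
      ENNReal.ofReal T * W * ∫⁻ u in Ioc 0 τ, ENNReal.ofReal (weight s (Q t u)) * ‖b (u, Q t u)‖ₑ ^ 2 := by
    intro t ht
    have hQt : Measurable (Q t) := hQ.comp (measurable_const.prodMk measurable_id)
    have hbt : Measurable fun u => ‖b (u, Q t u)‖ₑ := hb2.comp (measurable_id.prodMk hQt)
    rw [intervalIntegral.integral_of_le ht.1.le]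
    calc _ ≤ (∫⁻ u in Ioc 0 t, ENNReal.ofReal (weight ((1 - s) / 2) (Q t u)) *
          (ENNReal.ofReal (weight (s / 2) (Q t u)) * ‖b (u, Q t u)‖ₑ)) ^ 2 := by
          refine pow_le_pow_left' ((enorm_integral_le_lintegral_enorm _).trans (lintegral_mono fun u => ?_)) 2
          rw [enorm_mul, ← mul_assoc]
          refine mul_le_mul_left ?_ _
          refine le_trans (le_of_eq ?_) (hsplit (Q t u))
          rw [← ofReal_norm]
          congr 1
          simp only [norm_mul, Complex.norm_I, Complex.norm_real, Complex.norm_ofNat, Real.norm_eq_abs, mul_one,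
            abs_mul, abs_two]; rfl
      _ ≤ (∫⁻ u in Ioc 0 t, ENNReal.ofReal (weight ((1 - s) / 2) (Q t u)) ^ 2) *
          ∫⁻ u in Ioc 0 t, (ENNReal.ofReal (weight (s / 2) (Q t u)) * ‖b (u, Q t u)‖ₑ) ^ 2 :=
          lintegral_mul_sq_le ((hw _).comp hQt).aemeasurable (((hw _).comp hQt).mul hbt).aemeasurable
      _ ≤ (ENNReal.ofReal T * W) *
          ∫⁻ u in Ioc 0 τ, ENNReal.ofReal (weight s (Q t u)) * ‖b (u, Q t u)‖ₑ ^ 2 := by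
          refine mul_le_mul' ?_ ?_
          · refine (setLIntegral_le_lintegral _ _).trans ?_
            simp_rw [hsq]
            rw [lintegral_comp_affine (hw _) hc]
            exact mul_le_mul_left hTinv _
          · simp_rw [mul_pow, hsq]
            exact lintegral_mono_set (Ioc_subset_Ioc_right ht.2)
  calc _ ≤ ∫⁻ t in Ioc 0 τ, ENNReal.ofReal T * W *
        ∫⁻ u in Ioc 0 τ, ENNReal.ofReal (weight s (Q t u)) * ‖b (u, Q t u)‖ₑ ^ 2 :=
        setLIntegral_mono' measurableSet_Ioc h1
    _ = ENNReal.ofReal T * W * ∫⁻ t in Ioc 0 τ, ∫⁻ u in Ioc 0 τ,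
          ENNReal.ofReal (weight s (Q t u)) * ‖b (u, Q t u)‖ₑ ^ 2 :=
        lintegral_const_mul _ hH.lintegral_prod_right'
    _ = ENNReal.ofReal T * W * ∫⁻ u in Ioc 0 τ, ∫⁻ t in Ioc 0 τ,
          ENNReal.ofReal (weight s (Q t u)) * ‖b (u, Q t u)‖ₑ ^ 2 := by
        rw [lintegral_lintegral_swap]
        exact hH.aemeasurable
    _ ≤ ENNReal.ofReal T * W * ∫⁻ u in Ioc 0 τ,
          ENNReal.ofReal T * ∫⁻ p, ENNReal.ofReal (weight s p) * ‖b (u, p)‖ₑ ^ 2 := by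
        refine mul_le_mul_right (lintegral_mono fun u => ?_) _
        refine (setLIntegral_le_lintegral _ _).trans ?_
        have hm : Measurable fun p => ENNReal.ofReal (weight s p) * ‖b (u, p)‖ₑ ^ 2 :=
          (hw s).mul ((hb2.comp (measurable_const.prodMk measurable_id)).pow_const 2)
        have := lintegral_comp_affine' hm hc q u
        refine (le_of_eq this).trans (mul_le_mul_left hTinv _)
    _ = _ := by
        rw [lintegral_const_mul' _ _ ENNReal.ofReal_ne_top, pow_two, ENNReal.ofReal_mul hT.le]
        ring

theorem enorm_add_sq_le {E : Type*} [SeminormedAddCommGroup E] (a b : E) :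
    ‖a + b‖ₑ ^ 2 ≤ 2 * (‖a‖ₑ ^ 2 + ‖b‖ₑ ^ 2) := by
  have h : ‖a + b‖ ^ 2 ≤ 2 * (‖a‖ ^ 2 + ‖b‖ ^ 2) :=
    (pow_le_pow_left₀ (norm_nonneg _) (norm_add_le a b) 2).trans (add_sq_le)
  have h2 := ENNReal.ofReal_le_ofReal h
  rwa [ENNReal.ofReal_mul zero_le_two, ENNReal.ofReal_add (by positivity) (by positivity),
    ENNReal.ofReal_pow (norm_nonneg _), ENNReal.ofReal_pow (norm_nonneg _), ENNReal.ofReal_pow (norm_nonneg _),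
    ofReal_norm, ofReal_norm, ofReal_norm, ENNReal.ofReal_ofNat] at h2

theorem measurable_fourier {g : ℝ → ℂ} (hg : Integrable g) : Measurable (𝓕 g) :=
  (continuous_fourier hg).measurable

theorem sobolevSq_add_le (s : ℝ) {g₁ g₂ : ℝ → ℝ} (h₁ : Integrable g₁) (h₂ : Integrable g₂) :
    sobolevSq s (fun v => g₁ v + g₂ v) ≤ 2 * (sobolevSq s g₁ + sobolevSq s g₂) := by
  have h₁' : Integrable fun v => (g₁ v : ℂ) := h₁.ofReal
  have h₂' : Integrable fun v => (g₂ v : ℂ) := h₂.ofReal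
  have hw : Measurable fun q => ENNReal.ofReal (weight s q) :=
    (continuous_weight s).measurable.ennreal_ofReal
  unfold sobolevSq
  have hm : Measurable fun ξ => ENNReal.ofReal (weight s ξ) * ‖𝓕 (fun v => (g₁ v : ℂ)) ξ‖ₑ ^ 2 :=
    hw.mul ((measurable_fourier h₁').enorm.pow_const 2)
  rw [← lintegral_add_left hm, ← lintegral_const_mul' _ _ (by norm_num)]
  refine lintegral_mono fun ξ => ?_
  have e : 𝓕 (fun v => ((g₁ v + g₂ v : ℝ) : ℂ)) ξ = 𝓕 (fun v => (g₁ v : ℂ)) ξ + 𝓕 (fun v => (g₂ v : ℂ)) ξ := by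
    simp only [fourier_eq_integral_wave, Complex.ofReal_add, add_mul]
    refine integral_add ?_ ?_
    · exact h₁'.mul_bdd (c := 1) (continuous_wave ξ).aestronglyMeasurable (ae_of_all _ fun v => (norm_wave ξ v).le)
    · exact h₂'.mul_bdd (c := 1) (continuous_wave ξ).aestronglyMeasurable (ae_of_all _ fun v => (norm_wave ξ v).le)
  rw [e]
  refine (mul_le_mul_right (enorm_add_sq_le _ _) _).trans (le_of_eq ?_)
  ring

theorem sobolevSq_mul_const (s : ℝ) (g : ℝ → ℝ) (c : ℝ) :
    sobolevSq s (fun v => g v * c) = ‖c‖ₑ ^ 2 * sobolevSq s g := by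
  unfold sobolevSq
  rw [← lintegral_const_mul' _ _ (by simp)]
  refine lintegral_congr fun ξ => ?_
  have e : 𝓕 (fun v => ((g v * c : ℝ) : ℂ)) ξ = c * 𝓕 (fun v => (g v : ℂ)) ξ := by
    simp only [fourier_eq_integral_wave]
    rw [← integral_const_mul]
    refine integral_congr_ae (ae_of_all _ fun v => ?_)
    push_cast; ring
  rw [e, enorm_mul, mul_pow]
  have : ‖(c : ℂ)‖ₑ = ‖c‖ₑ := by rw [← ofReal_norm, ← ofReal_norm, Complex.norm_real]
  rw [this]; ring

theorem lintegral_sobolevSq_le (s : ℝ) {T : ℝ} {φ : ℝ × ℝ → ℝ} (hφ : Integrable φ (cell T)) :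
    ∫⁻ x in Ioc 0 T, sobolevSq s (fun v => φ (x, v)) ≤ l2HsNorm s T φ ^ 2 := by
  unfold l2HsNorm
  rw [← ENNReal.rpow_natCast, ← ENNReal.rpow_mul]
  simp only [one_div, Nat.cast_ofNat, isUnit_iff_ne_zero, ne_eq, OfNat.ofNat_ne_zero, not_false_eq_true,
    IsUnit.inv_mul_cancel, ENNReal.rpow_one]
  refine lintegral_mono_ae ?_
  filter_upwards [hφ.prod_right_ae] with x hx
  exact sobolevSq_le_hsNorm_sq s hx

/-- The squared maximum over a period. -/
def supSq (T : ℝ) (e : ℝ → ℝ) : ℝ≥0∞ := ⨆ x ∈ Ioc 0 T, ‖e x‖ₑ ^ 2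

theorem integrable_profile {f₀ : ℝ → ℝ} (h : Integrable f₀) (T : ℝ) :
    Integrable (fun z : ℝ × ℝ => f₀ z.2) (cell T) :=
  h.comp_snd _

namespace IsSolution

variable {T s : ℝ} {I : Set ℝ} {f : ℝ → ℝ × ℝ → ℝ} {E : ℝ → ℝ → ℝ} {f₀ : ℝ → ℝ}

/-- Duhamel's formula samples the transform at a frequency moving with time, so joint measurability
in `(u, q)` is needed, with an exceptional set of times independent of `q`. The parameter `c` covers
two uses: `c = 1` subtracts the profile for the density estimate, `c = 0` keeps all of `f`. -/
theorem exists_stronglyMeasurable_modePair_field (h : IsSolution T I f E) (hT : 0 < T) (hI : MeasurableSet I)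
    (hc : Continuous f₀) (c : ℝ) (n : ℤ) :
    ∃ b : ℝ × ℝ → ℂ, StronglyMeasurable b ∧ ∀ᵐ u ∂(volume.restrict I), ∀ q,
      modePair T n (fun z => (f u z - c * f₀ z.2) * E u z.1) (wave q) = b (u, q) := by
  obtain ⟨F, G, hF, hG, hFG⟩ := h.exists_measurable hT hI
  refine ⟨fun p => ∫ z, (((F (p.1, z) - c * f₀ z.2) * G (p.1, z.1) : ℝ) : ℂ) *
    (mode T n z.1 * wave p.2 z.2) ∂(cell T), ?_, ?_⟩
  · refine StronglyMeasurable.integral_prod_right' (ν := cell T)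
      (f := fun p : (ℝ × ℝ) × (ℝ × ℝ) => (((F (p.1.1, p.2) - c * f₀ p.2.2) * G (p.1.1, p.2.1) : ℝ) : ℂ) *
        (mode T n p.2.1 * wave p.1.2 p.2.2)) ?_
    have e0 : StronglyMeasurable fun p : (ℝ × ℝ) × (ℝ × ℝ) => c * f₀ p.2.2 :=
      (continuous_const.mul (hc.comp (by fun_prop))).stronglyMeasurable
    have e1 : StronglyMeasurable fun p : (ℝ × ℝ) × (ℝ × ℝ) => (F (p.1.1, p.2) - c * f₀ p.2.2) * G (p.1.1, p.2.1) :=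
      ((hF.comp_measurable (by fun_prop)).sub e0).mul (hG.comp_measurable (by fun_prop))
    have e2 : StronglyMeasurable fun p : (ℝ × ℝ) × (ℝ × ℝ) => mode T n p.2.1 * wave p.1.2 p.2.2 := by
      refine (((continuous_mode T n).comp ?_).mul
        (continuous_wave_uncurry.comp (f := fun p : (ℝ × ℝ) × (ℝ × ℝ) => (p.1.2, p.2.2)) ?_)).stronglyMeasurable <;> fun_prop
    exact (Complex.continuous_ofReal.comp_stronglyMeasurable e1).mul e2
  · filter_upwards [hFG] with u hu q
    refine integral_congr_ae ?_
    have hx : ∀ᵐ z ∂(cell T), z.1 ∈ Ioc 0 T :=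
      Measure.quasiMeasurePreserving_fst.ae (ae_restrict_mem measurableSet_Ioc)
    filter_upwards [hu.1, hx] with z hz hzx
    rw [hz, hu.2 _ hzx]

theorem integrable_sub_profile (h : IsSolution T I f E) (hf₀ : Integrable f₀) (c : ℝ) {t : ℝ} (ht : t ∈ I) :
    Integrable (fun z => f t z - c * f₀ z.2) (cell T) :=
  (h.integrable t ht).sub ((integrable_profile hf₀ T).const_mul c)

theorem integrable_sub_profile_mul_field (h : IsSolution T I f E) (hT : 0 < T) (hf₀ : Integrable f₀) (c : ℝ)
    {t : ℝ} (ht : t ∈ I) : Integrable (fun z => (f t z - c * f₀ z.2) * E t z.1) (cell T) := by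
  refine (h.integrable_sub_profile hf₀ c ht).mul_bdd (c := 2 * T) ?_ ?_
  · exact ((h.continuous_field hT ht).comp continuous_fst).aestronglyMeasurable
  · exact ae_of_all _ fun z => h.abs_field_le hT ht z.1

theorem supSq_le (h : IsSolution T I f E) (hT : 0 < T) {t : ℝ} (ht : t ∈ I) :
    supSq T (E t) ≤ ENNReal.ofReal (4 * T ^ 2) := by
  refine iSup₂_le fun x _ => ?_
  rw [← ofReal_norm, ← ENNReal.ofReal_pow (norm_nonneg _)]
  refine ENNReal.ofReal_le_ofReal ?_
  have := pow_le_pow_left₀ (norm_nonneg (E t x)) (h.abs_field_le hT ht x) 2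
  refine this.trans (le_of_eq ?_)
  ring

/-- The field does not depend on `v`, so in each velocity section it is a scalar that leaves the
Sobolev norm and is bounded by its maximum; the sum over modes is Bessel's inequality. -/
theorem tsum_lintegral_modePair_field_le (h : IsSolution T I f E) (hT : 0 < T) (hf₀ : Integrable f₀) (c : ℝ)
    {t : ℝ} (ht : t ∈ I) :
    ∑' n : ℤ, ∫⁻ q, ENNReal.ofReal (weight s q) *
        ‖modePair T n (fun z => (f t z - c * f₀ z.2) * E t z.1) (wave q)‖ₑ ^ 2 ≤
      ENNReal.ofReal T * (∫⁻ x in Ioc 0 T, sobolevSq s fun v => f t (x, v) - c * f₀ v) * supSq T (E t) := by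
  refine (tsum_lintegral_modePair_sq_le hT s (h.integrable_sub_profile_mul_field hT hf₀ c ht)).trans ?_
  rw [mul_assoc]
  refine mul_le_mul_right ?_ _
  have hS : supSq T (E t) ≠ ⊤ := ((h.supSq_le hT ht).trans_lt ENNReal.ofReal_lt_top).ne
  calc _ ≤ ∫⁻ x in Ioc 0 T, supSq T (E t) * sobolevSq s fun v => f t (x, v) - c * f₀ v := by
        refine setLIntegral_mono' measurableSet_Ioc fun x hx => ?_
        refine (le_of_eq (sobolevSq_mul_const s (fun v => f t (x, v) - c * f₀ v) (E t x))).trans ?_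
        exact mul_le_mul_left (le_iSup₂ (f := fun x (_ : x ∈ Ioc 0 T) => ‖E t x‖ₑ ^ 2) x hx) _
    _ = _ := by rw [lintegral_const_mul' _ _ hS, mul_comm]

/-- The forcing term in Duhamel's formula is controlled in `L²` by the maximum of the field. -/
theorem tsum_lintegral_forcing_le (h : IsSolution T (Ici 0) f E) (hT : 0 < T) (hf₀ : Integrable f₀)
    (hcf : Continuous f₀) (c : ℝ) {M : ℝ≥0∞} (hM_top : M ≠ ⊤)
    (hM : ∀ t, 0 ≤ t → ∫⁻ x in Ioc 0 T, sobolevSq s (fun v => f t (x, v) - c * f₀ v) ≤ M) (q τ : ℝ) :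
    ∑' n : {n : ℤ // n ≠ 0}, ∫⁻ t in Ioc 0 τ, ‖∫ u in (0 : ℝ)..t,
        2 * Real.pi * (q + (n : ℤ) / T * (t - u) : ℝ) * Complex.I *
        modePair T n (fun z => (f u z - c * f₀ z.2) * E u z.1) (wave (q + (n : ℤ) / T * (t - u)))‖ₑ ^ 2 ≤
      ENNReal.ofReal (T ^ 3) * (∫⁻ p, ENNReal.ofReal (weight (1 - s) p)) * M *
        ∫⁻ u in Ioc 0 τ, supSq T (E u) := by
  choose b hb hbe using fun n => h.exists_stronglyMeasurable_modePair_field hT measurableSet_Ici hcf c n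
  have hw : Measurable fun q => ENNReal.ofReal (weight s q) :=
    (continuous_weight s).measurable.ennreal_ofReal
  have hτ : ∀ᵐ u ∂(volume.restrict (Ioc 0 τ)), u ∈ Ici (0 : ℝ) ∧ ∀ n q,
      modePair T n (fun z => (f u z - c * f₀ z.2) * E u z.1) (wave q) = b n (u, q) := by
    filter_upwards [ae_restrict_of_ae_restrict_of_subset (s := Ioc 0 τ) (fun x hx => hx.1.le) (ae_all_iff.2 hbe),
      ae_restrict_mem measurableSet_Ioc] with u hu hu2 using ⟨hu2.1.le, hu⟩
  set W := ∫⁻ p, ENNReal.ofReal (weight (1 - s) p)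
  calc _ ≤ ∑' n : {n : ℤ // n ≠ 0}, ENNReal.ofReal (T ^ 2) * W *
        ∫⁻ u in Ioc 0 τ, ∫⁻ p, ENNReal.ofReal (weight s p) * ‖b n (u, p)‖ₑ ^ 2 := by
        refine ENNReal.tsum_le_tsum fun n => ?_
        refine le_trans (le_of_eq ?_) (lintegral_duhamel_sq_le hT n.2 (hb n) q τ)
        refine setLIntegral_congr_fun measurableSet_Ioc fun t ht => ?_
        congr 2
        refine intervalIntegral.integral_congr_ae ?_
        have := (ae_restrict_iff' measurableSet_Ici).1 (hbe n)
        filter_upwards [this] with u hu hut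
        rw [uIoc_of_le ht.1.le] at hut
        rw [hu hut.1.le]
    _ ≤ ENNReal.ofReal (T ^ 2) * W *
        ∑' n : ℤ, ∫⁻ u in Ioc 0 τ, ∫⁻ p, ENNReal.ofReal (weight s p) * ‖b n (u, p)‖ₑ ^ 2 := by
        rw [ENNReal.tsum_mul_left]
        exact mul_le_mul_right (ENNReal.tsum_comp_le_tsum_of_injective Subtype.val_injective _) _
    _ = ENNReal.ofReal (T ^ 2) * W *
        ∫⁻ u in Ioc 0 τ, ∑' n : ℤ, ∫⁻ p, ENNReal.ofReal (weight s p) * ‖b n (u, p)‖ₑ ^ 2 := by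
        rw [lintegral_tsum]
        intro n
        exact (((hw.comp measurable_snd).mul ((hb n).enorm.pow_const 2)).lintegral_prod_right'
          (f := fun p : ℝ × ℝ => ENNReal.ofReal (weight s p.2) * ‖b n p‖ₑ ^ 2)).aemeasurable
    _ ≤ ENNReal.ofReal (T ^ 2) * W * ∫⁻ u in Ioc 0 τ, ENNReal.ofReal T * M * supSq T (E u) := by
        refine mul_le_mul_right (lintegral_mono_ae ?_) _
        filter_upwards [hτ] with u hu
        simp only [← hu.2]
        refine (h.tsum_lintegral_modePair_field_le hT hf₀ c hu.1).trans ?_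
        gcongr
        exact hM u hu.1
    _ = _ := by
        rw [lintegral_const_mul' _ _ (ENNReal.mul_ne_top ENNReal.ofReal_ne_top hM_top), pow_succ T 2,
          ENNReal.ofReal_mul (by positivity)]
        ring

end IsSolution

/-- For `n ≠ 0`, integrating in time is integrating in the frequency `q + nt/T`, with Jacobian at
most `T`. Phase mixing thus turns regularity in `v` into square integrability in time. -/
theorem tsum_lintegral_free_streaming_le {T : ℝ} (hT : 0 < T) {s : ℝ} (hs : 0 ≤ s) {φ : ℝ × ℝ → ℝ}
    (hφ : Integrable φ (cell T)) (q : ℝ) :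
    ∑' n : {n : ℤ // n ≠ 0}, ∫⁻ t, ‖modePair T n φ (wave (q + (n : ℤ) / T * (t - 0)))‖ₑ ^ 2 ≤
      ENNReal.ofReal (T ^ 2) * ∫⁻ x in Ioc 0 T, sobolevSq s fun v => φ (x, v) := by
  have h1 : ∀ n : {n : ℤ // n ≠ 0}, ∫⁻ t, ‖modePair T n φ (wave (q + (n : ℤ) / T * (t - 0)))‖ₑ ^ 2 ≤
      ENNReal.ofReal T * ∫⁻ p, ENNReal.ofReal (weight s p) * ‖modePair T n φ (wave p)‖ₑ ^ 2 := by
    intro n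
    have hm : Measurable fun p => ‖modePair T n φ (wave p)‖ₑ ^ 2 :=
      (measurable_modePair_wave hφ).enorm.pow_const 2
    have hc : (((n : ℤ) : ℝ) / T) ≠ 0 := div_ne_zero (by exact_mod_cast n.2) hT.ne'
    refine (le_of_eq (lintegral_comp_affine' hm hc q 0)).trans ?_
    refine mul_le_mul' (ENNReal.ofReal_le_ofReal (abs_inv_intCast_div_le hT n.2)) (lintegral_mono fun p => ?_)
    refine le_mul_of_one_le_left' ?_
    rw [← ENNReal.ofReal_one]
    exact ENNReal.ofReal_le_ofReal (one_le_weight hs p)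
  refine (ENNReal.tsum_le_tsum h1).trans ?_
  rw [ENNReal.tsum_mul_left, pow_two, ENNReal.ofReal_mul hT.le, mul_assoc]
  refine mul_le_mul_right ?_ _
  refine le_trans ?_ (tsum_lintegral_modePair_sq_le hT s hφ)
  exact ENNReal.tsum_comp_le_tsum_of_injective Subtype.val_injective
    (fun n : ℤ => ∫⁻ p, ENNReal.ofReal (weight s p) * ‖modePair T n φ (wave p)‖ₑ ^ 2)

/-! ### The Volterra equation for a density mode -/

/-- The convolution kernel of the linearized equation for the density mode `n`. -/
def modeKernel (T : ℝ) (n : ℤ) (f₀ : ℝ → ℝ) : ℝ → ℂ :=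
  (Ioi 0).indicator fun w : ℝ => -(w : ℂ) * 𝓕 (fun v => (f₀ v : ℂ)) (n / T * w)

theorem fourier_comp_mul_left (D : ℝ → ℂ) {c : ℝ} (hc : 0 < c) (y : ℝ) :
    𝓕 (fun w => D (c * w)) y = ((c⁻¹ : ℝ) : ℂ) * 𝓕 D (y / c) := by
  rw [fourier_eq_integral_wave, fourier_eq_integral_wave]
  have := Measure.integral_comp_mul_left (fun w => D w * wave (y / c) w) c
  rw [abs_of_pos (inv_pos.2 hc), Complex.real_smul] at this
  rw [← this]
  refine integral_congr_ae (ae_of_all _ fun w => ?_)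
  simp only [wave]
  congr 4
  field_simp

theorem fourier_conj (D : ℝ → ℂ) (y : ℝ) :
    𝓕 (fun w => (starRingEnd ℂ) (D w)) y = (starRingEnd ℂ) (𝓕 D (-y)) := by
  rw [fourier_eq_integral_wave, fourier_eq_integral_wave, ← integral_conj]
  refine integral_congr_ae (ae_of_all _ fun w => ?_)
  simp only [map_mul, wave, ← Complex.exp_conj, Complex.conj_I, Complex.conj_ofReal]
  congr 2
  push_cast; ring

theorem modeKernel_of_pos {T : ℝ} (hT : 0 < T) {n : ℤ} (hn : 0 < n) (f₀ : ℝ → ℝ) :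
    modeKernel T n f₀ = fun w => (((n / T)⁻¹ : ℝ) : ℂ) * dispersionKernel f₀ (n / T * w) := by
  have hn' : (0 : ℝ) < n := by exact_mod_cast hn
  have hc : (0 : ℝ) < n / T := div_pos hn' hT
  have hnC : (n : ℂ) ≠ 0 := by exact_mod_cast hn'.ne'
  have hTC : (T : ℂ) ≠ 0 := by exact_mod_cast hT.ne'
  ext w
  simp only [modeKernel, dispersionKernel, indicator, mem_Ioi, mul_pos_iff_of_pos_left hc]
  split_ifs
  · push_cast
    field_simp
  · simp

theorem modeKernel_neg (T : ℝ) (n : ℤ) (f₀ : ℝ → ℝ) :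
    modeKernel T (-n) f₀ = fun w => (starRingEnd ℂ) (modeKernel T n f₀ w) := by
  ext w
  simp only [modeKernel, indicator]
  split_ifs
  · rw [show ((-n : ℤ) : ℝ) / T * w = -(n / T * w) by push_cast; ring, IsRegularProfile.fourier_neg_eq_conj]
    simp
  · simp

theorem modeKernel_of_neg (T : ℝ) (n : ℤ) (f₀ : ℝ → ℝ) {w : ℝ} (hw : w < 0) : modeKernel T n f₀ w = 0 :=
  indicator_of_notMem (by simpa using hw.le) _

namespace IsRegularProfile

variable {s : ℝ} {f₀ : ℝ → ℝ}

theorem integrable_modeKernel (h : IsRegularProfile s f₀) {T : ℝ} (hT : 0 < T) {n : ℤ} (hn : n ≠ 0) :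
    Integrable (modeKernel T n f₀) := by
  have hpos : ∀ n : ℤ, 0 < n → Integrable (modeKernel T n f₀) := by
    intro n hn
    rw [modeKernel_of_pos hT hn]
    exact (h.integrable_dispersionKernel.comp_mul_left' (div_pos (by exact_mod_cast hn) hT).ne').const_mul _
  rcases lt_or_gt_of_ne hn with hn | hn
  · have := modeKernel_neg T (-n) f₀
    rw [neg_neg] at this
    rw [this]
    exact (Complex.conjCLE : ℂ →L[ℝ] ℂ).integrable_comp (hpos (-n) (by omega))
  · exact hpos n hn

/-- For `n > 0` the amplitude and the dilation each contribute a factor `T/n`, so the transform is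
`(T/n)² K̂(yT/n)`; replacing `θ` by `θ/n² ∈ [0, 1]` reduces to the bound for the dispersion kernel.
Negative `n` follow by conjugation. -/
theorem modeKernel_bound {T : ℝ} (hT : 0 < T) {κ : ℝ}
    (hκ : ∀ θ : ℝ, 0 ≤ θ → θ ≤ 1 → ∀ y, κ ≤ ‖1 - (θ * T ^ 2 : ℝ) * 𝓕 (dispersionKernel f₀) y‖)
    {n : ℤ} (hn : n ≠ 0) {θ : ℝ} (hθ : 0 ≤ θ) (hθ1 : θ ≤ 1) (y : ℝ) :
    κ ≤ ‖1 - (θ : ℂ) * 𝓕 (modeKernel T n f₀) y‖ := by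
  have hpos : ∀ n : ℤ, 0 < n → ∀ y, κ ≤ ‖1 - (θ : ℂ) * 𝓕 (modeKernel T n f₀) y‖ := by
    intro n hn y
    have hn' : (1 : ℝ) ≤ n := by exact_mod_cast hn
    have hc : (0 : ℝ) < n / T := div_pos (by linarith) hT
    have e : 𝓕 (modeKernel T n f₀) y = (((n / T)⁻¹ * (n / T)⁻¹ : ℝ) : ℂ) * 𝓕 (dispersionKernel f₀) (y / (n / T)) := by
      rw [modeKernel_of_pos hT hn, Complex.ofReal_mul, mul_assoc, ← fourier_comp_mul_left _ hc,
        fourier_eq_integral_wave, fourier_eq_integral_wave, ← integral_const_mul]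
      simp only [mul_assoc]
    have hθn : θ / n ^ 2 ≤ 1 := (div_le_self hθ (by nlinarith)).trans hθ1
    refine (hκ (θ / n ^ 2) (by positivity) hθn (y / (n / T))).trans (le_of_eq ?_)
    rw [e, ← mul_assoc, ← Complex.ofReal_mul]
    congr 4
    field_simp
  rcases lt_or_gt_of_ne hn with hn | hn
  · have := modeKernel_neg T (-n) f₀
    rw [neg_neg] at this
    rw [this, fourier_conj]
    refine (hpos (-n) (by omega) (-y)).trans (le_of_eq ?_)
    rw [← Complex.norm_conj (1 - _)]
    simp
  · exact hpos n hn y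

end IsRegularProfile

theorem modePair_mul_profile {T : ℝ} {n : ℤ} (f₀ e : ℝ → ℝ) (q : ℝ) :
    modePair T n (fun z => f₀ z.2 * e z.1) (wave q) =
      (∫ x in Ioc 0 T, mode T n x * e x) * 𝓕 (fun v => (f₀ v : ℂ)) q := by
  rw [fourier_eq_integral_wave, modePair, cell, ← integral_prod_mul]
  refine integral_congr_ae (ae_of_all _ fun z => ?_)
  simp only; push_cast; ring

namespace IsSolution

variable {T s : ℝ} {I : Set ℝ} {f : ℝ → ℝ × ℝ → ℝ} {E : ℝ → ℝ → ℝ} {f₀ : ℝ → ℝ}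

theorem aestronglyMeasurable_modePair (h : IsSolution T I f E) (hT : 0 < T) (hI : MeasurableSet I) (n : ℤ) (q : ℝ) :
    AEStronglyMeasurable (fun t => modePair T n (f t) (wave q)) (volume.restrict I) := by
  obtain ⟨F, G, hF, hG, hFG⟩ := h.exists_measurable hT hI
  refine ⟨fun u => ∫ z, (F (u, z) : ℂ) * (mode T n z.1 * wave q z.2) ∂(cell T), ?_, ?_⟩
  · refine StronglyMeasurable.integral_prod_right' (ν := cell T)
      (f := fun p : ℝ × (ℝ × ℝ) => (F p : ℂ) * (mode T n p.2.1 * wave q p.2.2)) ?_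
    have e2 : StronglyMeasurable fun p : ℝ × (ℝ × ℝ) => mode T n p.2.1 * wave q p.2.2 :=
      (((continuous_mode T n).comp (by fun_prop)).mul ((continuous_wave q).comp (by fun_prop))).stronglyMeasurable
    exact (Complex.continuous_ofReal.comp_stronglyMeasurable hF).mul e2
  · filter_upwards [hFG] with u hu
    refine integral_congr_ae ?_
    filter_upwards [hu.1] with z hz
    rw [hz]

/-- The linearization. In the part `f₀ E` the variables separate, and the Poisson equation expresses
the mode of `E` through the mode of the density; the other part is quadratic in the perturbation. -/
theorem modePair_field_eq (h : IsSolution T I f E) (hT : 0 < T) (hf₀ : Integrable f₀) {t : ℝ} (ht : t ∈ I)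
    {n : ℤ} (hn : n ≠ 0) (q : ℝ) :
    modePair T n (fun z => f t z * E t z.1) (wave q) =
      -(T / (2 * Real.pi * n * Complex.I)) * modePair T n (f t) (wave 0) * 𝓕 (fun v => (f₀ v : ℂ)) q +
      modePair T n (fun z => (f t z - 1 * f₀ z.2) * E t z.1) (wave q) := by
  have e : modePair T n (f t) (wave 0) = ∫ x in Ioc 0 T, mode T n x * (∫ v, f t (x, v) : ℝ) := by
    rw [modePair_wave_eq (h.integrable t ht)]
    simp only [fourier_eq_integral_wave, wave_zero, mul_one, integral_complex_ofReal]
  rw [e, ← h.integral_mode_mul_field hT ht hn, ← modePair_mul_profile, modePair, modePair, modePair,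
    ← integral_add]
  · refine integral_congr_ae (ae_of_all _ fun z => ?_)
    simp only; push_cast; ring
  · refine integrable_modePair ?_ (continuous_wave q) fun v => (norm_wave q v).le
    refine (integrable_profile hf₀ T).mul_bdd (c := 2 * T) ?_ ?_
    · exact ((h.continuous_field hT ht).comp continuous_fst).aestronglyMeasurable
    · exact ae_of_all _ fun z => h.abs_field_le hT ht z.1
  · exact integrable_modePair (h.integrable_sub_profile_mul_field hT hf₀ 1 ht) (continuous_wave q)
      fun v => (norm_wave q v).le

end IsSolution

namespace IsSolution

variable {T s : ℝ} {f : ℝ → ℝ × ℝ → ℝ} {E : ℝ → ℝ → ℝ} {f₀ : ℝ → ℝ}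

theorem norm_modePair_wave_le {I : Set ℝ} (h : IsSolution T I f E) (hT : 0 < T) {t : ℝ} (ht : t ∈ I) (n : ℤ) (q : ℝ) :
    ‖modePair T n (f t) (wave q)‖ ≤ T := by
  simpa using h.norm_modePair_le hT ht (n := n) (fun v => (norm_wave q v).le)

theorem intervalIntegrable_forcing {I : Set ℝ} (h : IsSolution T I f E) (hT : 0 < T) (hI : I.OrdConnected)
    (n : ℤ) (ξ : ℝ) {t₀ t : ℝ} (h₀ : t₀ ∈ I) (ht : t ∈ I) (h₀t : t₀ ≤ t) :
    IntervalIntegrable (fun u => 2 * Real.pi * (ξ + n / T * (t - u) : ℝ) * Complex.I *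
      modePair T n (fun z => f u z * E u z.1) (wave (ξ + n / T * (t - u)))) volume t₀ t := by
  have hΨ : Continuous fun p : ℝ × ℝ => 2 * Real.pi * ((ξ + n / T * (t - p.1) : ℝ) : ℂ) * Complex.I *
      wave (ξ + n / T * (t - p.1)) p.2 := by
    have := continuous_wave_uncurry.comp (f := fun p : ℝ × ℝ => (ξ + n / T * (t - p.1), p.2)) (by fun_prop)
    exact Continuous.mul (by fun_prop) this
  have := h.intervalIntegrable_modePair_field hT hI n hΨ.stronglyMeasurable
    (C := 2 * Real.pi * (|ξ| + |n / T| * (t - t₀))) h₀ ht h₀t ?_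
  · refine this.congr (fun u _ => ?_)
    simp only [modePair_const_mul]
  · intro u hu v
    simp only [norm_mul, norm_wave, Complex.norm_I, Complex.norm_real, Complex.norm_ofNat, Real.norm_eq_abs, mul_one,
      abs_of_pos Real.pi_pos]
    refine mul_le_mul_of_nonneg_left ((abs_add_le _ _).trans ?_) (by positivity)
    rw [abs_mul, abs_of_nonneg (sub_nonneg.2 hu.2)]
    gcongr
    exact hu.1

/-- The stability estimate for a density mode: it is controlled in `L²(0, τ)` by the free
streaming of the initial datum and by the nonlinear forcing. -/
theorem lintegral_density_mode_le (h : IsSolution T (Ici 0) f E) (hT : 0 < T) (h₀ : IsRegularProfile s f₀)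
    {κ : ℝ} (hκ0 : 0 < κ)
    (hκ : ∀ θ : ℝ, 0 ≤ θ → θ ≤ 1 → ∀ y, κ ≤ ‖1 - (θ * T ^ 2 : ℝ) * 𝓕 (dispersionKernel f₀) y‖)
    {n : ℤ} (hn : n ≠ 0) (τ : ℝ) :
    ENNReal.ofReal (κ ^ 2) * ∫⁻ t in Ioc 0 τ, ‖modePair T n (f t) (wave 0)‖ₑ ^ 2 ≤
      ∫⁻ t in Ioc 0 τ, ‖modePair T n (f 0) (wave (0 + n / T * (t - 0))) +
        ∫ u in (0 : ℝ)..t, 2 * Real.pi * (0 + n / T * (t - u) : ℝ) * Complex.I *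
          modePair T n (fun z => (f u z - 1 * f₀ z.2) * E u z.1) (wave (0 + n / T * (t - u)))‖ₑ ^ 2 := by
  set A : ℝ → ℂ := fun t => modePair T n (f t) (wave 0)
  set K := modeKernel T n f₀
  -- Truncation provides the integrability required by the Volterra estimate, and costs nothing
  -- because only the residual before `τ` enters there. The interval is open at `τ` since `x` must
  -- vanish from `τ` on.
  set x : ℝ → ℂ := (Ioo 0 τ).indicator A
  have hK : Integrable K := h₀.integrable_modeKernel hT hn
  have hA : AEStronglyMeasurable A (volume.restrict (Ioo 0 τ)) :=
    (h.aestronglyMeasurable_modePair hT measurableSet_Ici n 0).mono_set fun u hu => hu.1.le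
  have hxm : AEStronglyMeasurable x := (aestronglyMeasurable_indicator_iff measurableSet_Ioo).2 hA
  have hxb : ∀ u, ‖x u‖ ≤ T := by
    intro u
    simp only [x, indicator]
    split_ifs with hu
    · exact h.norm_modePair_wave_le hT hu.1.le n 0
    · simpa using hT.le
  have hx2 : MemLp x 2 := by
    refine (memLp_indicator_iff_restrict measurableSet_Ioo).2 ?_
    refine MemLp.of_bound hA T ?_
    filter_upwards [ae_restrict_mem measurableSet_Ioo] with u hu
    exact h.norm_modePair_wave_le hT hu.1.le n 0
  have hx1 : Integrable x := by
    refine (integrable_indicator_iff measurableSet_Ioo).2 ?_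
    refine Integrable.of_bound hA T ?_
    filter_upwards [ae_restrict_mem measurableSet_Ioo] with u hu
    exact h.norm_modePair_wave_le hT hu.1.le n 0
  have key := lintegral_sq_le_of_volterra hK (fun t ht => modeKernel_of_neg T n f₀ ht) hκ0
    (fun θ hθ hθ1 y => IsRegularProfile.modeKernel_bound hT hκ hn hθ hθ1 y) hx2 hx1
    (τ := τ) (fun t ht => indicator_of_notMem (fun h => not_lt.2 ht h.2) _)
  have e1 : ∫⁻ t, ‖x t‖ₑ ^ 2 = ∫⁻ t in Ioc 0 τ, ‖A t‖ₑ ^ 2 := by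
    rw [← restrict_Ioo_eq_restrict_Ioc, ← lintegral_indicator measurableSet_Ioo]
    refine lintegral_congr fun t => ?_
    simp only [x, indicator]
    split_ifs <;> simp
  rw [e1] at key
  refine key.trans ?_
  rw [← restrict_Ioo_eq_restrict_Ioc]
  set H : ℝ → ℂ := fun t => modePair T n (f 0) (wave (0 + n / T * (t - 0))) +
        ∫ u in (0 : ℝ)..t, 2 * Real.pi * (0 + n / T * (t - u) : ℝ) * Complex.I *
          modePair T n (fun z => (f u z - 1 * f₀ z.2) * E u z.1) (wave (0 + n / T * (t - u)))
  have hconv : ∀ t, ∫ u, x u * K (t - u) = ∫ u in Ioc 0 t, x u * K (t - u) := by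
    intro t
    refine (setIntegral_eq_integral_of_forall_compl_eq_zero fun u hu => ?_).symm
    rw [mem_Ioc, not_and_or, not_lt, not_le] at hu
    rcases hu with hu | hu
    · rw [show x u = 0 from indicator_of_notMem (fun h => not_lt.2 hu h.1) _, zero_mul]
    · rw [show K (t - u) = 0 from modeKernel_of_neg T n f₀ (sub_neg.2 hu), mul_zero]
  -- At frequency zero, Duhamel's factor `2πi(n/T)(t - u)` and the Poisson factor `-T/(2πin)`
  -- multiply to `-(t - u)`, which produces `modeKernel`.
  have hH : ∀ t ∈ Ioo 0 τ, x t - ∫ u, x u * K (t - u) = H t := by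
    intro t ht
    have hint1 : IntervalIntegrable (fun u => 2 * Real.pi * (0 + n / T * (t - u) : ℝ) * Complex.I *
        modePair T n (fun z => f u z * E u z.1) (wave (0 + n / T * (t - u)))) volume 0 t :=
      h.intervalIntegrable_forcing hT ordConnected_Ici n 0 self_mem_Ici (mem_Ici.2 ht.1.le) ht.1.le
    have hint2 : IntervalIntegrable (fun u => x u * K (t - u)) volume 0 t := by
      refine Integrable.intervalIntegrable ?_
      exact (hK.comp_sub_left t).bdd_mul (c := T) hxm (ae_of_all _ hxb)
    have hd := h.duhamel hT ordConnected_Ici n 0 (self_mem_Ici) (mem_Ici.2 ht.1.le) ht.1.le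
    have hxt : x t = A t := indicator_of_mem ht _
    rw [hconv, ← intervalIntegral.integral_of_le ht.1.le, hxt]
    simp only [A, H]
    rw [hd, add_sub_assoc, ← intervalIntegral.integral_sub hint1 hint2]
    congr 1
    refine intervalIntegral.integral_congr_ae (ae_of_all _ fun u hu => ?_)
    rw [uIoc_of_le ht.1.le] at hu
    have hxu : x u = A u := indicator_of_mem (s := Ioo 0 τ) ⟨hu.1, hu.2.trans_lt ht.2⟩ _
    rw [h.modePair_field_eq hT h₀.profile.integrable hu.1.le hn, hxu]
    have hKu : K (t - u) = -((t - u : ℝ) : ℂ) * 𝓕 (fun v => (f₀ v : ℂ)) (n / T * (t - u)) := by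
      rcases hu.2.eq_or_lt with rfl | hlt
      · simp [K, modeKernel]
      · exact indicator_of_mem (by simpa using hlt) _
    rw [hKu]
    have hnC : (n : ℂ) ≠ 0 := by exact_mod_cast hn
    have hTC : (T : ℂ) ≠ 0 := by exact_mod_cast hT.ne'
    have hπ : (Real.pi : ℂ) ≠ 0 := by exact_mod_cast Real.pi_ne_zero
    simp only [zero_add, A]
    push_cast
    field_simp
    ring
  calc ∫⁻ t in Iio τ, ‖x t - ∫ u, x u * K (t - u)‖ₑ ^ 2
      ≤ ∫⁻ t, (Ioo 0 τ).indicator (fun t => ‖H t‖ₑ ^ 2) t := by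
        rw [← lintegral_indicator measurableSet_Iio]
        refine lintegral_mono fun t => ?_
        simp only [indicator, mem_Iio]
        split_ifs with h1 h2 h2
        · rw [hH t h2]
        · have ht0 : t ≤ 0 := by
            by_contra hc
            exact h2 ⟨not_le.1 hc, h1⟩
          rw [hconv, Ioc_eq_empty (not_lt.2 ht0)]
          rw [show x t = 0 from indicator_of_notMem h2 _]
          simp
        · exact zero_le
        · exact zero_le
    _ = _ := lintegral_indicator measurableSet_Ioo _

end IsSolution

/-! ### The field in terms of the density, and sums over the modes -/

theorem tsum_mul_sq_le {ι : Type*} [Countable ι] (a b : ι → ℝ≥0∞) :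
    (∑' i, a i * b i) ^ 2 ≤ (∑' i, a i ^ 2) * ∑' i, b i ^ 2 := by
  let _ : MeasurableSpace ι := ⊤
  have : MeasurableSingletonClass ι := ⟨fun _ => trivial⟩
  have := lintegral_mul_sq_le (μ := Measure.count) (f := a) (g := b)
    (measurable_from_top.aemeasurable) (measurable_from_top.aemeasurable)
  simpa only [lintegral_count] using this

/-- The square sum of the nonzero Fourier coefficients of the density. -/
def densitySq (T : ℝ) (φ : ℝ × ℝ → ℝ) : ℝ≥0∞ :=
  ∑' n : {n : ℤ // n ≠ 0}, ‖modePair T n φ (wave 0)‖ₑ ^ 2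

/-- The square sum of the multipliers that take the density to the field. -/
def poissonSq (T : ℝ) : ℝ≥0∞ := ∑' n : {n : ℤ // n ≠ 0}, ENNReal.ofReal (T / (2 * Real.pi * |((n : ℤ) : ℝ)|)) ^ 2

theorem poissonSq_ne_top {T : ℝ} (hT : 0 < T) : poissonSq T ≠ ⊤ := by
  have h : Summable fun n : {n : ℤ // n ≠ 0} => (T / (2 * Real.pi * |((n : ℤ) : ℝ)|)) ^ 2 := by
    have := (Real.summable_one_div_int_pow (p := 2)).2 (by norm_num)
    have := (this.mul_left ((T / (2 * Real.pi)) ^ 2)).subtype {n : ℤ | n ≠ 0}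
    refine this.congr fun n => ?_
    simp only [Function.comp]
    rw [div_pow, div_pow, mul_pow _ |_|, sq_abs]
    have : (n.1 : ℝ) ≠ 0 := Int.cast_ne_zero.2 n.2
    field_simp
  refine ne_of_eq_of_ne (tsum_congr fun n => ?_) h.tsum_ofReal_ne_top
  rw [ENNReal.ofReal_pow (by positivity)]

theorem enorm_mode (T : ℝ) (n : ℤ) (x : ℝ) : ‖mode T n x‖ₑ = 1 := by
  rw [← ofReal_norm, norm_mode, ENNReal.ofReal_one]

namespace IsSolution

section

variable {T : ℝ} {I : Set ℝ} {f : ℝ → ℝ × ℝ → ℝ} {E : ℝ → ℝ → ℝ} {t : ℝ}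

theorem integral_mode_mul_field_eq_modePair (h : IsSolution T I f E) (hT : 0 < T) (ht : t ∈ I) {n : ℤ}
    (hn : n ≠ 0) : ∫ x in Ioc 0 T, mode T n x * E t x =
      -(T / (2 * Real.pi * n * Complex.I)) * modePair T n (f t) (wave 0) := by
  rw [h.integral_mode_mul_field hT ht hn, modePair_wave_eq (h.integrable t ht)]
  simp only [fourier_eq_integral_wave, wave_zero, mul_one, integral_complex_ofReal]

theorem enorm_integral_mode_mul_field (h : IsSolution T I f E) (hT : 0 < T) (ht : t ∈ I) {n : ℤ}
    (hn : n ≠ 0) : ‖∫ x in Ioc 0 T, mode T n x * E t x‖ₑ =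
      ENNReal.ofReal (T / (2 * Real.pi * |(n : ℝ)|)) * ‖modePair T n (f t) (wave 0)‖ₑ := by
  rw [h.integral_mode_mul_field_eq_modePair hT ht hn, enorm_mul, ← ofReal_norm]
  congr 2
  have : ‖(n : ℂ)‖ = |(n : ℝ)| := by rw [← Complex.ofReal_intCast, Complex.norm_real, Real.norm_eq_abs]
  simp [abs_of_pos hT, abs_of_pos Real.pi_pos]

theorem integral_mode_zero_mul_field (h : IsSolution T I f E) (hT : 0 < T) (ht : t ∈ I) :
    ∫ x in Ioc 0 T, mode T 0 x * E t x = 0 := by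
  have h1 := h.mean_E t ht
  rw [intervalIntegral.integral_of_le hT.le] at h1
  have h2 : ∀ x, mode T 0 x = 1 := fun x => by simp [mode]
  simp only [h2, one_mul]
  rw [integral_complex_ofReal, h1, Complex.ofReal_zero]

/-- The zero mode drops out because the field has mean zero. The free weight `w` serves sums of
coefficients, of their squares, and of their products with modes of `f`. -/
theorem tsum_enorm_integral_mode_mul_field (h : IsSolution T I f E) (hT : 0 < T) (ht : t ∈ I)
    (w : ℤ → ℝ≥0∞) :
    ∑' n : ℤ, ‖∫ x in Ioc 0 T, mode T n x * E t x‖ₑ * w n =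
      ∑' n : {n : ℤ // n ≠ 0}, ENNReal.ofReal (T / (2 * Real.pi * |((n : ℤ) : ℝ)|)) *
        ‖modePair T n (f t) (wave 0)‖ₑ * w n := by
  rw [← tsum_subtype_eq_of_support_subset (s := {n : ℤ | n ≠ 0})]
  · exact tsum_congr fun n => by rw [h.enorm_integral_mode_mul_field hT ht n.2]
  · intro n hn hn0
    refine hn ?_
    simp only at hn0 ⊢
    rw [hn0, h.integral_mode_zero_mul_field hT ht]; simp

theorem tsum_enorm_integral_mode_sq_le (h : IsSolution T I f E) (hT : 0 < T) (ht : t ∈ I) :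
    (∑' n : ℤ, ‖∫ x in Ioc 0 T, mode T n x * E t x‖ₑ) ^ 2 ≤ poissonSq T * densitySq T (f t) := by
  have := h.tsum_enorm_integral_mode_mul_field hT ht (fun _ => 1)
  simp only [mul_one] at this
  rw [this]
  exact tsum_mul_sq_le _ _

theorem hasSum_field (h : IsSolution T I f E) (hT : 0 < T) (ht : t ∈ I) (ha : densitySq T (f t) ≠ ⊤) (x : ℝ) :
    HasSum (fun n : ℤ => (T : ℂ)⁻¹ * (∫ y in Ioc 0 T, mode T n y * E t y) * mode T (-n) x) (E t x) := by
  have h1 := h.tsum_enorm_integral_mode_sq_le hT ht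
  have h2 : ∑' n : ℤ, ‖∫ x in Ioc 0 T, mode T n x * E t x‖ₑ ≠ ⊤ := by
    intro h3
    rw [h3] at h1
    exact ENNReal.mul_ne_top (poissonSq_ne_top hT) ha (top_le_iff.1 (by simpa using h1))
  refine hasSum_mode hT (g := fun x => (E t x : ℂ)) (Complex.continuous_ofReal.comp (h.continuous_field hT ht))
    (fun x => by simp only [h.periodic_E t ht]) ?_ x
  have := ENNReal.summable_toReal h2
  simpa using this

/-- The multipliers `T/(2π|n|)` are square summable, so by Cauchy-Schwarz the Fourier series of the
continuous function `E t` converges absolutely and represents it at every point. -/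
theorem enorm_field_le (h : IsSolution T I f E) (hT : 0 < T) (ht : t ∈ I) (x : ℝ) :
    ‖E t x‖ₑ ^ 2 ≤ ENNReal.ofReal T⁻¹ ^ 2 * poissonSq T * densitySq T (f t) := by
  by_cases ha : densitySq T (f t) = ⊤
  · rw [ha, ENNReal.mul_top]
    · exact le_top
    · refine mul_ne_zero (by simpa using hT) ?_
      unfold poissonSq
      rw [Ne, ENNReal.tsum_eq_zero, not_forall]
      exact ⟨⟨1, one_ne_zero⟩, by simp; positivity⟩
  have hs := (h.hasSum_field hT ht ha x).tsum_eq
  have hE : ‖E t x‖ₑ = ‖(E t x : ℂ)‖ₑ := by rw [← ofReal_norm, ← ofReal_norm, Complex.norm_real]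
  rw [hE, ← hs, mul_assoc]
  refine (pow_le_pow_left' (enorm_tsum_le_tsum_enorm) 2).trans ?_
  have e : ∀ n : ℤ, ‖(T : ℂ)⁻¹ * (∫ y in Ioc 0 T, mode T n y * E t y) * mode T (-n) x‖ₑ =
      ENNReal.ofReal T⁻¹ * ‖∫ y in Ioc 0 T, mode T n y * E t y‖ₑ := by
    intro n
    rw [enorm_mul, enorm_mul, enorm_mode, mul_one, ← ofReal_norm (T : ℂ)⁻¹]
    simp [abs_of_pos hT]
  simp_rw [e]
  rw [ENNReal.tsum_mul_left, mul_pow]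
  exact mul_le_mul_right (h.tsum_enorm_integral_mode_sq_le hT ht) _

theorem supSq_le_densitySq (h : IsSolution T I f E) (hT : 0 < T) (ht : t ∈ I) :
    supSq T (E t) ≤ ENNReal.ofReal T⁻¹ ^ 2 * poissonSq T * densitySq T (f t) :=
  iSup₂_le fun x _ => h.enorm_field_le hT ht x

theorem aemeasurable_enorm_modePair (h : IsSolution T (Ici 0) f E) (hT : 0 < T) (n : ℤ) (q τ : ℝ) :
    AEMeasurable (fun t => ‖modePair T n (f t) (wave q)‖ₑ ^ 2) (volume.restrict (Ioc 0 τ)) :=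
  (((h.aestronglyMeasurable_modePair hT measurableSet_Ici n q).mono_set
    fun _ hu => hu.1.le).enorm).pow_const 2

theorem lintegral_densitySq (h : IsSolution T (Ici 0) f E) (hT : 0 < T) (τ : ℝ) :
    ∫⁻ t in Ioc 0 τ, densitySq T (f t) =
      ∑' n : {n : ℤ // n ≠ 0}, ∫⁻ t in Ioc 0 τ, ‖modePair T n (f t) (wave 0)‖ₑ ^ 2 :=
  lintegral_tsum fun n => h.aemeasurable_enorm_modePair hT n 0 τ

end

variable {T s : ℝ} {f : ℝ → ℝ × ℝ → ℝ} {E : ℝ → ℝ → ℝ} {f₀ : ℝ → ℝ}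

/-- Serves twice: with `c = 1`, `q = 0` it bounds the right side of the Volterra equations, where
`M` is small; with `c = 0` and any `q` it bounds the full Duhamel formula. -/
theorem tsum_lintegral_add_le (h : IsSolution T (Ici 0) f E) (hT : 0 < T) (hs : 0 ≤ s)
    (hf₀ : Integrable f₀) (hcf : Continuous f₀) (c : ℝ) {M Mf : ℝ≥0∞} (hM_top : M ≠ ⊤)
    (hM : ∀ t, 0 ≤ t → ∫⁻ x in Ioc 0 T, sobolevSq s (fun v => f t (x, v) - c * f₀ v) ≤ M)
    (hMf : ∫⁻ x in Ioc 0 T, sobolevSq s (fun v => f 0 (x, v)) ≤ Mf) (q τ : ℝ) :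
    ∑' n : {n : ℤ // n ≠ 0}, ∫⁻ t in Ioc 0 τ, ‖modePair T n (f 0) (wave (q + (n : ℤ) / T * (t - 0))) +
        ∫ u in (0 : ℝ)..t, 2 * Real.pi * (q + (n : ℤ) / T * (t - u) : ℝ) * Complex.I *
          modePair T n (fun z => (f u z - c * f₀ z.2) * E u z.1) (wave (q + (n : ℤ) / T * (t - u)))‖ₑ ^ 2 ≤
      2 * (ENNReal.ofReal (T ^ 2) * Mf + ENNReal.ofReal (T ^ 3) * (∫⁻ p, ENNReal.ofReal (weight (1 - s) p)) * M *
        ∫⁻ u in Ioc 0 τ, supSq T (E u)) := by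
  have h0 := h.integrable 0 self_mem_Ici
  set α : {n : ℤ // n ≠ 0} → ℝ → ℂ := fun n t => modePair T n (f 0) (wave (q + (n : ℤ) / T * (t - 0)))
  set β : {n : ℤ // n ≠ 0} → ℝ → ℂ := fun n t =>
    ∫ u in (0 : ℝ)..t, 2 * Real.pi * (q + (n : ℤ) / T * (t - u) : ℝ) * Complex.I *
          modePair T n (fun z => (f u z - c * f₀ z.2) * E u z.1) (wave (q + (n : ℤ) / T * (t - u)))
  have hα : ∀ n, Measurable fun t => ‖α n t‖ₑ ^ 2 := fun n =>
    ((measurable_modePair_wave h0).enorm.pow_const 2).comp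
      (by fun_prop : Measurable fun t : ℝ => q + (n : ℤ) / T * (t - 0))
  calc ∑' n, ∫⁻ t in Ioc 0 τ, ‖α n t + β n t‖ₑ ^ 2
      ≤ ∑' n, 2 * ((∫⁻ t, ‖α n t‖ₑ ^ 2) + ∫⁻ t in Ioc 0 τ, ‖β n t‖ₑ ^ 2) := by
        refine ENNReal.tsum_le_tsum fun n => ?_
        refine (lintegral_mono fun t => enorm_add_sq_le (α n t) (β n t)).trans ?_
        rw [lintegral_const_mul' _ _ (by norm_num), lintegral_add_left (hα n)]
        gcongr
        exact Measure.restrict_le_self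
    _ = 2 * ((∑' n, ∫⁻ t, ‖α n t‖ₑ ^ 2) + ∑' n, ∫⁻ t in Ioc 0 τ, ‖β n t‖ₑ ^ 2) := by
        rw [ENNReal.tsum_mul_left, ENNReal.tsum_add]
    _ ≤ _ := by
        refine mul_le_mul_right (add_le_add ?_ ?_) _
        · exact (tsum_lintegral_free_streaming_le hT hs h0 q).trans (mul_le_mul_right hMf _)
        · exact h.tsum_lintegral_forcing_le hT hf₀ hcf c hM_top hM q τ

theorem lintegral_densitySq_le (h : IsSolution T (Ici 0) f E) (hT : 0 < T) (h₀ : IsRegularProfile s f₀)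
    {κ : ℝ} (hκ0 : 0 < κ)
    (hκ : ∀ θ : ℝ, 0 ≤ θ → θ ≤ 1 → ∀ y, κ ≤ ‖1 - (θ * T ^ 2 : ℝ) * 𝓕 (dispersionKernel f₀) y‖)
    {M Mf : ℝ≥0∞} (hM_top : M ≠ ⊤)
    (hM : ∀ t, 0 ≤ t → ∫⁻ x in Ioc 0 T, sobolevSq s (fun v => f t (x, v) - 1 * f₀ v) ≤ M)
    (hMf : ∫⁻ x in Ioc 0 T, sobolevSq s (fun v => f 0 (x, v)) ≤ Mf) (τ : ℝ) :
    ENNReal.ofReal (κ ^ 2) * ∫⁻ t in Ioc 0 τ, densitySq T (f t) ≤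
      2 * (ENNReal.ofReal (T ^ 2) * Mf + ENNReal.ofReal (T ^ 3) * (∫⁻ p, ENNReal.ofReal (weight (1 - s) p)) * M *
        ∫⁻ u in Ioc 0 τ, supSq T (E u)) := by
  have hs : 0 ≤ s := by have := h₀.gt; linarith
  rw [h.lintegral_densitySq hT, ← ENNReal.tsum_mul_left]
  refine (ENNReal.tsum_le_tsum fun n => h.lintegral_density_mode_le hT h₀ hκ0 hκ n.2 τ).trans ?_
  exact h.tsum_lintegral_add_le hT hs h₀.profile.integrable h₀.continuous 1 hM_top hM hMf 0 τ

end IsSolution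

/-! ### A decay criterion, and the forcing absorbed by smallness -/

/-- A square integrable function on `(0, ∞)` that is uniformly continuous tends to zero. -/
theorem tendsto_zero_of_lintegral_sq_le {g : ℝ → ℂ} {C : ℝ≥0∞} (hC : C ≠ ⊤)
    (hg : ∀ τ, ∫⁻ t in Ioc 0 τ, ‖g t‖ₑ ^ 2 ≤ C)
    (hu : ∀ ε > 0, ∃ η > 0, ∀ t₀ ≥ 0, ∀ t ∈ Icc t₀ (t₀ + η), ‖g t - g t₀‖ ≤ ε) :
    Tendsto g atTop (𝓝 0) := by
  set Φ : ℝ → ℝ≥0∞ := fun τ => ∫⁻ t in Ioc 0 τ, ‖g t‖ₑ ^ 2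
  have hmono : Monotone Φ := fun a b hab => lintegral_mono_set (Ioc_subset_Ioc_right hab)
  have hlim := tendsto_atTop_iSup hmono
  set L := ⨆ τ, Φ τ
  have hL : L ≠ ⊤ := ((iSup_le hg).trans_lt hC.lt_top).ne
  rw [Metric.tendsto_atTop]
  intro ε hε
  obtain ⟨η, hη, h⟩ := hu (ε / 2) (by positivity)
  set c := ENNReal.ofReal ((ε / 2) ^ 2 * η)
  have hc : c ≠ 0 := by simp only [c, Ne, ENNReal.ofReal_eq_zero, not_le]; positivity
  have hev : ∀ᶠ t in atTop, L < Φ t + c := by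
    by_cases hL0 : L = 0
    · rw [hL0]; exact Eventually.of_forall fun t => pos_iff_ne_zero.2 (by simp [hc])
    · filter_upwards [hlim.eventually_const_lt (ENNReal.sub_lt_self hL hL0 hc)] with t ht
      exact ENNReal.lt_add_of_sub_lt_right (Or.inl hL) ht
  obtain ⟨N, hN⟩ := eventually_atTop.1 hev
  refine ⟨max N 0, fun t₀ ht₀ => ?_⟩
  by_contra hcon
  rw [dist_zero_right, not_lt] at hcon
  have ht00 : 0 ≤ t₀ := (le_max_right _ _).trans ht₀
  -- If `‖g t₀‖ ≥ ε`, then `‖g‖ ≥ ε/2` on an interval of length `η`, which adds at least `c` to the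
  -- integral. After time `N` less than `c` is left.
  have h1 : Φ t₀ + c ≤ Φ (t₀ + η) := by
    have hun : Ioc 0 (t₀ + η) = Ioc 0 t₀ ∪ Ioc t₀ (t₀ + η) := (Ioc_union_Ioc_eq_Ioc ht00 (by linarith)).symm
    simp only [Φ]
    rw [hun, lintegral_union measurableSet_Ioc (Ioc_disjoint_Ioc_of_le le_rfl)]
    refine add_le_add_right ?_ _
    calc c = ∫⁻ t in Ioc t₀ (t₀ + η), ENNReal.ofReal ((ε / 2) ^ 2) := by
          simp only [c]
          rw [setLIntegral_const, Real.volume_Ioc, ENNReal.ofReal_mul (by positivity)]; congr 2; ring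
      _ ≤ _ := by
          refine setLIntegral_mono' measurableSet_Ioc fun t ht => ?_
          rw [← ofReal_norm, ← ENNReal.ofReal_pow (norm_nonneg _)]
          refine ENNReal.ofReal_le_ofReal (pow_le_pow_left₀ (by positivity) ?_ 2)
          have h2 := h t₀ ht00 t (Ioc_subset_Icc_self ht)
          have h3 := norm_sub_norm_le (g t₀) (g t)
          rw [norm_sub_rev] at h3
          linarith
  exact absurd (hN t₀ ((le_max_left _ _).trans ht₀)) (not_lt.2 (h1.trans (le_iSup Φ _)))

theorem lintegral_weight_ne_top {s : ℝ} (hs : 3 / 2 < s) :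
    ∫⁻ p, ENNReal.ofReal (weight (1 - s) p) ≠ ⊤ := by
  have h := (integrable_weight_neg (r := s - 1) (by linarith)).lintegral_lt_top
  rw [neg_sub] at h
  exact h.ne

/-- In `[0, ∞]` the term `k * X` can be cancelled only if it is finite, hence the requirement on
`X`. -/
theorem le_of_absorb {X B k : ℝ≥0∞} (hX : X ≠ ⊤) (hk0 : k ≠ 0) (hk : k ≠ ⊤) (h : (k + k) * X ≤ B + k * X) :
    X ≤ B / k := by
  rw [ENNReal.le_div_iff_mul_le (Or.inl hk0) (Or.inl hk), mul_comm]
  rw [add_mul] at h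
  exact ENNReal.le_of_add_le_add_right (ENNReal.mul_ne_top hk hX) h

namespace IsSolution

variable {T s : ℝ} {f : ℝ → ℝ × ℝ → ℝ} {E : ℝ → ℝ → ℝ} {f₀ : ℝ → ℝ}

theorem lintegral_sobolevSq_sub_le (h : IsSolution T (Ici 0) f E) (h₀ : IsRegularProfile s f₀) {ε : ℝ}
    (hε : 0 < ε) {t : ℝ} (ht : 0 ≤ t) (hl : l2HsNorm s T (fun z => f t z - f₀ z.2) < ENNReal.ofReal ε) :
    ∫⁻ x in Ioc 0 T, sobolevSq s (fun v => f t (x, v) - 1 * f₀ v) ≤ ENNReal.ofReal (ε ^ 2) := by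
  have hi := h.integrable_sub_profile h₀.profile.integrable 1 (mem_Ici.2 ht)
  simp only [one_mul] at hi ⊢
  refine (lintegral_sobolevSq_le s hi).trans ?_
  rw [ENNReal.ofReal_pow hε.le]
  exact pow_le_pow_left' hl.le 2

theorem lintegral_sobolevSq_le (h : IsSolution T (Ici 0) f E) (h₀ : IsRegularProfile s f₀) {M : ℝ≥0∞} {t : ℝ}
    (ht : 0 ≤ t) (hM : ∫⁻ x in Ioc 0 T, sobolevSq s (fun v => f t (x, v) - 1 * f₀ v) ≤ M) :
    ∫⁻ x in Ioc 0 T, sobolevSq s (fun v => f t (x, v)) ≤ 2 * (M + ENNReal.ofReal T * sobolevSq s f₀) := by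
  have hi := h.integrable_sub_profile h₀.profile.integrable 1 (mem_Ici.2 ht)
  have hpt : ∀ᵐ x ∂(volume.restrict (Ioc 0 T)), sobolevSq s (fun v => f t (x, v)) ≤
      2 * (sobolevSq s (fun v => f t (x, v) - 1 * f₀ v) + sobolevSq s f₀) := by
    filter_upwards [hi.prod_right_ae] with x hx
    have := sobolevSq_add_le s hx h₀.profile.integrable
    simpa using this
  refine (lintegral_mono_ae hpt).trans ?_
  rw [lintegral_const_mul' _ _ (by norm_num), lintegral_add_right _ measurable_const]
  refine mul_le_mul_right (add_le_add hM (le_of_eq ?_)) _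
  rw [lintegral_const, Measure.restrict_apply_univ, Real.volume_Ioc, sub_zero, mul_comm]

end IsSolution

/-- Close to a linearly stable profile, the density fluctuation is square integrable in time. -/
theorem IsRegularProfile.exists_density_bound {T s : ℝ} {f₀ : ℝ → ℝ} (h₀ : IsRegularProfile s f₀) (hT : 0 < T)
    (hTc : ENNReal.ofReal T < criticalPeriod f₀) :
    ∃ ε : ℝ, 0 < ε ∧ ∀ f E, IsSolution T (Ici 0) f E →
      (∀ t, 0 ≤ t → l2HsNorm s T (fun z => f t z - f₀ z.2) < ENNReal.ofReal ε) →
      ∃ C : ℝ≥0∞, C ≠ ⊤ ∧ ∀ τ, ∫⁻ t in Ioc 0 τ, densitySq T (f t) ≤ C := by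
  obtain ⟨κ, hκ0, hκ⟩ := h₀.exists_dispersion_bound hT hTc
  have hW := lintegral_weight_ne_top h₀.gt
  set W := ∫⁻ p, ENNReal.ofReal (weight (1 - s) p)
  set P := ENNReal.ofReal T⁻¹ ^ 2 * poissonSq T
  have hP : P ≠ ⊤ := ENNReal.mul_ne_top (by simp) (poissonSq_ne_top hT)
  set Q := 2 * (ENNReal.ofReal (T ^ 3) * W * P)
  have hQ : Q ≠ ⊤ := ENNReal.mul_ne_top (by simp) (ENNReal.mul_ne_top (ENNReal.mul_ne_top (by simp) hW) hP)
  set k := κ ^ 2 / 2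
  have hk : 0 < k := by positivity
  -- After the bound of the field by the density, the forcing is at most `Q ε²` times the density
  -- integral. This `ε` makes `Q ε² ≤ k = κ²/2`, half of the coefficient on the left; the `+ 1`
  -- covers `Q = 0`.
  set ε := Real.sqrt (k / (Q.toReal + 1))
  have hQ1 : 0 < Q.toReal + 1 := by positivity
  have hε2 : ε ^ 2 = k / (Q.toReal + 1) := Real.sq_sqrt (by positivity)
  have hε : 0 < ε := Real.sqrt_pos.2 (by positivity)
  have hQε : Q * ENNReal.ofReal (ε ^ 2) ≤ ENNReal.ofReal k := by
    rw [← ENNReal.ofReal_toReal hQ, ← ENNReal.ofReal_mul (by positivity), hε2]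
    refine ENNReal.ofReal_le_ofReal ?_
    rw [mul_div_assoc', div_le_iff₀ hQ1]
    nlinarith [ENNReal.toReal_nonneg (a := Q)]
  refine ⟨ε, hε, fun f E h hl => ?_⟩
  have hM : ∀ t, 0 ≤ t → ∫⁻ x in Ioc 0 T, sobolevSq s (fun v => f t (x, v) - 1 * f₀ v) ≤ ENNReal.ofReal (ε ^ 2) :=
    fun t ht => h.lintegral_sobolevSq_sub_le h₀ hε ht (hl t ht)
  set Mf := 2 * (ENNReal.ofReal (ε ^ 2) + ENNReal.ofReal T * sobolevSq s f₀)
  have hMf : Mf ≠ ⊤ := ENNReal.mul_ne_top (by simp)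
    (ENNReal.add_ne_top.2 ⟨by simp, ENNReal.mul_ne_top (by simp) h₀.sobolev.ne⟩)
  have hmain := h.lintegral_densitySq_le hT h₀ hκ0 hκ ENNReal.ofReal_ne_top hM
    (h.lintegral_sobolevSq_le h₀ le_rfl (hM 0 le_rfl))
  have hkk : ENNReal.ofReal (κ ^ 2) = ENNReal.ofReal k + ENNReal.ofReal k := by
    rw [← ENNReal.ofReal_add hk.le hk.le]; congr 1; ring
  refine ⟨2 * (ENNReal.ofReal (T ^ 2) * Mf) / ENNReal.ofReal k, ?_, fun τ => ?_⟩
  · exact ENNReal.div_ne_top (ENNReal.mul_ne_top (by simp) (ENNReal.mul_ne_top (by simp) hMf)) (by simpa using hk)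
  have hk0 : ENNReal.ofReal k ≠ 0 := by simpa using hk
  -- Absorption needs a finite quantity. The crude bound `|E| ≤ 2T`, inserted in the same estimate,
  -- gives finiteness for each `τ`, with a bound that may depend on `τ`.
  have hfin : ∫⁻ t in Ioc 0 τ, densitySq T (f t) ≠ ⊤ := by
    have hsup : ∫⁻ u in Ioc 0 τ, supSq T (E u) ≠ ⊤ := by
      refine ((setLIntegral_mono' measurableSet_Ioc
        fun u hu => h.supSq_le hT (mem_Ici.2 hu.1.le)).trans_lt ?_).ne
      rw [setLIntegral_const, Real.volume_Ioc]
      exact ENNReal.mul_lt_top ENNReal.ofReal_lt_top ENNReal.ofReal_lt_top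
    intro htop
    have := hmain τ
    rw [htop, ENNReal.mul_top (by simpa using hκ0.ne'), top_le_iff] at this
    refine ENNReal.mul_ne_top (by simp) (ENNReal.add_ne_top.2 ⟨ENNReal.mul_ne_top (by simp) hMf, ?_⟩) this
    exact ENNReal.mul_ne_top (ENNReal.mul_ne_top (ENNReal.mul_ne_top (by simp) hW) (by simp)) hsup
  refine le_of_absorb hfin hk0 ENNReal.ofReal_ne_top ?_
  rw [← hkk]
  refine (hmain τ).trans ?_
  have hsup : ∫⁻ u in Ioc 0 τ, supSq T (E u) ≤ P * ∫⁻ t in Ioc 0 τ, densitySq T (f t) := by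
    rw [← lintegral_const_mul' _ _ hP]
    exact setLIntegral_mono' measurableSet_Ioc fun u hu => h.supSq_le_densitySq hT (mem_Ici.2 hu.1.le)
  rw [mul_add]
  refine add_le_add_right ?_ _
  calc _ ≤ 2 * (ENNReal.ofReal (T ^ 3) * W * ENNReal.ofReal (ε ^ 2) * (P * ∫⁻ t in Ioc 0 τ, densitySq T (f t))) := by
        gcongr
    _ = Q * ENNReal.ofReal (ε ^ 2) * ∫⁻ t in Ioc 0 τ, densitySq T (f t) := by simp only [Q]; ring
    _ ≤ _ := mul_le_mul_left hQε _

/-! ### Tightness in velocity and decay of each mode -/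

theorem mul_le_sq_add_sq (a b : ℝ≥0∞) : a * b ≤ a ^ 2 + b ^ 2 := by
  rcases le_total a b with h | h
  · exact (mul_le_mul_left h b).trans ((le_of_eq (pow_two b).symm).trans le_add_self)
  · exact (mul_le_mul_right h a).trans ((le_of_eq (pow_two a).symm).trans le_self_add)

theorem norm_one_sub_wave_sq (q v : ℝ) : ‖1 - wave q v‖ ^ 2 = 2 * (1 - (wave q v).re) := by
  have h := norm_wave q v
  have h2 : (wave q v).re ^ 2 + (wave q v).im ^ 2 = 1 := by
    have := Complex.sq_norm (wave q v)
    rw [h, Complex.normSq_apply] at this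
    nlinarith
  rw [Complex.sq_norm, Complex.normSq_apply]
  simp only [Complex.sub_re, Complex.sub_im, Complex.one_re, Complex.one_im]
  nlinarith

namespace IsSolution

section

variable {T : ℝ} {I : Set ℝ} {f : ℝ → ℝ × ℝ → ℝ} {E : ℝ → ℝ → ℝ} {t : ℝ}

theorem mode_zero (T x : ℝ) : mode T 0 x = 1 := by simp [mode]

theorem modePair_zero (h : IsSolution T I f E) (hT : 0 < T) (ht : t ∈ I) :
    modePair T 0 (f t) (wave 0) = T := by
  simp only [modePair, mode_zero, wave_zero, mul_one]
  rw [integral_complex_ofReal, h.integral_eq hT ht]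

/-- Expanding the field in its Fourier series makes the zero mode of `fE` equal to `T⁻¹ Σ Ê_n
f̂_{-n}(q)`. By `ab ≤ a² + b²` each product is bounded by squares that are integrable in time; the
coefficient `T⁻¹ · T/(2π|n|)` is at most one. -/
theorem enorm_modePair_field_zero_le (h : IsSolution T I f E) (hT : 0 < T) (ht : t ∈ I)
    (ha : densitySq T (f t) ≠ ⊤) (q : ℝ) :
    ‖modePair T 0 (fun z => f t z * E t z.1) (wave q)‖ₑ ≤
      ∑' n : {n : ℤ // n ≠ 0}, (‖modePair T n (f t) (wave 0)‖ₑ ^ 2 + ‖modePair T (-n) (f t) (wave q)‖ₑ ^ 2) := by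
  set c : ℤ → ℂ := fun n => (T : ℂ)⁻¹ * ∫ y in Ioc 0 T, mode T n y * E t y
  set Φ : ℤ → ℝ × ℝ → ℂ := fun n z => c n * ((f t z : ℂ) * (mode T (-n) z.1 * wave q z.2))
  have hint : ∀ n, Integrable (fun z => (f t z : ℂ) * (mode T (-n) z.1 * wave q z.2)) (cell T) := fun n =>
    integrable_modePair (h.integrable t ht) (continuous_wave q) fun v => (norm_wave q v).le
  have hsumE : Summable fun n : ℤ => ‖c n‖ := by
    have h1 := h.tsum_enorm_integral_mode_sq_le hT ht
    have h2 : ∑' n : ℤ, ‖∫ x in Ioc 0 T, mode T n x * E t x‖ₑ ≠ ⊤ := by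
      intro h3
      rw [h3] at h1
      exact ENNReal.mul_ne_top (poissonSq_ne_top hT) ha (top_le_iff.1 (by simpa using h1))
    have h3 := (ENNReal.summable_toReal h2).mul_left ‖(T : ℂ)⁻¹‖
    refine h3.congr fun n => ?_
    simp only [c, norm_mul, toReal_enorm]
  have hnorm : ∀ n, ∫ z, ‖Φ n z‖ ∂(cell T) = ‖c n‖ * T := by
    intro n
    simp only [Φ, norm_mul, norm_mode, norm_wave, mul_one, Complex.norm_real, Real.norm_eq_abs]
    rw [integral_const_mul, h.integral_abs hT ht]
  have hs := hasSum_integral_of_summable_integral_norm (F := Φ) (μ := cell T)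
    (fun n => (hint n).const_mul (c n)) (by simp only [hnorm]; exact hsumE.mul_right T)
  have e1 : ∫ z, ∑' n, Φ n z ∂(cell T) = modePair T 0 (fun z => f t z * E t z.1) (wave q) := by
    refine integral_congr_ae (ae_of_all _ fun z => ?_)
    simp only [mode_zero, one_mul]
    have h1 := (h.hasSum_field hT ht ha z.1).mul_left ((f t z : ℂ) * wave q z.2)
    rw [show ((f t z * E t z.1 : ℝ) : ℂ) * wave q z.2 = (f t z : ℂ) * wave q z.2 * (E t z.1 : ℂ) by push_cast; ring,
      ← h1.tsum_eq]
    refine tsum_congr fun n => ?_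
    simp only [Φ, c]; ring
  have e2 : ∀ n, ∫ z, Φ n z ∂(cell T) = c n * modePair T (-n) (f t) (wave q) := fun n => integral_const_mul _ _
  rw [← e1, ← hs.tsum_eq]
  simp only [e2]
  refine enorm_tsum_le_tsum_enorm.trans ?_
  have e3 : ∀ n, ‖c n * modePair T (-n) (f t) (wave q)‖ₑ =
      ENNReal.ofReal T⁻¹ * (‖∫ y in Ioc 0 T, mode T n y * E t y‖ₑ * ‖modePair T (-n) (f t) (wave q)‖ₑ) := by
    intro n
    simp only [c]
    rw [enorm_mul, enorm_mul, ← ofReal_norm (T : ℂ)⁻¹, mul_assoc]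
    simp [abs_of_pos hT]
  simp_rw [e3]
  rw [ENNReal.tsum_mul_left, h.tsum_enorm_integral_mode_mul_field hT ht (fun n => ‖modePair T (-n) (f t) (wave q)‖ₑ),
    ← ENNReal.tsum_mul_left]
  refine ENNReal.tsum_le_tsum fun n => ?_
  refine le_trans ?_ (mul_le_sq_add_sq _ _)
  rw [← mul_assoc, ← mul_assoc, ← ENNReal.ofReal_mul (by positivity)]
  refine mul_le_mul_left (mul_le_of_le_one_left' ?_) _
  rw [← ENNReal.ofReal_one]
  refine ENNReal.ofReal_le_ofReal ?_
  have hn : (1 : ℝ) ≤ |((n : ℤ) : ℝ)| := by exact_mod_cast Int.one_le_abs n.2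
  have hπ := Real.pi_gt_three
  rw [mul_div_assoc', inv_mul_cancel₀ hT.ne', div_le_one (by positivity)]
  nlinarith

/-- Combine `g ≤ δ + g²/δ` for `g = |1 - e^{-2πiqv}|` with `g² = 2(1 - cos 2πqv)`. As `f ≥ 0`, the
integral of `f (1 - cos 2πqv)` is exactly the defect of the zero mode, which therefore controls
every mode `n` at once. -/
theorem norm_modePair_sub_le (h : IsSolution T I f E) (hT : 0 < T) (ht : t ∈ I) (n : ℤ) (q : ℝ) {δ : ℝ}
    (hδ : 0 < δ) : ‖modePair T n (f t) (wave 0) - modePair T n (f t) (wave q)‖ ≤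
      δ * T + 2 / δ * (T - (modePair T 0 (f t) (wave q)).re) := by
  have hf := h.integrable t ht
  rw [← modePair_sub hf (continuous_wave 0) (fun v => (norm_wave 0 v).le) (continuous_wave q)
    (fun v => (norm_wave q v).le)]
  have hre : (modePair T 0 (f t) (wave q)).re = ∫ z, f t z * (wave q z.2).re ∂(cell T) := by
    have hi := integrable_modePair (n := 0) hf (continuous_wave q) (fun v => (norm_wave q v).le)
    have h1 : (modePair T 0 (f t) (wave q)).re = ∫ z, ((f t z : ℂ) * (mode T 0 z.1 * wave q z.2)).re ∂(cell T) :=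
      (integral_re hi).symm
    rw [h1]
    refine integral_congr_ae (ae_of_all _ fun z => ?_)
    simp [mode_zero]
  have hi2 : Integrable (fun z => f t z * (wave q z.2).re) (cell T) := by
    refine hf.mul_bdd (c := 1) ?_ (ae_of_all _ fun z => ?_)
    · exact (Complex.continuous_re.comp ((continuous_wave q).comp continuous_snd)).aestronglyMeasurable
    · exact (Complex.abs_re_le_norm _).trans (norm_wave _ _).le
  have hd : Integrable (fun z => f t z - f t z * (wave q z.2).re) (cell T) := hf.sub hi2
  have e : ∫ z, (δ * f t z + 2 / δ * (f t z - f t z * (wave q z.2).re)) ∂(cell T) =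
      δ * T + 2 / δ * (T - (modePair T 0 (f t) (wave q)).re) := by
    rw [integral_add (hf.const_mul δ) (hd.const_mul _), integral_const_mul, integral_const_mul,
      integral_sub hf hi2, h.integral_eq hT ht, hre]
  rw [← e]
  refine norm_integral_le_of_norm_le ((hf.const_mul δ).add (hd.const_mul _)) (ae_of_all _ fun z => ?_)
  rw [norm_mul, norm_mul, norm_mode, one_mul, Complex.norm_real, Real.norm_eq_abs, abs_of_nonneg (h.nonneg t ht z)]
  simp only [wave_zero]
  have hg := norm_one_sub_wave_sq q z.2
  have hg0 := norm_nonneg (1 - wave q z.2)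
  set g := ‖1 - wave q z.2‖
  have h1 : g ≤ δ + g ^ 2 / δ := by
    rw [← sub_nonneg]
    have : δ + g ^ 2 / δ - g = ((δ - g / 2) ^ 2 + 3 / 4 * g ^ 2) / δ := by field_simp; ring
    rw [this]; positivity
  calc f t z * g ≤ f t z * (δ + g ^ 2 / δ) := mul_le_mul_of_nonneg_left h1 (h.nonneg t ht z)
    _ = _ := by rw [hg]; ring

theorem continuous_modePair_wave (h : IsSolution T I f E) (ht : t ∈ I) (n : ℤ) :
    Continuous fun q => modePair T n (f t) (wave q) := by
  refine continuous_of_dominated (bound := fun z => |f t z|) (fun q => ?_) (fun q => ae_of_all _ fun z => ?_)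
    (h.integrable t ht).abs (ae_of_all _ fun z => ?_)
  · exact (integrable_modePair (h.integrable t ht) (continuous_wave q) fun v => (norm_wave q v).le).1
  · simp [norm_mode, norm_wave]
  · have := continuous_wave_uncurry.comp (f := fun q : ℝ => (q, z.2)) (by fun_prop)
    exact continuous_const.mul (continuous_const.mul this)

end

variable {T s : ℝ} {f : ℝ → ℝ × ℝ → ℝ} {E : ℝ → ℝ → ℝ} {f₀ : ℝ → ℝ} {C M : ℝ≥0∞}

/-- All Fourier transforms in velocity of the nonzero modes are square integrable in time. -/
theorem tsum_lintegral_modePair_le (h : IsSolution T (Ici 0) f E) (hT : 0 < T) (hs : 0 ≤ s)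
    (hM_top : M ≠ ⊤) (hM : ∀ t, 0 ≤ t → ∫⁻ x in Ioc 0 T, sobolevSq s (fun v => f t (x, v)) ≤ M)
    (hC : ∀ τ, ∫⁻ t in Ioc 0 τ, densitySq T (f t) ≤ C) (q τ : ℝ) :
    ∑' n : {n : ℤ // n ≠ 0}, ∫⁻ t in Ioc 0 τ, ‖modePair T n (f t) (wave q)‖ₑ ^ 2 ≤
      2 * (ENNReal.ofReal (T ^ 2) * M + ENNReal.ofReal (T ^ 3) * (∫⁻ p, ENNReal.ofReal (weight (1 - s) p)) * M *
        (ENNReal.ofReal T⁻¹ ^ 2 * poissonSq T * C)) := by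
  -- With `c = 0` the bound `M` is not small, but nothing has to be absorbed: the field is already
  -- known to be square integrable in time.
  have h1 := h.tsum_lintegral_add_le hT hs (f₀ := fun _ => 0) (integrable_zero _ _ _) continuous_const 0 hM_top
    (by simpa using hM) (hM 0 le_rfl) q τ
  simp only [mul_zero, sub_zero] at h1
  have e : ∀ n : {n : ℤ // n ≠ 0}, ∫⁻ t in Ioc 0 τ, ‖modePair T n (f t) (wave q)‖ₑ ^ 2 =
      ∫⁻ t in Ioc 0 τ, ‖modePair T n (f 0) (wave (q + (n : ℤ) / T * t)) +
        ∫ u in (0 : ℝ)..t, 2 * Real.pi * (q + (n : ℤ) / T * (t - u) : ℝ) * Complex.I *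
          modePair T n (fun z => f u z * E u z.1) (wave (q + (n : ℤ) / T * (t - u)))‖ₑ ^ 2 := by
    intro n
    refine setLIntegral_congr_fun measurableSet_Ioc fun t ht => ?_
    have := h.duhamel hT ordConnected_Ici n q self_mem_Ici (mem_Ici.2 ht.1.le) ht.1.le
    rw [sub_zero] at this
    simp only [this]
  simp_rw [e]
  refine h1.trans ?_
  have hsup : ∫⁻ u in Ioc 0 τ, supSq T (E u) ≤ ENNReal.ofReal T⁻¹ ^ 2 * poissonSq T * C := by
    refine le_trans ?_ (mul_le_mul_right (hC τ) _)
    rw [← lintegral_const_mul' _ _ (ENNReal.mul_ne_top (by simp) (poissonSq_ne_top hT))]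
    exact setLIntegral_mono' measurableSet_Ioc fun u hu => h.supSq_le_densitySq hT (mem_Ici.2 hu.1.le)
  gcongr

/-- The time integral of `enorm_modePair_field_zero_le`, available for almost every time since
`densitySq` has finite integral; the modes `-n` are reindexed. The bound is uniform in `q` and `τ`.
-/
theorem lintegral_modePair_field_zero_le (h : IsSolution T (Ici 0) f E) (hT : 0 < T) {C' : ℝ≥0∞} (hC_top : C ≠ ⊤)
    (hC : ∀ τ, ∫⁻ t in Ioc 0 τ, densitySq T (f t) ≤ C)
    (hC' : ∀ q τ, ∑' n : {n : ℤ // n ≠ 0}, ∫⁻ t in Ioc 0 τ, ‖modePair T n (f t) (wave q)‖ₑ ^ 2 ≤ C') (q τ : ℝ) :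
    ∫⁻ t in Ioc 0 τ, ‖modePair T 0 (fun z => f t z * E t z.1) (wave q)‖ₑ ≤ C + C' := by
  have hm : AEMeasurable (fun t => densitySq T (f t)) (volume.restrict (Ioc 0 τ)) :=
    AEMeasurable.tsum fun n => h.aemeasurable_enorm_modePair hT n 0 τ
  have hfin : ∀ᵐ t ∂(volume.restrict (Ioc 0 τ)), densitySq T (f t) < ⊤ :=
    ae_lt_top' hm ((hC τ).trans_lt hC_top.lt_top).ne
  calc _ ≤ ∫⁻ t in Ioc 0 τ, ((densitySq T (f t)) +
          ∑' n : {n : ℤ // n ≠ 0}, ‖modePair T (-n) (f t) (wave q)‖ₑ ^ 2) := by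
        refine lintegral_mono_ae ?_
        filter_upwards [hfin, ae_restrict_mem measurableSet_Ioc] with t ht ht2
        refine (h.enorm_modePair_field_zero_le hT (mem_Ici.2 ht2.1.le) ht.ne q).trans (le_of_eq ?_)
        rw [ENNReal.tsum_add]; rfl
    _ ≤ _ := by
        rw [lintegral_add_left' hm]
        refine add_le_add (hC τ) ?_
        rw [lintegral_tsum fun n => h.aemeasurable_enorm_modePair hT _ q τ]
        refine le_trans ?_ (hC' q τ)
        exact ENNReal.tsum_comp_le_tsum_of_injective (f := fun n : {n : ℤ // n ≠ 0} => (⟨-n, neg_ne_zero.2 n.2⟩ : {n : ℤ // n ≠ 0}))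
          (fun a b hab => by simpa [Subtype.ext_iff] using hab)
          (fun n : {n : ℤ // n ≠ 0} => ∫⁻ t in Ioc 0 τ, ‖modePair T n (f t) (wave q)‖ₑ ^ 2)

/-- Tightness in velocity, uniformly in time. -/
theorem exists_equicontinuous (h : IsSolution T (Ici 0) f E) (hT : 0 < T) {D : ℝ≥0∞} (hD : D ≠ ⊤)
    (hB : ∀ q τ, ∫⁻ t in Ioc 0 τ, ‖modePair T 0 (fun z => f t z * E t z.1) (wave q)‖ₑ ≤ D) {ε : ℝ} (hε : 0 < ε) :
    ∃ δ > 0, ∀ t ≥ 0, ∀ q, |q| ≤ δ → ∀ n, ‖modePair T n (f t) (wave 0) - modePair T n (f t) (wave q)‖ ≤ ε := by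
  -- The free flow does not move the frequency of the mode `n = 0`, so its change over all time is
  -- `2πiq` times an integral bounded by `D`.
  have hzero : ∀ t ≥ 0, ∀ q, ‖modePair T 0 (f t) (wave q) - modePair T 0 (f 0) (wave q)‖ ≤
      2 * Real.pi * |q| * D.toReal := by
    intro t ht q
    have hd := h.duhamel hT ordConnected_Ici 0 q self_mem_Ici (mem_Ici.2 ht) ht
    simp only [Int.cast_zero, zero_div, zero_mul, add_zero] at hd
    rw [hd, add_sub_cancel_left, intervalIntegral.integral_const_mul, norm_mul,
      intervalIntegral.integral_of_le ht]
    have e1 : ‖(2 * Real.pi * (q : ℝ) * Complex.I : ℂ)‖ = 2 * Real.pi * |q| := by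
      simp [abs_of_pos Real.pi_pos]
    rw [e1]
    refine mul_le_mul_of_nonneg_left ?_ (by positivity)
    have := (enorm_integral_le_lintegral_enorm _).trans (hB q t)
    rw [← ofReal_norm] at this
    exact (ENNReal.ofReal_le_iff_le_toReal hD).1 this
  -- The constants give `δ₀ T = ε/2` and `(2/δ₀)(2η) = ε/2`. One `η` bounds the change of the zero
  -- mode since time zero, the other its deviation from `T` at time zero.
  set δ₀ := ε / (2 * T)
  have hδ₀ : 0 < δ₀ := by positivity
  set η := ε * δ₀ / 8
  have hη : 0 < η := by positivity
  have hcont := (h.continuous_modePair_wave self_mem_Ici 0).tendsto 0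
  obtain ⟨δ₁, hδ₁, h1⟩ := Metric.tendsto_nhds_nhds.1 hcont η hη
  refine ⟨min (δ₁ / 2) (η / (2 * Real.pi * (D.toReal + 1))), by positivity, fun t ht q hq n => ?_⟩
  have hq1 : |q| < δ₁ := by linarith [hq.trans (min_le_left _ _)]
  have hq2 : |q| ≤ η / (2 * Real.pi * (D.toReal + 1)) := hq.trans (min_le_right _ _)
  rw [le_div_iff₀ (by positivity)] at hq2
  have hq3 : 2 * Real.pi * |q| * D.toReal ≤ η := by
    have : 0 ≤ 2 * Real.pi * |q| := by positivity
    nlinarith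
  have h2 := h1 (x := q) (by simpa using hq1)
  rw [dist_eq_norm, h.modePair_zero hT self_mem_Ici] at h2
  have h3 := hzero t ht q
  have h4 : T - (modePair T 0 (f t) (wave q)).re ≤ 2 * η := by
    have a := Complex.abs_re_le_norm (modePair T 0 (f t) (wave q) - T)
    have b : ‖modePair T 0 (f t) (wave q) - T‖ ≤ 2 * η := by
      have := norm_add_le (modePair T 0 (f t) (wave q) - modePair T 0 (f 0) (wave q)) (modePair T 0 (f 0) (wave q) - T)
      rw [sub_add_sub_cancel] at this
      linarith
    have c := neg_abs_le (modePair T 0 (f t) (wave q) - T).re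
    simp only [Complex.sub_re, Complex.ofReal_re] at a c
    linarith
  refine (h.norm_modePair_sub_le hT (mem_Ici.2 ht) n q hδ₀).trans ?_
  have h5 : 2 / δ₀ * (T - (modePair T 0 (f t) (wave q)).re) ≤ 2 / δ₀ * (2 * η) :=
    mul_le_mul_of_nonneg_left h4 (by positivity)
  have h6 : δ₀ * T = ε / 2 := by simp only [δ₀]; field_simp
  have h7 : 2 / δ₀ * (2 * η) = ε / 2 := by simp only [η]; field_simp; ring
  linarith

/-- The mode is square integrable in time, so uniform continuity suffices. In Duhamel's formula
started at `t₀`, free streaming changes the frequency by `n(t - t₀)/T`, which the uniform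
equicontinuity in `q` controls, and the forcing over `[t₀, t]` is of order `t - t₀`. -/
theorem tendsto_modePair_zero (h : IsSolution T (Ici 0) f E) (hT : 0 < T) (hC_top : C ≠ ⊤)
    (hC : ∀ τ, ∫⁻ t in Ioc 0 τ, densitySq T (f t) ≤ C)
    (hequi : ∀ ε > 0, ∃ δ > 0, ∀ t ≥ 0, ∀ q, |q| ≤ δ → ∀ n,
      ‖modePair T n (f t) (wave 0) - modePair T n (f t) (wave q)‖ ≤ ε) {n : ℤ} (hn : n ≠ 0) :
    Tendsto (fun t => modePair T n (f t) (wave 0)) atTop (𝓝 0) := by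
  refine tendsto_zero_of_lintegral_sq_le hC_top (fun τ => ?_) fun ε hε => ?_
  · refine le_trans ?_ (hC τ)
    rw [h.lintegral_densitySq hT]
    exact ENNReal.le_tsum (f := fun n : {n : ℤ // n ≠ 0} => ∫⁻ t in Ioc 0 τ, ‖modePair T n (f t) (wave 0)‖ₑ ^ 2) ⟨n, hn⟩
  · obtain ⟨δ, hδ, hδe⟩ := hequi (ε / 2) (by positivity)
    set k := |(n : ℝ) / T|
    have hk : 0 < k := abs_pos.2 (div_ne_zero (by exact_mod_cast hn) hT.ne')
    set L := 2 * Real.pi * k * (2 * T ^ 2)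
    have hL : 0 < L := by positivity
    -- The three entries bound, in turn, the factor `t - u` in the forcing by one, the shift of the
    -- frequency by `δ`, and the forcing by `ε/2`.
    refine ⟨min 1 (min (δ / k) (ε / (2 * L))), by positivity, fun t₀ ht₀ t ht => ?_⟩
    set η := min 1 (min (δ / k) (ε / (2 * L)))
    have hη : 0 < η := by positivity
    have hη1 : η ≤ 1 := min_le_left _ _
    have hη2 : k * η ≤ δ := by
      have : η ≤ δ / k := (min_le_right _ _).trans (min_le_left _ _)
      rw [le_div_iff₀ hk] at this; linarith
    have hη3 : L * η ≤ ε / 2 := by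
      have : η ≤ ε / (2 * L) := (min_le_right _ _).trans (min_le_right _ _)
      rw [le_div_iff₀ (by positivity)] at this; linarith
    have htt : 0 ≤ t - t₀ := sub_nonneg.2 ht.1
    have htη : t - t₀ ≤ η := by linarith [ht.2]
    have hd := h.duhamel hT ordConnected_Ici n 0 (mem_Ici.2 ht₀) (mem_Ici.2 (ht₀.le.trans ht.1)) ht.1
    have h1 := hδe t₀ ht₀ (0 + n / T * (t - t₀)) (by
      rw [zero_add, abs_mul, abs_of_nonneg htt]
      exact (mul_le_mul_of_nonneg_left htη hk.le).trans hη2) n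
    have h2 : ‖∫ u in t₀..t, 2 * Real.pi * (0 + n / T * (t - u) : ℝ) * Complex.I *
        modePair T n (fun z => f u z * E u z.1) (wave (0 + n / T * (t - u)))‖ ≤ L * |t - t₀| := by
      refine intervalIntegral.norm_integral_le_of_norm_le_const fun u hu => ?_
      rw [uIoc_of_le ht.1] at hu
      have hu0 : 0 ≤ t - u := sub_nonneg.2 hu.2
      have h3 := h.norm_modePair_field_le hT (mem_Ici.2 (ht₀.le.trans hu.1.le)) (n := n)
        (fun v => (norm_wave (0 + n / T * (t - u)) v).le)
      rw [norm_mul]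
      have e1 : ‖(2 * Real.pi * ((0 + n / T * (t - u) : ℝ) : ℂ) * Complex.I : ℂ)‖ = 2 * Real.pi * (k * (t - u)) := by
        rw [norm_mul, norm_mul, norm_mul, Complex.norm_I, Complex.norm_real, Complex.norm_real, Complex.norm_ofNat,
          Real.norm_eq_abs, Real.norm_eq_abs, abs_of_pos Real.pi_pos, zero_add, abs_mul, abs_of_nonneg hu0, mul_one]
      rw [e1]
      have h4 : k * (t - u) ≤ k := mul_le_of_le_one_right hk.le (by linarith [hu.1])
      calc _ ≤ 2 * Real.pi * k * (1 * (2 * T ^ 2)) := by gcongr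
        _ = L := by simp only [L]; ring
    rw [abs_of_nonneg htt] at h2
    have h5 : L * (t - t₀) ≤ ε / 2 := (mul_le_mul_of_nonneg_left htη hL.le).trans hη3
    rw [hd]
    rw [add_sub_right_comm]
    refine (norm_add_le _ _).trans ?_
    rw [norm_sub_rev]
    linarith

end IsSolution

/-! ### Convergence of the field -/

theorem fieldNorm_sq (T : ℝ) (e : ℝ → ℝ) : fieldNorm T e ^ 2 = ∫⁻ x in Ioc 0 T, ‖(e x : ℂ)‖ₑ ^ 2 := by
  rw [fieldNorm, eLpNorm_eq_lintegral_rpow_enorm_toReal (by norm_num) (by norm_num), ← ENNReal.rpow_natCast,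
    ← ENNReal.rpow_mul]
  simp only [← ofReal_norm, Complex.norm_real]
  simp

namespace IsSolution

section

variable {T : ℝ} {I : Set ℝ} {f : ℝ → ℝ × ℝ → ℝ} {E : ℝ → ℝ → ℝ} {t : ℝ}

theorem mul_fieldNorm_sq (h : IsSolution T I f E) (hT : 0 < T) (ht : t ∈ I) :
    ENNReal.ofReal T * fieldNorm T (E t) ^ 2 = ∑' n : {n : ℤ // n ≠ 0},
      (ENNReal.ofReal (T / (2 * Real.pi * |((n : ℤ) : ℝ)|)) * ‖modePair T n (f t) (wave 0)‖ₑ) ^ 2 := by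
  have hL : MemLp (fun x => (E t x : ℂ)) 2 (volume.restrict (Ioc 0 T)) := by
    refine MemLp.of_bound (Complex.continuous_ofReal.comp (h.continuous_field hT ht)).aestronglyMeasurable (2 * T)
      (ae_of_all _ fun x => ?_)
    rw [Complex.norm_real]
    exact h.abs_field_le hT ht x
  rw [fieldNorm_sq, ← tsum_enorm_sq_mode hT hL]
  simp_rw [pow_two]
  rw [h.tsum_enorm_integral_mode_mul_field hT ht]
  refine tsum_congr fun n => ?_
  rw [h.enorm_integral_mode_mul_field hT ht n.2]

end

variable {T : ℝ} {f : ℝ → ℝ × ℝ → ℝ} {E : ℝ → ℝ → ℝ}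

/-- Parseval's identity writes the norm as a sum over modes that tends to zero termwise; since
`|ρ_n| ≤ T`, the terms are dominated by the summable `(T/(2π|n|) · T)²`. -/
theorem tendsto_fieldNorm (h : IsSolution T (Ici 0) f E) (hT : 0 < T)
    (hlim : ∀ n : ℤ, n ≠ 0 → Tendsto (fun t => modePair T n (f t) (wave 0)) atTop (𝓝 0)) :
    Tendsto (fun t => fieldNorm T (E t)) atTop (𝓝 0) := by
  set c : {n : ℤ // n ≠ 0} → ℝ≥0∞ := fun n => ENNReal.ofReal (T / (2 * Real.pi * |((n : ℤ) : ℝ)|))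
  have h1 : Tendsto (fun t => ∑' n, (c n * ‖modePair T n (f t) (wave 0)‖ₑ) ^ 2) atTop (𝓝 0) := by
    have hd := tendsto_lintegral_filter_of_dominated_convergence (μ := Measure.count) (l := atTop)
      (F := fun (t : ℝ) (n : {n : ℤ // n ≠ 0}) => (c n * ‖modePair T n (f t) (wave 0)‖ₑ) ^ 2) (f := fun _ => 0)
      (fun n => (c n * ENNReal.ofReal T) ^ 2) (Eventually.of_forall fun t => measurable_of_countable _) ?_ ?_ ?_
    · simpa only [lintegral_count, lintegral_zero] using hd
    · filter_upwards [eventually_ge_atTop 0] with t ht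
      refine ae_of_all _ fun n => pow_le_pow_left' (mul_le_mul_right ?_ _) 2
      rw [← ofReal_norm]
      exact ENNReal.ofReal_le_ofReal (h.norm_modePair_wave_le hT (mem_Ici.2 ht) n 0)
    · simp only [lintegral_count, mul_pow]
      rw [ENNReal.tsum_mul_right]
      exact ENNReal.mul_ne_top (poissonSq_ne_top hT) (by simp)
    · refine ae_of_all _ fun n => ?_
      have h2 : Tendsto (fun t => ‖modePair T n (f t) (wave 0)‖ₑ) atTop (𝓝 0) := by
        have := (hlim n n.2).enorm
        simpa using this
      have h3 := ENNReal.Tendsto.pow (n := 2) (ENNReal.Tendsto.const_mul (a := c n) h2 (Or.inr ENNReal.ofReal_ne_top))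
      simpa using h3
  have hT0 : ENNReal.ofReal T ≠ 0 := by simpa using hT
  have h2 : Tendsto (fun t => ((ENNReal.ofReal T)⁻¹ * ∑' n, (c n * ‖modePair T n (f t) (wave 0)‖ₑ) ^ 2) ^ (1 / 2 : ℝ))
      atTop (𝓝 0) := by
    have h3 := ENNReal.Tendsto.const_mul (a := (ENNReal.ofReal T)⁻¹) h1 (Or.inr (ENNReal.inv_ne_top.2 hT0))
    have h4 := (ENNReal.continuous_rpow_const (y := (1 / 2 : ℝ))).tendsto _ |>.comp h3
    simpa [Function.comp_def] using h4
  refine h2.congr' ?_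
  filter_upwards [eventually_ge_atTop 0] with t ht
  rw [← h.mul_fieldNorm_sq hT (mem_Ici.2 ht), ← mul_assoc, ENNReal.inv_mul_cancel hT0 ENNReal.ofReal_ne_top, one_mul,
    ← ENNReal.rpow_natCast, ← ENNReal.rpow_mul]
  simp

end IsSolution

/-- Solutions that stay close to a linearly stable profile are damped. -/
theorem IsRegularProfile.exists_damping {T s : ℝ} {f₀ : ℝ → ℝ} (h₀ : IsRegularProfile s f₀) (hT : 0 < T)
    (hTc : ENNReal.ofReal T < criticalPeriod f₀) :
    ∃ ε : ℝ, 0 < ε ∧ ∀ f E, IsSolution T (Ici 0) f E →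
      (∀ t, 0 ≤ t → l2HsNorm s T (fun z => f t z - f₀ z.2) < ENNReal.ofReal ε) →
      Tendsto (fun t => fieldNorm T (E t)) atTop (𝓝 0) := by
  obtain ⟨ε, hε, hmain⟩ := h₀.exists_density_bound hT hTc
  refine ⟨ε, hε, fun f E h hl => ?_⟩
  obtain ⟨C, hC_top, hC⟩ := hmain f E h hl
  have hs : 0 ≤ s := by have := h₀.gt; linarith
  set M := 2 * (ENNReal.ofReal (ε ^ 2) + ENNReal.ofReal T * sobolevSq s f₀)
  have hM_top : M ≠ ⊤ := ENNReal.mul_ne_top (by simp)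
    (ENNReal.add_ne_top.2 ⟨by simp, ENNReal.mul_ne_top (by simp) h₀.sobolev.ne⟩)
  have hM : ∀ t, 0 ≤ t → ∫⁻ x in Ioc 0 T, sobolevSq s (fun v => f t (x, v)) ≤ M := fun t ht =>
    h.lintegral_sobolevSq_le h₀ ht (h.lintegral_sobolevSq_sub_le h₀ hε ht (hl t ht))
  have hU := h.tsum_lintegral_modePair_le hT hs hM_top hM hC
  have hB := h.lintegral_modePair_field_zero_le hT hC_top hC hU
  refine h.tendsto_fieldNorm hT fun n hn => h.tendsto_modePair_zero hT hC_top hC (fun ε hε => ?_) hn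
  refine h.exists_equicontinuous hT (ENNReal.add_ne_top.2 ⟨hC_top, ?_⟩) hB hε
  refine ENNReal.mul_ne_top (by simp) (ENNReal.add_ne_top.2 ⟨ENNReal.mul_ne_top (by simp) hM_top, ?_⟩)
  exact ENNReal.mul_ne_top (ENNReal.mul_ne_top (ENNReal.mul_ne_top (by simp) (lintegral_weight_ne_top h₀.gt)) hM_top)
    (ENNReal.mul_ne_top (ENNReal.mul_ne_top (by simp) (poissonSq_ne_top hT)) hC_top)

/-! ### Time reversal -/

/-- The reflection of phase space in the middle of the period cell. -/
def reflect (T : ℝ) (z : ℝ × ℝ) : ℝ × ℝ := (T - z.1, z.2)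

section reflect

variable (T : ℝ)

theorem measurePreserving_sub_left_Ioc :
    MeasurePreserving (fun x : ℝ => T - x) (volume.restrict (Ioc 0 T)) (volume.restrict (Ioc 0 T)) := by
  have h := (Measure.measurePreserving_sub_left volume T).restrict_preimage (s := Ico 0 T) measurableSet_Ico
  have e : (fun x : ℝ => T - x) ⁻¹' Ico 0 T = Ioc 0 T := by
    ext x; simp only [mem_preimage, mem_Ico, mem_Ioc]; constructor <;> rintro ⟨h1, h2⟩ <;> constructor <;> linarith
  rw [e, restrict_Ico_eq_restrict_Ioc] at h
  exact h

theorem measurePreserving_reflect : MeasurePreserving (reflect T) (cell T) (cell T) :=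
  (measurePreserving_sub_left_Ioc T).prod (MeasurePreserving.id volume)

theorem measurableEmbedding_sub_left : MeasurableEmbedding (fun x : ℝ => T - x) :=
  (Homeomorph.subLeft T).measurableEmbedding

theorem measurableEmbedding_reflect : MeasurableEmbedding (reflect T) :=
  ((Homeomorph.subLeft T).prodCongr (Homeomorph.refl ℝ)).measurableEmbedding

theorem integral_reflect (g : ℝ × ℝ → ℝ) : ∫ z, g (reflect T z) ∂(cell T) = ∫ z, g z ∂(cell T) :=
  (measurePreserving_reflect T).integral_comp (measurableEmbedding_reflect T) g

theorem reflect_reflect (z : ℝ × ℝ) : reflect T (reflect T z) = z := by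
  simp [reflect]

theorem IsTest.reflect {T : ℝ} {φ : ℝ × ℝ → ℝ} (h : IsTest T φ) : IsTest T fun z => φ (VlasovPoisson.reflect T z) where
  smooth := h.smooth.comp (by unfold VlasovPoisson.reflect; fun_prop)
  periodic x v := by
    have := h.periodic (T - (x + T)) v
    simp only [VlasovPoisson.reflect]
    rw [← this]; congr 2; ring
  support := by
    obtain ⟨R, hR⟩ := h.support
    exact ⟨R, fun x v hv => hR _ _ hv⟩

/-- The velocity is kept; reflection changes the sign of `∂ₓ`, and the field changes sign by
definition, so both terms change sign, as time reversal requires. -/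
theorem transportTerm_reflect (g : ℝ × ℝ → ℝ) (e : ℝ → ℝ) (φ : ℝ × ℝ → ℝ) :
    transportTerm T (fun z => g (reflect T z)) (fun x => -e (T - x)) φ =
      -transportTerm T g e (fun z => φ (reflect T z)) := by
  unfold transportTerm
  rw [← integral_neg, ← integral_reflect]
  refine integral_congr_ae (ae_of_all _ fun z => ?_)
  simp only [reflect, sub_sub_cancel]
  rw [deriv_comp_const_sub (fun x => φ (x, z.2))]
  ring

theorem l2HsNorm_reflect (s : ℝ) (g : ℝ × ℝ → ℝ) :
    l2HsNorm s T (fun z => g (reflect T z)) = l2HsNorm s T g := by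
  unfold l2HsNorm
  congr 1
  exact (measurePreserving_sub_left_Ioc T).lintegral_comp_emb (measurableEmbedding_sub_left T)
    (fun x => hsNorm s (fun v => g (x, v)) ^ 2)

theorem fieldNorm_reflect (e : ℝ → ℝ) : fieldNorm T (fun x => -e (T - x)) = fieldNorm T e := by
  have h : fieldNorm T (fun x => -e (T - x)) ^ 2 = fieldNorm T e ^ 2 := by
    rw [fieldNorm_sq, fieldNorm_sq, ← (measurePreserving_sub_left_Ioc T).lintegral_comp_emb
      (measurableEmbedding_sub_left T) (fun x => ‖(e x : ℂ)‖ₑ ^ 2)]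
    refine lintegral_congr fun x => ?_
    rw [Complex.ofReal_neg, enorm_neg]
  exact (ENNReal.pow_right_strictMono two_ne_zero).injective h

end reflect

/-- Time reversal together with reflection in space maps solutions to solutions. -/
theorem IsSolution.reverse {T : ℝ} {f : ℝ → ℝ × ℝ → ℝ} {E : ℝ → ℝ → ℝ} (h : IsSolution T (Iic 0) f E) :
    IsSolution T (Ici 0) (fun t z => f (-t) (reflect T z)) (fun t x => -E (-t) (T - x)) where
  measurable := by
    have h1 : MeasurePreserving (fun t : ℝ => -t) (volume.restrict (Ici 0)) (volume.restrict (Iic 0)) := by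
      have := (Measure.measurePreserving_neg (volume : Measure ℝ)).restrict_preimage (s := Iic 0) measurableSet_Iic
      convert! this using 2
      ext x; simp
    exact h.measurable.comp_quasiMeasurePreserving (h1.prod (measurePreserving_reflect T)).quasiMeasurePreserving
  nonneg t ht z := h.nonneg (-t) (by simpa using ht) _
  periodic_f t ht x v := by
    have := h.periodic_f (-t) (by simpa using ht) (T - (x + T)) v
    simp only [reflect]
    rw [← this]; congr 2; ring
  integrable t ht := (measurePreserving_reflect T).integrable_comp_of_integrable (h.integrable (-t) (by simpa using ht))
  neutral := by rw [neg_zero, integral_reflect T (f 0), h.neutral]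
  periodic_E t ht x := by
    have := h.periodic_E (-t) (by simpa using ht) (T - (x + T))
    rw [← this]; congr 2; ring
  mean_E t ht := by
    rw [intervalIntegral.integral_neg, intervalIntegral.integral_comp_sub_left (fun x => E (-t) x) T, sub_self, sub_zero,
      h.mean_E (-t) (by simpa using ht), neg_zero]
  poisson t ht x y := by
    have := h.poisson (-t) (by simpa using ht) (T - y) (T - x)
    rw [neg_sub_neg, this]
    exact (intervalIntegral.integral_comp_sub_left (fun z => 1 - ∫ v, f (-t) (z, v)) T).symm
  vlasov φ hφ t₁ h₁ t₂ h₂ h₁₂ := by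
    obtain ⟨hi, he⟩ := h.vlasov _ hφ.reflect (-t₂) (by simpa using h₂) (-t₁) (by simpa using h₁) (neg_le_neg h₁₂)
    simp only [transportTerm_reflect]
    have e : ∀ t, ∫ z, f (-t) (reflect T z) * φ z ∂(cell T) = ∫ z, f (-t) z * φ (reflect T z) ∂(cell T) := by
      intro t
      rw [← integral_reflect T (fun z => f (-t) z * φ (reflect T z))]
      simp only [reflect_reflect]
    refine ⟨?_, ?_⟩
    · have := (IntervalIntegrable.iff_comp_neg (by simp)).1 hi.symm
      simp only [neg_neg] at this
      exact this.neg
    · rw [e, e, intervalIntegral.integral_neg,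
        intervalIntegral.integral_comp_neg (fun t => transportTerm T (f t) (E t) fun z => φ (reflect T z)), ← he]
      ring

end VlasovPoisson

end

theorem theorem5 (s : ℝ) (hs : 3 / 2 < s) (f₀ : ℝ → ℝ)
    (hf₀ : VlasovPoisson.IsProfile f₀) (hcont : Continuous f₀) (hf₀s : VlasovPoisson.MemHs s f₀)
    (T : ℝ) (hT : 0 < T) (hTT₀ : ENNReal.ofReal T < VlasovPoisson.criticalPeriod f₀) :
    ∃ ε₀ : ℝ, 0 < ε₀ ∧
      (∀ (f : ℝ → ℝ × ℝ → ℝ) (E : ℝ → ℝ → ℝ),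
        VlasovPoisson.IsSolution T (Ici 0) f E →
        (∀ t, 0 ≤ t →
          VlasovPoisson.l2HsNorm s T (fun z => f t z - f₀ z.2) < ENNReal.ofReal ε₀) →
        VlasovPoisson.BoundedFiniteEnergy T (f 0) →
        Tendsto (fun t => VlasovPoisson.fieldNorm T (E t)) atTop (𝓝 0)) ∧
      (∀ (f : ℝ → ℝ × ℝ → ℝ) (E : ℝ → ℝ → ℝ),
        VlasovPoisson.IsSolution T (Iic 0) f E →
        (∀ t, t ≤ 0 →
          VlasovPoisson.l2HsNorm s T (fun z => f t z - f₀ z.2) < ENNReal.ofReal ε₀) →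
        VlasovPoisson.BoundedFiniteEnergy T (f 0) →
        Tendsto (fun t => VlasovPoisson.fieldNorm T (E t)) atBot (𝓝 0)) := by
  have h₀ : VlasovPoisson.IsRegularProfile s f₀ := ⟨hs, hf₀, hcont,
    (VlasovPoisson.sobolevSq_le_hsNorm_sq s hf₀.integrable).trans_lt (ENNReal.pow_lt_top hf₀s)⟩
  obtain ⟨ε, hε, hmain⟩ := h₀.exists_damping hT hTT₀
  refine ⟨ε, hε, fun f E h hl _ => hmain f E h hl, fun f E h hl _ => ?_⟩
  have h1 := hmain _ _ h.reverse fun t ht => by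
    refine lt_of_eq_of_lt ?_ (hl (-t) (neg_nonpos.2 ht))
    exact VlasovPoisson.l2HsNorm_reflect T s (fun z => f (-t) z - f₀ z.2)
  simp only [VlasovPoisson.fieldNorm_reflect] at h1
  have h2 := h1.comp tendsto_neg_atBot_atTop
  simpa [Function.comp_def] using h2
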